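/- Let $d\ge 1$, let $\|\cdot\|$ be an arbitrary norm on $\mathbb R^d$, and let $\varphi:[0,\infty)\to[0,\infty)$ be increasing and left continuous with $\lim_{t\downarrow 0}\varphi(t)=0$ and $\varphi\neq 0$ ("increasing" and "decreasing" are meant in the weak sense). For an $\mathbb R^d$-valued random vector $Z$ put $$\|Z\|_\varphi=\inf\{t>0:\ \mathbb E\,\varphi(\|Z\|/t)\le 1\}\in[0,\infty]$$ (with $\inf\emptyset=\infty$). Let $X$ be an $\mathbb R^d$-valued random vector with law $\mu$. For $N\in\mathbb N$ let $$\delta(N|X,\varphi)=\inf_{\hat X}\|X-\hat X\|_\varphi ,$$ where the infimum is over all random vectors $\hat X$ defined on the same probability space as $X$ and taking at most $N$ values. Let $\mu_c$ be the absolutely continuous part of $\mu$ with respect to Lebesgue measure $\lambda^d$, and $h=d\mu_c/d\lambda^d$. Let $U$ be uniformly distributed on $[0,1)^d$ and, for $\eta>0$, let $$g(\eta)=\lim_{N\to\infty}\ \inf_{\mathcal C}\ \mathbb E\,\varphi\Bigl((N/\eta)^{1/d}\min_{y\in \mathcal C}\|U-y\|\Bigr),$$ the infimum being over all non-empty finite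 sets $\mathcal C\subset\mathbb R^d$ with $|\mathcal C|\le N$; put $g(0)=\liminf_{\eta\downarrow 0}g(\eta)\in[0,\infty]$ and $\bar g(t)=\inf_{\eta>0}[g(\eta)+\eta t]$. An increasing function $\Psi:[0,\infty)\to[0,\infty)$ satisfies the growth condition (G) for $\varphi$ if there are a decreasing summable sequence $(\alpha_n)_{n\ge0}$ of positive numbers and an increasing sequence $(r_n)_{n\ge0}$ in $[0,\infty)$, not identically $0$, with $$\sum_{n=0}^\infty \frac{1}{\Psi(r_n)}\,\varphi\bigl(\alpha_n^{-1/d}\,r_{n+1}\bigr)<\infty ,$$ where $1/0=\infty$ and $0\cdot\infty=0$. **Theorem 1.1.** Assume that $\Psi$ satisfies the growth condition (G) for $\varphi$ and that $\mathbb E\,\Psi(\|X\|)<\infty$. Then the limit defining $g(\eta)$ exists and is finite for every $\eta>0$, and $$\lim_{N\to\infty}N^{1/d}\,\delta(N|X,\varphi)=I^{1/d},\qquad I=\inf_\xi\int_{\mathbb R^d}\xi(x)\,dx,$$ where the infimum is over all Lebesgue integrable $\xi:\mathbb R^d\to[0,\infty)$ with $\int_{\mathbb R^d} g(\xi(x))\,d\mu_c(x)\le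 1$; here $I$ is finite and the infimum is attained. Moreover, $$I=\sup_{\kappa>0}\frac1\kappa\Bigl(\int_{\mathbb R^d}\bar g\Bigl(\frac{\kappa}{h(x)}\Bigr)\,d\mu_c(x)-1\Bigr),$$ and $I>0$ if and only if $\mu_c(\mathbb R^d)\,\sup_{t\ge0}\varphi(t)>1$, where $0\cdot\infty=0$. -/

import Mathlib

open MeasureTheory Filter Topology Set
open scoped NNReal ENNReal

namespace OrliczQuantization

noncomputable section

/-- The Orlicz "norm" `‖Z‖_φ = inf {t : E φ(‖Z‖ / t) ≤ 1}` of a random vector `Z`, where `ℝ^d` carries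
the norm `nrm`; the infimum of the empty set is `∞`. Only `t > 0` is used, so that the quotient
makes sense: if `t = 0` is admitted with `0 / 0 = 0`, `c / 0 = ∞` and `φ(∞) = sup φ`, then by
monotonicity of `φ` every `t > 0` is admitted as well, and the infimum is the same. -/
def orliczNorm {d : ℕ} (nrm : Seminorm ℝ (Fin d → ℝ)) (φ : ℝ≥0 → ℝ≥0)
    {Ω : Type*} [MeasurableSpace Ω] (P : Measure Ω) (Z : Ω → Fin d → ℝ) : ℝ≥0∞ :=
  ⨅ (t : ℝ≥0) (_ : 0 < t) (_ : ∫⁻ ω, (φ ((nrm (Z ω)).toNNReal / t) : ℝ≥0∞) ∂P ≤ 1), (t : ℝ≥0∞)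

/-- The quantization error `δ(N|X,φ)`: the infimum of `‖X - X̂‖_φ` over all random vectors `X̂`
whose range has at most `N` elements. -/
def quantError {d : ℕ} (nrm : Seminorm ℝ (Fin d → ℝ)) (φ : ℝ≥0 → ℝ≥0)
    {Ω : Type*} [MeasurableSpace Ω] (P : Measure Ω) (X : Ω → Fin d → ℝ) (N : ℕ) : ℝ≥0∞ :=
  ⨅ (Y : Ω → Fin d → ℝ) (_ : Measurable Y) (_ : (Set.range Y).encard ≤ N),
    orliczNorm nrm φ P (fun ω => X ω - Y ω)

/-- The distance `d(x, C) = min_{y ∈ C} ‖x - y‖` of a point to a non-empty codebook. -/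
def codebookDist {d : ℕ} (nrm : Seminorm ℝ (Fin d → ℝ)) (C : Finset (Fin d → ℝ))
    (hC : C.Nonempty) (x : Fin d → ℝ) : ℝ≥0 :=
  C.inf' hC (fun y => (nrm (x - y)).toNNReal)

/-- The half-open unit cube `[0,1)^d`. -/
def unitCube (d : ℕ) : Set (Fin d → ℝ) := Set.univ.pi (fun _ => Set.Ico (0 : ℝ) 1)

/-- `f_N(η) = inf_C E φ((N/η)^{1/d} d(U, C))`, where `U` is uniformly distributed on the unit cube
and `C` ranges over the non-empty codebooks with at most `N` points. -/
def cubeError {d : ℕ} (nrm : Seminorm ℝ (Fin d → ℝ)) (φ : ℝ≥0 → ℝ≥0) (N : ℕ) (η : ℝ≥0) : ℝ≥0∞ :=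
  ⨅ (C : Finset (Fin d → ℝ)) (hC : C.Nonempty) (_ : C.card ≤ N),
    ∫⁻ x in unitCube d, (φ (((N : ℝ≥0) / η) ^ ((d : ℝ)⁻¹) * codebookDist nrm C hC x) : ℝ≥0∞)

/-- `lim_{N → ∞} f_N(η)`, written as an upper limit; that the limit exists for `η > 0` is
a claim of the theorem and not part of this definition. -/
def complexityPos {d : ℕ} (nrm : Seminorm ℝ (Fin d → ℝ)) (φ : ℝ≥0 → ℝ≥0) (η : ℝ≥0) : ℝ≥0∞ :=
  limsup (fun N : ℕ => cubeError nrm φ N η) atTop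

/-- The function `g`: `g(η) = lim_{N → ∞} f_N(η)` for `η > 0`, and
`g(0) = liminf_{η ↓ 0} g(η) ∈ [0, ∞]`. -/
def complexity {d : ℕ} (nrm : Seminorm ℝ (Fin d → ℝ)) (φ : ℝ≥0 → ℝ≥0) (η : ℝ≥0) : ℝ≥0∞ :=
  if η = 0 then liminf (complexityPos nrm φ) (𝓝[>] 0) else complexityPos nrm φ η

/-- `ḡ(t) = inf_{η > 0} [g(η) + η t]`. -/
def complexityBar {d : ℕ} (nrm : Seminorm ℝ (Fin d → ℝ)) (φ : ℝ≥0 → ℝ≥0) (t : ℝ≥0∞) : ℝ≥0∞ :=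
  ⨅ (η : ℝ≥0) (_ : 0 < η), complexity nrm φ η + (η : ℝ≥0∞) * t

/-- The Lebesgue density `h = dμ_c/dλ^d` of the absolutely continuous part of `μ`. -/
def acDensity {d : ℕ} (μ : Measure (Fin d → ℝ)) : (Fin d → ℝ) → ℝ≥0∞ :=
  μ.rnDeriv volume

/-- The absolutely continuous part `μ_c` of `μ` with respect to Lebesgue measure. -/
def acPart {d : ℕ} (μ : Measure (Fin d → ℝ)) : Measure (Fin d → ℝ) :=
  volume.withDensity (acDensity μ)

/-- Admissible point allocations: non-negative Lebesgue integrable `ξ` with `∫ g(ξ) dμ_c ≤ 1`. -/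
def IsAdmissible {d : ℕ} (nrm : Seminorm ℝ (Fin d → ℝ)) (φ : ℝ≥0 → ℝ≥0)
    (μ : Measure (Fin d → ℝ)) (ξ : (Fin d → ℝ) → ℝ≥0) : Prop :=
  Integrable (fun x => (ξ x : ℝ)) volume ∧ ∫⁻ x, complexity nrm φ (ξ x) ∂(acPart μ) ≤ 1

/-- The value `I = inf_ξ ∫ ξ(x) dx` of the point allocation problem. -/
def allocValue {d : ℕ} (nrm : Seminorm ℝ (Fin d → ℝ)) (φ : ℝ≥0 → ℝ≥0)
    (μ : Measure (Fin d → ℝ)) : ℝ≥0∞ :=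
  ⨅ (ξ : (Fin d → ℝ) → ℝ≥0) (_ : IsAdmissible nrm φ μ ξ), ∫⁻ x, (ξ x : ℝ≥0∞)

/-- The growth condition (G) for `φ` in dimension `d`: there are a positive decreasing summable
sequence `α` and an increasing sequence `r` in `[0, ∞)`, not identically zero, with
`∑ φ(α_n^{-1/d} r_{n+1}) / Ψ(r_n) < ∞`. The quotient is taken in `[0, ∞]`, with `c / 0 = ∞`
for `c > 0` and `0 / 0 = 0`. -/
def GrowthCondition (d : ℕ) (φ Ψ : ℝ≥0 → ℝ≥0) : Prop :=
  ∃ α r : ℕ → ℝ≥0, (∀ n, 0 < α n) ∧ Antitone α ∧ Summable α ∧ Monotone r ∧ (∃ n, 0 < r n) ∧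
    ∑' n, (φ (α n ^ (-(d : ℝ)⁻¹) * r (n + 1)) : ℝ≥0∞) / (Ψ (r n) : ℝ≥0∞) < ∞

end

end OrliczQuantization

open OrliczQuantization

/-! Write s = 1/t for the reciprocal of the Orlicz level. A quantizer with N values has error at
most 1/s essentially when some N points satisfy ∫ φ(s · dist(x, C)) dμ ≤ 1. With N = η s^d, the
asymptotic claim says that I is the threshold for those η at which distortion 1 is possible at large
scales. `Achievable` records pairs (distortion, points per s^d); these add up over sums of measures,
because codebooks can be united.

Uniform distribution. `limErr` is an infimum over all scales. Shrunken copies of one good codebook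
tile the cube at every larger scale, so the infimum is also the limit, and it equals g on η > 0.
Using one density on a single half-size subcube and another on the remaining ones forces the
one-sided limits of g to agree. Counting the volume near the codepoints gives g(0) = sup φ.

Upper bound. On a large cube the absolutely continuous part is cut into pieces on which a simple
approximation of h and a discretization of ξ are constant; each piece is nearly exhausted by small
cells carrying rescaled codebooks. The singular part lies, up to small mass, in an open set of tiny
volume, where a fine grid costs few points. Far out, the shell r_n ≤ ‖x‖ < r_{n+1} receives about
α_n s^d points, and the growth condition sums the resulting distortions (`exists_achievable_tail`).

Lower bound. Charge a price κ per point. A cube of constant mass density a then costs at least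
`densityCost` per unit volume. This passes to bounded sets by serving the complement optimally, to
finitely many disjoint compact sets because separated sets hardly share codepoints, and to a general
density by simple functions (`lintegral_densityCost_le`). Thus a pair (b, η) occurring at
arbitrarily large scales satisfies dual(κ) ≤ b + κ η for all κ.

Duality. No convexity of g is needed. Minimizers of η ↦ a g(η) + η increase with a. At a critical
price the largest minimizers meet the error level and the smallest ones overshoot it; taking one
kind on a half space and the other kind outside hits the level exactly, since the measures involved
do not charge hyperplanes. The result has no duality gap (`exists_optimal_density`). Attainment, the
dual formula and the converse "if dual(κ) ≤ 1 + κ η for all κ, then I ≤ η" follow, and the converse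
closes the lower bound. For the upper bound, a little slack in the error is bought at small extra
cost (`achievable_of_allocValue_lt`). -/

namespace OrliczQuantization

/-! ### Codebook distortion, achievable pairs and cubes -/

/-- The pointwise distortion `min_{y ∈ C} φ(s ‖x - y‖)` of a codebook at scale `s`; it is `∞` for
the empty codebook. -/
noncomputable def err {d : ℕ} (nrm : Seminorm ℝ (Fin d → ℝ)) (φ : ℝ≥0 → ℝ≥0) (s : ℝ≥0)
    (C : Finset (Fin d → ℝ)) (x : Fin d → ℝ) : ℝ≥0∞ :=
  ⨅ y ∈ C, (φ (s * (nrm (x - y)).toNNReal) : ℝ≥0∞)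

/-- The pair `(e, η)` is asymptotically achievable for `m`: at every large scale `s` some codebook
with at most `η s ^ d` points has distortion at most `e`. -/
def Achievable {d : ℕ} (nrm : Seminorm ℝ (Fin d → ℝ)) (φ : ℝ≥0 → ℝ≥0)
    (m : Measure (Fin d → ℝ)) (e η : ℝ≥0∞) : Prop :=
  ∀ᶠ s : ℝ≥0 in atTop, ∃ C : Finset (Fin d → ℝ),
    (C.card : ℝ≥0∞) ≤ η * (s : ℝ≥0∞) ^ d ∧ ∫⁻ x, err nrm φ s C x ∂m ≤ e

/-- The half-open cube with lower corner `v` and side length `l`. -/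
def box {d : ℕ} (v : Fin d → ℝ) (l : ℝ) : Set (Fin d → ℝ) :=
  Set.univ.pi fun i => Set.Ico (v i) (v i + l)

/-- `c` bounds `nrm` and the sup norm in terms of each other. -/
structure NormBound {d : ℕ} (nrm : Seminorm ℝ (Fin d → ℝ)) (c : ℝ≥0) : Prop where
  pos : 0 < c
  le_mul : ∀ x, nrm x ≤ c * ‖x‖
  norm_le : ∀ x, ‖x‖ ≤ c * nrm x

/-! ### Equivalence of the given norm and the sup norm -/

section Norm
variable {d : ℕ} {nrm : Seminorm ℝ (Fin d → ℝ)} {φ : ℝ≥0 → ℝ≥0}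

lemma exists_seminorm_le_mul_norm (nrm : Seminorm ℝ (Fin d → ℝ)) :
    ∃ c : ℝ≥0, ∀ x, nrm x ≤ c * ‖x‖ := by
  classical
  refine ⟨∑ i, (nrm (Pi.single i 1)).toNNReal, fun x => ?_⟩
  have hx : x = ∑ i, x i • (Pi.single i (1 : ℝ) : Fin d → ℝ) := by
    ext j
    simp [Finset.sum_apply, Pi.single_apply]
  calc nrm x = nrm (∑ i, x i • (Pi.single i (1 : ℝ) : Fin d → ℝ)) := by rw [← hx]
    _ ≤ ∑ i, nrm (x i • (Pi.single i (1 : ℝ) : Fin d → ℝ)) :=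
        Finset.le_sum_of_subadditive nrm (map_zero nrm).le (map_add_le_add _) _ _
    _ ≤ ∑ i, nrm (Pi.single i 1) * ‖x‖ := by
        refine Finset.sum_le_sum fun i _ => ?_
        rw [map_smul_eq_mul, mul_comm]
        exact mul_le_mul_of_nonneg_left (norm_le_pi_norm x i) (apply_nonneg _ _)
    _ = _ := by
        rw [← Finset.sum_mul]
        push_cast
        congr 1
        exact Finset.sum_congr rfl fun i _ => (Real.coe_toNNReal _ (apply_nonneg _ _)).symm

lemma seminorm_continuous (nrm : Seminorm ℝ (Fin d → ℝ)) : Continuous nrm := by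
  obtain ⟨c, hc⟩ := exists_seminorm_le_mul_norm nrm
  refine (LipschitzWith.of_dist_le_mul (K := c) fun x y => ?_).continuous
  rw [Real.dist_eq, dist_eq_norm]
  exact (abs_sub_map_le_sub nrm x y).trans (hc _)

lemma exists_normBound (hd : 0 < d) (hnrm : ∀ x, nrm x = 0 → x = 0) :
    ∃ c, NormBound nrm c := by
  obtain ⟨c, hc⟩ := exists_seminorm_le_mul_norm nrm
  have : Nonempty (Fin d) := ⟨⟨0, hd⟩⟩
  obtain ⟨z, hz, hmin⟩ := (isCompact_sphere (0 : Fin d → ℝ) 1).exists_isMinOn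
    (NormedSpace.sphere_nonempty.2 zero_le_one) (seminorm_continuous nrm).continuousOn
  have hz0 : 0 < nrm z := by
    refine lt_of_le_of_ne (apply_nonneg _ _) fun h => ?_
    have := hnrm z h.symm
    simp [this] at hz
  have hlow : ∀ x, ‖x‖ ≤ (nrm z)⁻¹ * nrm x := fun x => by
    rcases eq_or_ne x 0 with rfl | hx
    · simp
    have hx' : 0 < ‖x‖ := norm_pos_iff.2 hx
    have hmem : ‖x‖⁻¹ • x ∈ Metric.sphere (0 : Fin d → ℝ) 1 := by
      simp [norm_smul, hx'.ne']
    have h1 := hmin hmem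
    simp only [mem_ofPred_eq, map_smul_eq_mul, norm_inv, norm_norm] at h1
    rw [inv_mul_eq_div, le_div_iff₀ hx'] at h1
    rw [inv_mul_eq_div, le_div_iff₀ hz0]
    linarith
  refine ⟨c + (nrm z)⁻¹.toNNReal, ?_, fun x => (hc x).trans ?_, fun x => (hlow x).trans ?_⟩
  · have : 0 < (nrm z)⁻¹.toNNReal := Real.toNNReal_pos.2 (inv_pos.2 hz0)
    positivity
  · gcongr
    simp
  · gcongr
    rw [NNReal.coe_add, Real.coe_toNNReal _ (inv_nonneg.2 hz0.le)]
    simp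

end Norm

/-! ### Elementary rules for the distortion -/

section Err
variable {d : ℕ} {nrm : Seminorm ℝ (Fin d → ℝ)} {φ : ℝ≥0 → ℝ≥0}

lemma err_le {s : ℝ≥0} {C : Finset (Fin d → ℝ)} {y : Fin d → ℝ} (hy : y ∈ C) (x : Fin d → ℝ) :
    err nrm φ s C x ≤ φ (s * (nrm (x - y)).toNNReal) :=
  iInf₂_le y hy

lemma err_anti {s : ℝ≥0} {C C' : Finset (Fin d → ℝ)} (h : C ⊆ C') (x : Fin d → ℝ) :
    err nrm φ s C' x ≤ err nrm φ s C x :=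
  le_iInf₂ fun _ hy => err_le (h hy) x

lemma err_mono (hφ : Monotone φ) {s s' : ℝ≥0} (h : s ≤ s') (C : Finset (Fin d → ℝ))
    (x : Fin d → ℝ) : err nrm φ s C x ≤ err nrm φ s' C x :=
  iInf₂_mono fun _ _ => by
    gcongr
    apply hφ
    gcongr

lemma measurable_err (hφ : Monotone φ) (s : ℝ≥0) (C : Finset (Fin d → ℝ)) :
    Measurable (err nrm φ s C) := by
  unfold err
  refine Measurable.biInf _ C.countable_toSet fun y _ => ?_
  have h1 : Measurable fun x : Fin d → ℝ => s * (nrm (x - y)).toNNReal :=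
    (continuous_const.mul (continuous_real_toNNReal.comp
      ((seminorm_continuous nrm).comp (continuous_id.sub continuous_const)))).measurable
  exact (hφ.measurable.comp h1).coe_nnreal_ennreal

lemma err_empty (s : ℝ≥0) (x : Fin d → ℝ) : err nrm φ s ∅ x = ∞ := by
  simp [err]

/-- An increasing function commutes with a finite minimum; non-emptiness matters since the empty
infimum is `∞`. -/
lemma err_eq_codebookDist (hφ : Monotone φ) (s : ℝ≥0) (C : Finset (Fin d → ℝ)) (hC : C.Nonempty)
    (x : Fin d → ℝ) : err nrm φ s C x = φ (s * codebookDist nrm C hC x) := by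
  apply le_antisymm
  · obtain ⟨y, hy, h⟩ := Finset.exists_mem_eq_inf' hC fun y => (nrm (x - y)).toNNReal
    rw [codebookDist, h]
    exact err_le hy x
  · refine le_iInf₂ fun y hy => ?_
    gcongr
    apply hφ
    gcongr
    exact Finset.inf'_le _ hy

/-- Shrinking space by `l` has the same effect as multiplying the scale by `l`. -/
lemma err_image [DecidableEq (Fin d → ℝ)] (s l : ℝ≥0) (v x : Fin d → ℝ)
    (C : Finset (Fin d → ℝ)) :
    err nrm φ s (C.image fun y => v + (l : ℝ) • y) (v + (l : ℝ) • x) = err nrm φ (s * l) C x := by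
  have key : ∀ y : Fin d → ℝ, s * (nrm (v + (l : ℝ) • x - (v + (l : ℝ) • y))).toNNReal
      = s * l * (nrm (x - y)).toNNReal := fun y => by
    rw [add_sub_add_left_eq_sub, ← smul_sub, map_smul_eq_mul, Real.norm_of_nonneg l.coe_nonneg,
      Real.toNNReal_mul l.coe_nonneg, Real.toNNReal_coe, mul_assoc]
  refine le_antisymm (le_iInf₂ fun y hy => ?_) (le_iInf₂ fun z hz => ?_)
  · rw [← key]
    exact err_le (Finset.mem_image_of_mem _ hy) _
  · obtain ⟨y, hy, rfl⟩ := Finset.mem_image.1 hz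
    rw [key]
    exact err_le hy _

end Err

/-! ### Calculus of achievable pairs -/

section Achievable
variable {d : ℕ} {nrm : Seminorm ℝ (Fin d → ℝ)} {φ : ℝ≥0 → ℝ≥0}
  {m m' : Measure (Fin d → ℝ)} {e e' η η' : ℝ≥0∞}

lemma Achievable.mono (h : Achievable nrm φ m e η) (hm : m' ≤ m) (he : e ≤ e') (hη : η ≤ η') :
    Achievable nrm φ m' e' η' := by
  filter_upwards [h] with s ⟨C, hC, hCe⟩
  exact ⟨C, hC.trans (by gcongr), (lintegral_mono' hm le_rfl).trans (hCe.trans he)⟩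

lemma lintegral_err_union_le [DecidableEq (Fin d → ℝ)] (s : ℝ≥0) (C C' : Finset (Fin d → ℝ)) :
    ∫⁻ x, err nrm φ s (C ∪ C') x ∂(m + m')
      ≤ ∫⁻ x, err nrm φ s C x ∂m + ∫⁻ x, err nrm φ s C' x ∂m' := by
  rw [lintegral_add_measure]
  exact add_le_add (lintegral_mono fun x => err_anti Finset.subset_union_left x)
    (lintegral_mono fun x => err_anti Finset.subset_union_right x)

/-- The union of the two codebooks serves each measure at least as well as its own codebook does. -/
lemma Achievable.add (h : Achievable nrm φ m e η) (h' : Achievable nrm φ m' e' η') :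
    Achievable nrm φ (m + m') (e + e') (η + η') := by
  classical
  filter_upwards [h, h'] with s ⟨C, hC, hCe⟩ ⟨C', hC', hCe'⟩
  refine ⟨C ∪ C', ?_, (lintegral_err_union_le s C C').trans (add_le_add hCe hCe')⟩
  calc ((C ∪ C').card : ℝ≥0∞) ≤ C.card + C'.card := by exact_mod_cast Finset.card_union_le C C'
    _ ≤ _ := by rw [add_mul]; gcongr

lemma Achievable.zero : Achievable nrm φ 0 0 0 :=
  Eventually.of_forall fun s => ⟨∅, by simp, by simp⟩

lemma Achievable.sum {ι : Type*} (t : Finset ι) {m : ι → Measure (Fin d → ℝ)} {e η : ι → ℝ≥0∞}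
    (h : ∀ i ∈ t, Achievable nrm φ (m i) (e i) (η i)) :
    Achievable nrm φ (∑ i ∈ t, m i) (∑ i ∈ t, e i) (∑ i ∈ t, η i) := by
  classical
  induction t using Finset.induction_on with
  | empty => simpa using Achievable.zero
  | insert i t hi ih =>
    rw [Finset.sum_insert hi, Finset.sum_insert hi, Finset.sum_insert hi]
    exact (h i (by simp)).add (ih fun j hj => h j (by simp [hj]))

lemma Achievable.smul (h : Achievable nrm φ m e η) (a : ℝ≥0∞) :
    Achievable nrm φ (a • m) (a * e) η := by
  filter_upwards [h] with s ⟨C, hC, hCe⟩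
  refine ⟨C, hC, ?_⟩
  rw [lintegral_smul_measure, smul_eq_mul]
  gcongr

end Achievable

/-! ### Half-open cubes, their subdivision and affine changes of variables -/

section Box
variable {d : ℕ}

lemma measurableSet_box (v : Fin d → ℝ) (l : ℝ) : MeasurableSet (box v l) :=
  MeasurableSet.univ_pi fun _ => measurableSet_Ico

lemma volume_box (v : Fin d → ℝ) (l : ℝ≥0) : volume (box v l) = (l : ℝ≥0∞) ^ d := by
  simp [box, Real.volume_pi_Ico]

lemma unitCube_eq_box : unitCube d = box 0 1 := by simp [unitCube, box]

lemma norm_sub_le_of_mem_box {v x : Fin d → ℝ} {l : ℝ≥0} (hx : x ∈ box v l) : ‖x - v‖ ≤ l := by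
  rw [pi_norm_le_iff_of_nonneg l.coe_nonneg]
  intro i
  have := hx i (mem_univ i)
  rw [Pi.sub_apply, Real.norm_eq_abs, abs_of_nonneg (by linarith [this.1])]
  have h2 := this.2
  show _ ≤ (l : ℝ)
  linarith

lemma exists_mem_subbox {v x : Fin d → ℝ} {l : ℝ≥0} {n : ℕ} (hn : 0 < n) (hx : x ∈ box v l) :
    ∃ j : Fin d → Fin n, x ∈ box (v + fun i => ((l / n : ℝ≥0) : ℝ) * (j i : ℕ)) ((l / n : ℝ≥0) : ℝ) := by
  have hn' : (0 : ℝ) < n := by exact_mod_cast hn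
  rcases eq_or_ne d 0 with rfl | hd
  · exact ⟨fun i => i.elim0, fun i => i.elim0⟩
  have hl : (0 : ℝ) < l := by
    have := hx ⟨0, Nat.pos_of_ne_zero hd⟩ (mem_univ _)
    linarith [this.1, this.2]
  have hln : (0 : ℝ) < l / n := by positivity
  have h1 : ∀ i, 0 ≤ (x i - v i) / (l / n) := fun i =>
    div_nonneg (by linarith [(hx i (mem_univ i)).1]) hln.le
  have h2 : ∀ i, (x i - v i) / (l / n) < n := fun i => by
    rw [div_lt_iff₀ hln]
    have := (hx i (mem_univ i)).2
    field_simp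
    linarith
  refine ⟨fun i => ⟨⌊(x i - v i) / (l / n)⌋₊, (Nat.floor_lt (h1 i)).2 (h2 i)⟩, fun i _ => ?_⟩
  have h3 := Nat.floor_le (h1 i)
  have h4 := Nat.lt_floor_add_one ((x i - v i) / (l / n))
  rw [le_div_iff₀ hln] at h3
  rw [div_lt_iff₀ hln] at h4
  simp only [Pi.add_apply, NNReal.coe_div, NNReal.coe_natCast, mem_Ico]
  constructor <;> nlinarith

lemma preimage_box {v : Fin d → ℝ} {l : ℝ≥0} (hl : 0 < l) :
    (fun y => v + (l : ℝ) • y) ⁻¹' box v l = unitCube d := by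
  have hl' : (0 : ℝ) < l := hl
  ext y
  simp only [box, unitCube, mem_preimage, mem_univ_pi, mem_Ico, Pi.add_apply, Pi.smul_apply,
    smul_eq_mul, add_lt_add_iff_left, le_add_iff_nonneg_right]
  refine forall_congr' fun i => ?_
  rw [mul_nonneg_iff_of_pos_left hl', mul_lt_iff_lt_one_right hl']

lemma setLIntegral_box {f : (Fin d → ℝ) → ℝ≥0∞} (hf : Measurable f) (v : Fin d → ℝ) {l : ℝ≥0}
    (hl : 0 < l) :
    ∫⁻ x in box v l, f x = (l : ℝ≥0∞) ^ d * ∫⁻ y in unitCube d, f (v + (l : ℝ) • y) := by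
  have hl' : (0 : ℝ) < l := hl
  have hT : Measurable fun y : Fin d → ℝ => v + (l : ℝ) • y := by fun_prop
  have hmap : Measure.map (fun y : Fin d → ℝ => v + (l : ℝ) • y) volume
      = ((l : ℝ≥0∞) ^ d)⁻¹ • volume := by
    have h1 : (fun y : Fin d → ℝ => v + (l : ℝ) • y) = (fun y => v + y) ∘ fun y => (l : ℝ) • y := rfl
    rw [h1, ← Measure.map_map (by fun_prop) (by fun_prop), Measure.map_addHaar_smul _ hl'.ne',
      Measure.map_smul, (measurePreserving_add_left volume v).map_eq]
    congr 1
    rw [Module.finrank_fin_fun, abs_of_pos (by positivity), ENNReal.ofReal_inv_of_pos (by positivity),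
      ENNReal.ofReal_pow hl'.le, ENNReal.ofReal_coe_nnreal]
  have h0 : (l : ℝ≥0∞) ^ d ≠ 0 := by
    have : (l : ℝ≥0∞) ≠ 0 := by simpa using hl.ne'
    exact pow_ne_zero _ this
  have ht : (l : ℝ≥0∞) ^ d ≠ ∞ := by finiteness
  rw [← preimage_box (v := v) hl, ← lintegral_indicator (hT (measurableSet_box v l)),
    ← lintegral_indicator (measurableSet_box v l)]
  have h2 : ∀ y : Fin d → ℝ, indicator ((fun y => v + (l : ℝ) • y) ⁻¹' box v l)
      (fun y => f (v + (l : ℝ) • y)) y = (indicator (box v l) f) (v + (l : ℝ) • y) := fun y => rfl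
  simp only [h2]
  rw [← lintegral_map (hf.indicator (measurableSet_box v l)) hT, hmap, lintegral_smul_measure,
    smul_eq_mul, ← mul_assoc, ENNReal.mul_inv_cancel h0 ht, one_mul]

end Box

end OrliczQuantization
-- The uniform distribution: existence, continuity and boundary value of g
namespace OrliczQuantization

/-- The least distortion of the uniform distribution on the unit cube at point density `η`. -/
noncomputable def limErr {d : ℕ} (nrm : Seminorm ℝ (Fin d → ℝ)) (φ : ℝ≥0 → ℝ≥0) (η : ℝ≥0) :
    ℝ≥0∞ :=
  ⨅ (s : ℝ≥0) (_ : 0 < s) (C : Finset (Fin d → ℝ))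
    (_ : (C.card : ℝ≥0∞) ≤ (η : ℝ≥0∞) * (s : ℝ≥0∞) ^ d), ∫⁻ x in unitCube d, err nrm φ s C x

variable {d : ℕ} {nrm : Seminorm ℝ (Fin d → ℝ)} {φ : ℝ≥0 → ℝ≥0}

lemma tendsto_const_div_nnreal_atTop (a : ℝ≥0) :
    Tendsto (fun s : ℝ≥0 => a / s) atTop (𝓝 0) := by
  rw [← NNReal.tendsto_coe]
  push_cast
  exact Tendsto.const_div_atTop (NNReal.tendsto_coe_atTop.2 tendsto_id) (a : ℝ)

lemma volume_unitCube : volume (unitCube d) = 1 := by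
  have := volume_box (0 : Fin d → ℝ) 1
  rw [unitCube_eq_box]
  simpa using this

lemma nonempty_of_setLIntegral_err_lt_top {s : ℝ≥0} {C : Finset (Fin d → ℝ)}
    {m : Measure (Fin d → ℝ)} (hm : m ≠ 0) (h : ∫⁻ x, err nrm φ s C x ∂m < ∞) : C.Nonempty := by
  rw [Finset.nonempty_iff_ne_empty]
  rintro rfl
  simp only [err_empty, lintegral_const] at h
  rw [ENNReal.top_mul (by simpa using hm)] at h
  exact lt_irrefl _ h

lemma limErr_le {η s : ℝ≥0} (hs : 0 < s) {C : Finset (Fin d → ℝ)}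
    (hC : (C.card : ℝ≥0∞) ≤ (η : ℝ≥0∞) * (s : ℝ≥0∞) ^ d) :
    limErr nrm φ η ≤ ∫⁻ x in unitCube d, err nrm φ s C x :=
  (iInf₂_le s hs).trans (iInf₂_le C hC)

lemma limErr_lt_iff {η : ℝ≥0} {e : ℝ≥0∞} : limErr nrm φ η < e ↔ ∃ s : ℝ≥0, 0 < s ∧
    ∃ C : Finset (Fin d → ℝ), (C.card : ℝ≥0∞) ≤ (η : ℝ≥0∞) * (s : ℝ≥0∞) ^ d ∧
      ∫⁻ x in unitCube d, err nrm φ s C x < e := by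
  simp [limErr, iInf_lt_iff]

lemma limErr_antitone : Antitone (limErr nrm φ) := fun a b hab => by
  refine le_iInf₂ fun s hs => le_iInf₂ fun C hC => limErr_le hs (hC.trans ?_)
  gcongr

lemma setLIntegral_box_err_image [DecidableEq (Fin d → ℝ)] (hφ : Monotone φ) (v : Fin d → ℝ)
    {l : ℝ≥0} (hl : 0 < l) (s : ℝ≥0) (C : Finset (Fin d → ℝ)) :
    ∫⁻ x in box v l, err nrm φ s (C.image fun y => v + (l : ℝ) • y) x
      = (l : ℝ≥0∞) ^ d * ∫⁻ x in unitCube d, err nrm φ (s * l) C x := by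
  rw [setLIntegral_box (measurable_err hφ _ _) v hl]
  simp only [err_image]

/-- A codebook at any scale does no better on a cube than the limiting distortion at its density. -/
lemma limErr_box_le (hφ : Monotone φ) (v : Fin d → ℝ) {l : ℝ≥0} (hl : 0 < l) {s : ℝ≥0}
    (hs : 0 < s) {η : ℝ≥0} {C : Finset (Fin d → ℝ)}
    (hC : (C.card : ℝ≥0∞) ≤ (η : ℝ≥0∞) * ((s * l : ℝ≥0) : ℝ≥0∞) ^ d) :
    (l : ℝ≥0∞) ^ d * limErr nrm φ η ≤ ∫⁻ x in box v l, err nrm φ s C x := by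
  classical
  have hl' : (l : ℝ) ≠ 0 := by exact_mod_cast hl.ne'
  have hCC : C = (C.image fun y => (l : ℝ)⁻¹ • (y - v)).image fun y => v + (l : ℝ) • y := by
    rw [Finset.image_image]
    have : ((fun y => v + (l : ℝ) • y) ∘ fun y : Fin d → ℝ => (l : ℝ)⁻¹ • (y - v)) = id := by
      ext1 y
      simp [smul_smul, hl']
    rw [this, Finset.image_id]
  rw [hCC, setLIntegral_box_err_image hφ v hl]
  gcongr
  refine limErr_le (mul_pos hs hl) (le_trans ?_ hC)
  exact_mod_cast Finset.card_image_le

/-- Scaled copies of codebooks for the unit cube are put into the cells of a regular grid. -/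
lemma exists_codebook_tiling (hφ : Monotone φ) {n : ℕ} (hn : 0 < n) (s : ℝ≥0)
    (C : (Fin d → Fin n) → Finset (Fin d → ℝ)) :
    ∃ C' : Finset (Fin d → ℝ), C'.card ≤ ∑ j, (C j).card ∧
      ∫⁻ x in unitCube d, err nrm φ s C' x
        ≤ ∑ j, ((n : ℝ≥0∞) ^ d)⁻¹ * ∫⁻ x in unitCube d, err nrm φ (s / n) (C j) x := by
  classical
  have hn0 : (n : ℝ≥0) ≠ 0 := by exact_mod_cast hn.ne'
  have hl : (0 : ℝ≥0) < 1 / n := by positivity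
  let v : (Fin d → Fin n) → Fin d → ℝ := fun j => 0 + fun i => ((1 / n : ℝ≥0) : ℝ) * (j i : ℕ)
  refine ⟨Finset.univ.biUnion fun j => (C j).image fun y => v j + ((1 / n : ℝ≥0) : ℝ) • y,
    Finset.card_biUnion_le.trans (Finset.sum_le_sum fun j _ => Finset.card_image_le), ?_⟩
  have hcov : unitCube d ⊆ ⋃ j, box (v j) ((1 / n : ℝ≥0) : ℝ) := fun x hx => by
    rw [unitCube_eq_box] at hx
    obtain ⟨j, hj⟩ := exists_mem_subbox (l := 1) hn (by simpa using hx)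
    exact mem_iUnion.2 ⟨j, hj⟩
  refine (lintegral_mono_set hcov).trans ((lintegral_iUnion_le _ _).trans ?_)
  rw [tsum_fintype]
  refine Finset.sum_le_sum fun j _ => ?_
  refine (lintegral_mono fun x => err_anti (Finset.subset_biUnion_of_mem (fun j =>
    (C j).image fun y => v j + ((1 / n : ℝ≥0) : ℝ) • y) (Finset.mem_univ j)) x).trans ?_
  rw [setLIntegral_box_err_image hφ (v j) hl]
  refine le_of_eq ?_
  congr 1
  · rw [ENNReal.coe_div hn0, ENNReal.inv_pow]
    simp
  · rw [mul_one_div]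

/-- Self-similarity: a codebook that is good at one scale `s₀` is copied into n^d cells to work at
any large scale. Rounding n up costs a factor of at most (1 + s₀/s)^d, which tends to 1 and is
absorbed by `η' < η`. -/
lemma exists_codebook_replicate (hφ : Monotone φ) {s₀ η' η : ℝ≥0} (hs₀ : 0 < s₀) (hη : η' < η)
    {C : Finset (Fin d → ℝ)} (hC : (C.card : ℝ≥0∞) ≤ (η' : ℝ≥0∞) * (s₀ : ℝ≥0∞) ^ d) :
    Achievable nrm φ (volume.restrict (unitCube d)) (∫⁻ x in unitCube d, err nrm φ s₀ C x) η := by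
  have hlim : Tendsto (fun s : ℝ≥0 => η' * (1 + s₀ / s) ^ d) atTop (𝓝 (η' * (1 + 0) ^ d)) := by
    refine Tendsto.const_mul _ (Tendsto.pow (Tendsto.const_add _ ?_) _)
    exact tendsto_const_div_nnreal_atTop s₀
  have hev := hlim.eventually_lt_const (u := η) (by simpa using hη)
  filter_upwards [hev, eventually_gt_atTop 0] with s hs hs0
  -- Rounding up makes the scale s/n inside a cell at most `s₀`, so the distortion of `C` can only
  -- drop.
  set n := ⌈s / s₀⌉₊ with hn_def
  have hn : 0 < n := Nat.ceil_pos.2 (by positivity)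
  have hn0 : (n : ℝ≥0∞) ≠ 0 := by exact_mod_cast hn.ne'
  have hsn : s / n ≤ s₀ := by
    have := Nat.le_ceil (s / s₀)
    rw [div_le_iff₀ hs₀] at this
    rw [div_le_iff₀ (by exact_mod_cast hn)]
    rwa [mul_comm]
  obtain ⟨C', hC', hC'e⟩ := exists_codebook_tiling (nrm := nrm) hφ hn s fun _ => C
  refine ⟨C', ?_, hC'e.trans ?_⟩
  · have h1 : (C'.card : ℝ≥0) ≤ n ^ d * C.card := by
      have : (C'.card : ℝ≥0) ≤ ∑ _j : Fin d → Fin n, (C.card : ℝ≥0) := by exact_mod_cast hC'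
      simpa using this
    have h2 : (n : ℝ≥0) ≤ s / s₀ + 1 := (Nat.ceil_lt_add_one zero_le).le
    have h3 : (C.card : ℝ≥0) ≤ η' * s₀ ^ d := by exact_mod_cast hC
    have h4 : (C'.card : ℝ≥0) ≤ η * s ^ d := by
      calc (C'.card : ℝ≥0) ≤ (s / s₀ + 1) ^ d * (η' * s₀ ^ d) := h1.trans (by gcongr)
        _ = η' * ((s / s₀ + 1) * s₀) ^ d := by rw [mul_pow]; ring
        _ = η' * ((1 + s₀ / s) * s) ^ d := by
            congr 2
            field_simp
        _ = (η' * (1 + s₀ / s) ^ d) * s ^ d := by rw [mul_pow]; ring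
        _ ≤ _ := by gcongr
    exact_mod_cast h4
  · rw [Finset.sum_const, Finset.card_univ, Fintype.card_fun, Fintype.card_fin, Fintype.card_fin,
      nsmul_eq_mul, ← mul_assoc]
    push_cast
    rw [ENNReal.mul_inv_cancel (pow_ne_zero _ hn0) (by finiteness), one_mul]
    exact lintegral_mono fun x => err_mono hφ hsn C x

lemma achievable_unitCube (hφ : Monotone φ) {η' η : ℝ≥0} (hη : η' < η) {e : ℝ≥0∞}
    (he : limErr nrm φ η' < e) : Achievable nrm φ (volume.restrict (unitCube d)) e η := by
  obtain ⟨s₀, hs₀, C, hC, hCe⟩ := limErr_lt_iff.1 he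
  exact (exists_codebook_replicate hφ hs₀ hη hC).mono le_rfl hCe.le le_rfl

/-- Of the 2^d half-size subcubes one is served at density `b` and the other `k` at density `a`.
Inside the subcubes the scale is `s` while for the whole cube it is `2 * s`, so the total density is
the average of the densities. -/
lemma limErr_mixing (hφ : Monotone φ) {a b c : ℝ≥0} {k : ℕ} (hk : k + 1 = 2 ^ d)
    (hc : k * a + b ≤ (k + 1 : ℕ) * c) {e₁ e₂ : ℝ≥0∞}
    (h₁ : Achievable nrm φ (volume.restrict (unitCube d)) e₁ a)
    (h₂ : Achievable nrm φ (volume.restrict (unitCube d)) e₂ b) :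
    (k + 1 : ℕ) * limErr nrm φ c ≤ k * e₁ + e₂ := by
  classical
  obtain ⟨s, hs, ⟨C₁, hC₁, he₁⟩, ⟨C₂, hC₂, he₂⟩⟩ :=
    ((eventually_gt_atTop (0 : ℝ≥0)).and (h₁.and h₂)).exists
  let j₀ : Fin d → Fin 2 := 0
  obtain ⟨C', hC', hCe'⟩ := exists_codebook_tiling (nrm := nrm) hφ two_pos (2 * s)
    fun j => if j = j₀ then C₂ else C₁
  have hcard : (Finset.univ.erase j₀).card = k := by
    rw [Finset.card_erase_of_mem (Finset.mem_univ _)]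
    simp [← hk]
  have hsum : ∀ {R : Type} [AddCommMonoid R] (f : Finset (Fin d → ℝ) → R),
      ∑ j, f (if j = j₀ then C₂ else C₁) = k • f C₁ + f C₂ := fun f => by
    rw [← Finset.add_sum_erase _ _ (Finset.mem_univ j₀), if_pos rfl, add_comm, ← hcard,
      ← Finset.sum_const]
    congr 1
    exact Finset.sum_congr rfl fun j hj => by rw [if_neg (Finset.ne_of_mem_erase hj)]
  have h2s : 2 * s / (2 : ℕ) = s := by
    push_cast
    field_simp
  have hpow : ((2 : ℕ) : ℝ≥0∞) ^ d = (k + 1 : ℕ) := by rw [hk]; push_cast; rfl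
  have hk0 : ((k + 1 : ℕ) : ℝ≥0∞) ≠ 0 := by exact_mod_cast k.succ_ne_zero
  have hcard' : (C'.card : ℝ≥0∞) ≤ (c : ℝ≥0∞) * ((2 * s : ℝ≥0) : ℝ≥0∞) ^ d := by
    rw [hsum Finset.card] at hC'
    have h3 : (C₁.card : ℝ≥0) ≤ a * s ^ d := by exact_mod_cast hC₁
    have h4 : (C₂.card : ℝ≥0) ≤ b * s ^ d := by exact_mod_cast hC₂
    have h5 : (C'.card : ℝ≥0) ≤ c * (2 * s) ^ d := by
      calc (C'.card : ℝ≥0) ≤ k * C₁.card + C₂.card := by exact_mod_cast hC'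
        _ ≤ k * (a * s ^ d) + b * s ^ d := by gcongr
        _ = (k * a + b) * s ^ d := by ring
        _ ≤ ((k + 1 : ℕ) * c) * s ^ d := by gcongr
        _ = c * (2 * s) ^ d := by rw [hk, mul_pow]; push_cast; ring
    exact_mod_cast h5
  have h6 := (limErr_le (by positivity) hcard').trans hCe'
  rw [h2s, hpow, hsum fun C => ((k + 1 : ℕ) : ℝ≥0∞)⁻¹ * ∫⁻ x in unitCube d, err nrm φ s C x,
    nsmul_eq_mul, mul_left_comm, ← mul_add] at h6
  have h7 := mul_le_mul' (le_refl ((k + 1 : ℕ) : ℝ≥0∞)) h6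
  rw [← mul_assoc, ENNReal.mul_inv_cancel hk0 (by finiteness), one_mul] at h7
  exact h7.trans (by gcongr)

/-- One codepoint suffices at the scale where η s^d = 1. -/
lemma limErr_le_phi {c : ℝ≥0} (hc : NormBound nrm c) (hd : 0 < d) (hφ : Monotone φ) {η : ℝ≥0}
    (hη : 0 < η) : limErr nrm φ η ≤ φ (η ^ (-(d : ℝ)⁻¹) * c) := by
  have hs : 0 < η ^ (-(d : ℝ)⁻¹) := NNReal.rpow_pos hη
  have hpow : (η ^ (-(d : ℝ)⁻¹)) ^ d = η⁻¹ := by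
    rw [NNReal.rpow_neg, inv_pow, NNReal.rpow_inv_natCast_pow _ hd.ne']
  refine (limErr_le (C := {0}) hs ?_).trans ?_
  · have : (1 : ℝ≥0) ≤ η * (η ^ (-(d : ℝ)⁻¹)) ^ d := by
      rw [hpow, mul_inv_cancel₀ hη.ne']
    rw [Finset.card_singleton]
    exact_mod_cast this
  · calc ∫⁻ x in unitCube d, err nrm φ (η ^ (-(d : ℝ)⁻¹)) {0} x
        ≤ ∫⁻ x in unitCube d, (φ (η ^ (-(d : ℝ)⁻¹) * c) : ℝ≥0∞) := by
          refine setLIntegral_mono measurable_const fun x hx => ?_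
          refine (err_le (Finset.mem_singleton_self 0) x).trans ?_
          gcongr
          apply hφ
          gcongr
          rw [unitCube_eq_box] at hx
          have h1 := norm_sub_le_of_mem_box (l := 1) (by simpa using hx)
          rw [sub_zero] at h1 ⊢
          rw [Real.toNNReal_le_iff_le_coe]
          refine (hc.le_mul x).trans ?_
          have : (c : ℝ) * ‖x‖ ≤ c * 1 := by gcongr; simpa using h1
          simpa using this
      _ = _ := by simp [volume_unitCube]

lemma limErr_lt_top {c : ℝ≥0} (hc : NormBound nrm c) (hd : 0 < d) (hφ : Monotone φ) {η : ℝ≥0}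
    (hη : 0 < η) : limErr nrm φ η < ∞ :=
  (limErr_le_phi hc hd hφ hη).trans_lt ENNReal.coe_lt_top

/-- One-sided limits of `limErr` agree. -/
lemma iInf_limErr_le_iSup_limErr {c : ℝ≥0} (hc : NormBound nrm c) (hd : 0 < d) (hφ : Monotone φ)
    {η : ℝ≥0} (hη : 0 < η) :
    ⨅ p : Ioo 0 η, limErr nrm φ p ≤ ⨆ q : Ioi η, limErr nrm φ q := by
  set A := ⨅ p : Ioo 0 η, limErr nrm φ p with hA
  set B := ⨆ q : Ioi η, limErr nrm φ q with hB
  have hAp : ∀ p, p < η → A ≤ limErr nrm φ p := fun p hp => by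
    rcases eq_or_ne p 0 with rfl | hp0
    · exact (iInf_le _ (⟨η / 2, by simpa using hη, NNReal.half_lt_self hη.ne'⟩ : Ioo 0 η)).trans
        (limErr_antitone zero_le)
    · exact iInf_le (fun p : Ioo 0 η => limErr nrm φ p) ⟨p, pos_of_ne_zero hp0, hp⟩
  have hAfin : A < ∞ := (hAp _ (NNReal.half_lt_self hη.ne')).trans_lt
    (limErr_lt_top hc hd hφ (by simpa using hη))
  have hBfin : B < ∞ := lt_of_le_of_lt (iSup_le fun q => limErr_antitone q.2.le)
    (limErr_lt_top hc hd hφ hη)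
  obtain ⟨k, hk⟩ : ∃ k, k + 1 = 2 ^ d := ⟨2 ^ d - 1, Nat.sub_add_cancel Nat.one_le_two_pow⟩
  have hk1 : 1 ≤ k := by
    have : 2 ^ 1 ≤ 2 ^ d := Nat.pow_le_pow_right two_pos hd
    omega
  have key : ∀ ε : ℝ≥0, 0 < ε → A ≤ B + (k + 1 : ℕ) * ε := fun ε hε => by
    have hε' : (ε : ℝ≥0∞) ≠ 0 := by simpa using hε.ne'
    obtain ⟨⟨p, hp0, hpη⟩, hp⟩ := iInf_lt_iff.1 (show ⨅ p : Ioo 0 η, limErr nrm φ p < A + ε from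
      ENNReal.lt_add_right hAfin.ne hε')
    obtain ⟨a, hpa, haη⟩ := exists_between hpη
    -- Although `b` exceeds `η`, the average of `k ≥ 1` copies of `a` and one `b` stays below `η`.
    -- Mixing therefore gives (k+1) A ≤ k A + B up to errors, and `k * A` cancels because `A` is
    -- finite.
    set b := η + (η - a) / 2 with hb
    have haη' : 0 < η - a := tsub_pos_of_lt haη
    have hηb : η < b := lt_add_of_pos_right _ (by positivity)
    obtain ⟨b', hηb', hbb'⟩ := exists_between hηb
    have h1 := achievable_unitCube (d := d) hφ hpa hp
    have h2 : Achievable nrm φ (volume.restrict (unitCube d)) (B + ε) b :=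
      achievable_unitCube (d := d) hφ hbb' <| lt_of_le_of_lt
        (le_iSup (fun q : Ioi η => limErr nrm φ q) ⟨b', hηb'⟩)
        (ENNReal.lt_add_right hBfin.ne hε')
    set q := (k * a + b) / (k + 1 : ℕ) with hq
    have hqη : q < η := by
      rw [hq, div_lt_iff₀ (by positivity), hb]
      have h3 : (η - a : ℝ≥0) + a = η := tsub_add_cancel_of_le haη.le
      have hk1' : (1 : ℝ) ≤ k := by exact_mod_cast hk1
      rw [← NNReal.coe_lt_coe]
      push_cast
      rw [NNReal.coe_sub haη.le]
      have h5 : (a : ℝ) < η := haη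
      nlinarith
    have h4 := limErr_mixing (c := q) hφ hk (by rw [hq, mul_div_cancel₀]; positivity) h1 h2
    have h5 : (k : ℝ≥0∞) * A + A ≤ k * A + (B + (k + 1 : ℕ) * ε) := by
      calc (k : ℝ≥0∞) * A + A = (k + 1 : ℕ) * A := by push_cast; ring
        _ ≤ (k + 1 : ℕ) * limErr nrm φ q := by gcongr; exact hAp q hqη
        _ ≤ _ := h4
        _ = _ := by push_cast; ring
    exact (ENNReal.add_le_add_iff_left (by finiteness)).1 h5
  refine ENNReal.le_of_forall_pos_le_add fun ε hε _ => ?_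
  have h := key (ε / (k + 1 : ℕ)) (by positivity)
  rwa [ENNReal.coe_div (by positivity), ENNReal.coe_natCast,
    ENNReal.mul_div_cancel (by simp) (by finiteness)] at h

lemma exists_lt_limErr_lt {c : ℝ≥0} (hc : NormBound nrm c) (hd : 0 < d) (hφ : Monotone φ)
    {η : ℝ≥0} (hη : 0 < η) {e : ℝ≥0∞} (he : limErr nrm φ η < e) :
    ∃ p, 0 < p ∧ p < η ∧ limErr nrm φ p < e := by
  have h : ⨅ p : Ioo 0 η, limErr nrm φ p < e :=
    ((iInf_limErr_le_iSup_limErr hc hd hφ hη).trans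
      (iSup_le fun q => limErr_antitone q.2.le)).trans_lt he
  obtain ⟨p, hp⟩ := iInf_lt_iff.1 h
  exact ⟨p, p.2.1, p.2.2, hp⟩

lemma exists_gt_lt_limErr {c : ℝ≥0} (hc : NormBound nrm c) (hd : 0 < d) (hφ : Monotone φ)
    {η : ℝ≥0} (hη : 0 < η) {e : ℝ≥0∞} (he : e < limErr nrm φ η) :
    ∃ q, η < q ∧ e < limErr nrm φ q := by
  have h : e < ⨆ q : Ioi η, limErr nrm φ q :=
    he.trans_le ((le_iInf fun p : Ioo 0 η => limErr_antitone p.2.2.le).trans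
      (iInf_limErr_le_iSup_limErr hc hd hφ hη))
  obtain ⟨q, hq⟩ := lt_iSup_iff.1 h
  exact ⟨q, q.2, hq⟩

/-- A monotone function whose one-sided limits agree is continuous. -/
lemma continuousAt_limErr {c : ℝ≥0} (hc : NormBound nrm c) (hd : 0 < d) (hφ : Monotone φ)
    {η : ℝ≥0} (hη : 0 < η) : ContinuousAt (limErr nrm φ) η := by
  refine tendsto_order.2 ⟨fun e he => ?_, fun e he => ?_⟩
  · obtain ⟨q, hq, h⟩ := exists_gt_lt_limErr hc hd hφ hη he
    filter_upwards [Iio_mem_nhds hq] with x hx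
    exact h.trans_le (limErr_antitone (le_of_lt hx))
  · obtain ⟨p, _, hp, h⟩ := exists_lt_limErr_lt hc hd hφ hη he
    filter_upwards [Ioi_mem_nhds hp] with x hx
    exact (limErr_antitone (le_of_lt hx)).trans_lt h

lemma achievable_unitCube_of_limErr_lt {c : ℝ≥0} (hc : NormBound nrm c) (hd : 0 < d)
    (hφ : Monotone φ) {η : ℝ≥0} (hη : 0 < η) {e : ℝ≥0∞} (he : limErr nrm φ η < e) :
    Achievable nrm φ (volume.restrict (unitCube d)) e η := by
  obtain ⟨p, _, hp, h⟩ := exists_lt_limErr_lt hc hd hφ hη he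
  exact achievable_unitCube hφ hp h

lemma rpow_inv_pow_natCast (hd : 0 < d) (x : ℝ≥0) : (x ^ ((d : ℝ)⁻¹)) ^ d = x :=
  NNReal.rpow_inv_natCast_pow _ hd.ne'

lemma tendsto_rpow_div_atTop (hd : 0 < d) {η : ℝ≥0} (hη : 0 < η) :
    Tendsto (fun N : ℕ => ((N : ℝ≥0) / η) ^ ((d : ℝ)⁻¹)) atTop atTop := by
  have hd' : (0 : ℝ) < (d : ℝ)⁻¹ := by positivity
  exact (NNReal.tendsto_rpow_atTop hd').comp
    ((tendsto_natCast_atTop_atTop (R := ℝ≥0)).atTop_div_const hη)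

lemma limErr_le_cubeError (hd : 0 < d) (hφ : Monotone φ) {η : ℝ≥0} (hη : 0 < η) (N : ℕ) :
    limErr nrm φ η ≤ cubeError nrm φ N η := by
  refine le_iInf fun C => le_iInf₂ fun hC hN => ?_
  have hN0 : 0 < N := hC.card_pos.trans_le hN
  simp only [← err_eq_codebookDist hφ]
  refine limErr_le (NNReal.rpow_pos (by positivity)) ?_
  have : (C.card : ℝ≥0) ≤ η * (((N : ℝ≥0) / η) ^ ((d : ℝ)⁻¹)) ^ d := by
    rw [rpow_inv_pow_natCast hd, mul_div_cancel₀ _ hη.ne']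
    exact_mod_cast hN
  exact_mod_cast this

/-- N points at density η correspond to the scale (N/η)^{1/d}. Codebooks at that scale compete in
`limErr`, which bounds every term from below; achievability at all large scales gives the upper
bound. -/
lemma tendsto_cubeError {c : ℝ≥0} (hc : NormBound nrm c) (hd : 0 < d) (hφ : Monotone φ) {η : ℝ≥0}
    (hη : 0 < η) : Tendsto (fun N : ℕ => cubeError nrm φ N η) atTop (𝓝 (limErr nrm φ η)) := by
  refine tendsto_order.2 ⟨fun e he => Eventually.of_forall fun N =>
    he.trans_le (limErr_le_cubeError hd hφ hη N), fun e he => ?_⟩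
  obtain ⟨e', he', hee'⟩ := exists_between he
  filter_upwards [(tendsto_rpow_div_atTop hd hη).eventually
    (achievable_unitCube_of_limErr_lt hc hd hφ hη he')] with N ⟨C, hC, hCe⟩
  have hne : C.Nonempty := nonempty_of_setLIntegral_err_lt_top
    (m := volume.restrict (unitCube d)) (by simp [Measure.restrict_eq_zero, volume_unitCube])
    (hCe.trans_lt (hee'.trans_le le_top))
  refine lt_of_le_of_lt ?_ hee'
  refine (iInf_le_of_le C (iInf₂_le_of_le hne ?_ ?_))
  · have h1 : (C.card : ℝ≥0) ≤ η * (((N : ℝ≥0) / η) ^ ((d : ℝ)⁻¹)) ^ d := by exact_mod_cast hC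
    rw [rpow_inv_pow_natCast hd, mul_div_cancel₀ _ hη.ne'] at h1
    exact_mod_cast h1
  · simpa only [← err_eq_codebookDist hφ] using hCe

lemma complexity_eq_limErr {c : ℝ≥0} (hc : NormBound nrm c) (hd : 0 < d) (hφ : Monotone φ)
    {η : ℝ≥0} (hη : 0 < η) : complexity nrm φ η = limErr nrm φ η := by
  rw [complexity, if_neg hη.ne', complexityPos]
  exact (tendsto_cubeError hc hd hφ hη).limsup_eq

/-- Few points leave most of the cube far away. -/
lemma phi_mul_le_limErr {c : ℝ≥0} (hc : NormBound nrm c) (hφ : Monotone φ) (T η : ℝ≥0) :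
    (φ T : ℝ≥0∞) * (1 - η * (2 * c * T) ^ d) ≤ limErr nrm φ η := by
  refine le_iInf₂ fun s hs => le_iInf₂ fun C hC => ?_
  -- The sup-norm radius is c T / s, so outside `F` every codepoint y has s · nrm (x - y) ≥ T. The
  -- volume of `F` is at most η s^d (2 c T / s)^d, in which s cancels.
  set F := ⋃ y ∈ C, Metric.closedBall y ((c * T / s : ℝ≥0) : ℝ) with hF
  have hFm : MeasurableSet F := C.measurableSet_biUnion fun y _ => Metric.isClosed_closedBall.measurableSet
  have hs' : (s : ℝ≥0) ≠ 0 := hs.ne'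
  have hFv : volume F ≤ η * (2 * c * T) ^ d := by
    calc volume F ≤ ∑ y ∈ C, volume (Metric.closedBall y ((c * T / s : ℝ≥0) : ℝ)) :=
          measure_biUnion_finset_le _ _
      _ = C.card * ((2 * (c * T / s) : ℝ≥0) : ℝ≥0∞) ^ d := by
          have : ∀ y : Fin d → ℝ, volume (Metric.closedBall y ((c * T / s : ℝ≥0) : ℝ))
              = ((2 * (c * T / s) : ℝ≥0) : ℝ≥0∞) ^ d := fun y => by
            rw [Real.volume_pi_closedBall _ (NNReal.coe_nonneg _), Fintype.card_fin,
              ENNReal.ofReal_pow (by positivity)]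
            congr 1
            rw [← ENNReal.ofReal_coe_nnreal]
            push_cast
            rfl
          simp only [this, Finset.sum_const, nsmul_eq_mul]
      _ ≤ (η * (s : ℝ≥0∞) ^ d) * ((2 * (c * T / s) : ℝ≥0) : ℝ≥0∞) ^ d := by gcongr
      _ = ((η * (s * (2 * (c * T / s))) ^ d : ℝ≥0) : ℝ≥0∞) := by
          rw [mul_pow]; push_cast; ring
      _ = ((η * (2 * c * T) ^ d : ℝ≥0) : ℝ≥0∞) := by
          congr 3
          field_simp
      _ = _ := by push_cast; rfl
  have hlow : ∀ x ∈ unitCube d \ F, (φ T : ℝ≥0∞) ≤ err nrm φ s C x := fun x hx => by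
    refine le_iInf₂ fun y hy => ?_
    gcongr
    apply hφ
    by_contra! hlt
    refine hx.2 (mem_biUnion hy ?_)
    rw [Metric.mem_closedBall, dist_eq_norm]
    refine (hc.norm_le _).trans ?_
    have h1 : (nrm (x - y)).toNNReal ≤ T / s := by
      rw [le_div_iff₀ hs, mul_comm]
      exact hlt.le
    have h2 : nrm (x - y) ≤ (T / s : ℝ≥0) := by
      rwa [← Real.toNNReal_le_iff_le_coe]
    calc (c : ℝ) * nrm (x - y) ≤ c * (T / s : ℝ≥0) := by gcongr
      _ = _ := by push_cast; ring
  calc (φ T : ℝ≥0∞) * (1 - η * (2 * c * T) ^ d) ≤ φ T * volume (unitCube d \ F) := by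
        gcongr
        refine le_trans ?_ (le_measure_sdiff)
        rw [volume_unitCube]
        gcongr
    _ = ∫⁻ _ in unitCube d \ F, (φ T : ℝ≥0∞) := by simp
    _ ≤ ∫⁻ x in unitCube d \ F, err nrm φ s C x :=
        setLIntegral_mono (measurable_err hφ _ _) hlow
    _ ≤ _ := lintegral_mono_set sdiff_subset

lemma limErr_le_iSup (hd : 0 < d) {η : ℝ≥0} (hη : 0 < η) :
    limErr nrm φ η ≤ ⨆ t, (φ t : ℝ≥0∞) := by
  have hs : 0 < η⁻¹ ^ ((d : ℝ)⁻¹) := NNReal.rpow_pos (by positivity)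
  refine (limErr_le (C := {0}) hs ?_).trans ?_
  · have : (1 : ℝ≥0) ≤ η * (η⁻¹ ^ ((d : ℝ)⁻¹)) ^ d := by
      rw [rpow_inv_pow_natCast hd, mul_inv_cancel₀ hη.ne']
    rw [Finset.card_singleton]
    exact_mod_cast this
  · calc ∫⁻ x in unitCube d, err nrm φ (η⁻¹ ^ ((d : ℝ)⁻¹)) {0} x
        ≤ ∫⁻ x in unitCube d, ⨆ t, (φ t : ℝ≥0∞) :=
          lintegral_mono fun x => (err_le (Finset.mem_singleton_self 0) x).trans
            (le_iSup (fun t => (φ t : ℝ≥0∞)) _)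
      _ = _ := by simp [volume_unitCube]

/-- For fixed T the uncovered volume tends to 1 as η ↓ 0, so g eventually exceeds every value below
φ(T). -/
lemma tendsto_limErr_zero {c : ℝ≥0} (hc : NormBound nrm c) (hd : 0 < d) (hφ : Monotone φ) :
    Tendsto (limErr nrm φ) (𝓝[>] 0) (𝓝 (⨆ t, (φ t : ℝ≥0∞))) := by
  refine tendsto_order.2 ⟨fun e he => ?_, fun e he => ?_⟩
  · obtain ⟨T, hT⟩ := lt_iSup_iff.1 he
    have h1 : Tendsto (fun η : ℝ≥0 => (φ T : ℝ≥0∞) * (1 - η * (2 * c * T) ^ d)) (𝓝[>] 0)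
        (𝓝 ((φ T : ℝ≥0∞) * (1 - (0 : ℝ≥0) * (2 * c * T) ^ d))) := by
      refine ENNReal.Tendsto.const_mul ?_ (Or.inr (by finiteness))
      refine ENNReal.Tendsto.sub tendsto_const_nhds ?_ (Or.inl (by simp))
      refine ENNReal.Tendsto.mul_const ?_ (Or.inr (by finiteness))
      exact (ENNReal.continuous_coe.tendsto 0).mono_left nhdsWithin_le_nhds
    filter_upwards [h1.eventually_const_lt (u := e) (by simpa using hT)] with η hη
    exact hη.trans_le (phi_mul_le_limErr hc hφ T η)
  · filter_upwards [self_mem_nhdsWithin] with η hη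
    exact (limErr_le_iSup hd hη).trans_lt he

lemma complexity_zero {c : ℝ≥0} (hc : NormBound nrm c) (hd : 0 < d) (hφ : Monotone φ) :
    complexity nrm φ 0 = ⨆ t, (φ t : ℝ≥0∞) := by
  rw [complexity, if_pos rfl]
  refine Tendsto.liminf_eq ((tendsto_limErr_zero hc hd hφ).congr' ?_)
  filter_upwards [self_mem_nhdsWithin] with η hη
  exact (tendsto_cubeError hc hd hφ hη).limsup_eq.symm

lemma complexity_antitone {c : ℝ≥0} (hc : NormBound nrm c) (hd : 0 < d) (hφ : Monotone φ) :
    Antitone (complexity nrm φ) := fun a b hab => by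
  rcases eq_or_ne b 0 with rfl | hb
  · rw [le_antisymm hab zero_le]
  have hb' := pos_of_ne_zero hb
  rw [complexity_eq_limErr hc hd hφ hb']
  rcases eq_or_ne a 0 with rfl | ha
  · rw [complexity_zero hc hd hφ]
    exact limErr_le_iSup hd hb'
  · rw [complexity_eq_limErr hc hd hφ (pos_of_ne_zero ha)]
    exact limErr_antitone hab

lemma complexity_continuous {c : ℝ≥0} (hc : NormBound nrm c) (hd : 0 < d) (hφ : Monotone φ) :
    Continuous (complexity nrm φ) := by
  refine continuous_iff_continuousAt.2 fun η => ?_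
  rcases eq_or_ne η 0 with rfl | hη
  · have h1 : ContinuousWithinAt (complexity nrm φ) (Ioi 0) 0 := by
      rw [ContinuousWithinAt, complexity_zero hc hd hφ]
      refine (tendsto_limErr_zero hc hd hφ).congr' ?_
      filter_upwards [self_mem_nhdsWithin] with η hη
      exact (complexity_eq_limErr hc hd hφ hη).symm
    have h2 : (insert 0 (Ioi 0) : Set ℝ≥0) = univ := by
      ext x
      simp
    have h3 := h1.insert
    rwa [h2, continuousWithinAt_univ] at h3
  · have hη' := pos_of_ne_zero hη
    refine (continuousAt_limErr hc hd hφ hη').congr ?_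
    filter_upwards [Ioi_mem_nhds hη'] with x hx
    exact (complexity_eq_limErr hc hd hφ hx).symm

lemma complexity_lt_top {c : ℝ≥0} (hc : NormBound nrm c) (hd : 0 < d) (hφ : Monotone φ)
    {η : ℝ≥0} (hη : 0 < η) : complexity nrm φ η < ∞ := by
  rw [complexity_eq_limErr hc hd hφ hη]
  exact limErr_lt_top hc hd hφ hη

end OrliczQuantization
-- Grids, exhaustion by cells, and Lebesgue measure on bounded sets
namespace OrliczQuantization
variable {d : ℕ} {nrm : Seminorm ℝ (Fin d → ℝ)} {φ : ℝ≥0 → ℝ≥0}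

lemma exists_grid {c : ℝ≥0} (hc : NormBound nrm c) (v : Fin d → ℝ) (l : ℝ≥0)
    {t : ℝ≥0} (ht : 1 ≤ t) :
    ∃ C : Finset (Fin d → ℝ), (C.card : ℝ≥0) ≤ t ^ d ∧
      ∀ x ∈ box v l, ∃ y ∈ C, (nrm (x - y)).toNNReal ≤ 2 * c * l / t := by
  classical
  -- Rounding down keeps the number of points below t^d, and t ≥ 1 makes the loss at most a factor
  -- 2; hence the constant `2 * c`.
  set n := ⌊t⌋₊ with hn_def
  have hn : 0 < n := Nat.floor_pos.2 ht
  have hnt : (n : ℝ≥0) ≤ t := Nat.floor_le zero_le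
  have htn : t ≤ 2 * n := by
    have h1 : t ≤ n + 1 := (Nat.lt_floor_add_one t).le
    have h2 : (1 : ℝ≥0) ≤ n := by exact_mod_cast hn
    calc t ≤ n + 1 := h1
      _ ≤ n + n := by gcongr
      _ = 2 * n := by ring
  refine ⟨Finset.univ.image fun j : Fin d → Fin n => v + fun i => ((l / n : ℝ≥0) : ℝ) * (j i : ℕ),
    ?_, fun x hx => ?_⟩
  · have h1 := Finset.card_image_le (s := Finset.univ)
      (f := fun j : Fin d → Fin n => v + fun i => ((l / n : ℝ≥0) : ℝ) * (j i : ℕ))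
    rw [Finset.card_univ, Fintype.card_fun, Fintype.card_fin, Fintype.card_fin] at h1
    calc _ ≤ ((n ^ d : ℕ) : ℝ≥0) := by exact_mod_cast h1
      _ = (n : ℝ≥0) ^ d := by push_cast; rfl
      _ ≤ _ := by gcongr
  · obtain ⟨j, hj⟩ := exists_mem_subbox hn hx
    refine ⟨_, Finset.mem_image_of_mem _ (Finset.mem_univ j), ?_⟩
    rw [Real.toNNReal_le_iff_le_coe]
    refine (hc.le_mul _).trans ?_
    have h2 := norm_sub_le_of_mem_box hj
    have h3 : l / n ≤ 2 * l / t := by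
      rw [div_le_div_iff₀ (by exact_mod_cast hn) (by positivity)]
      calc l * t ≤ l * (2 * n) := by gcongr
        _ = _ := by ring
    calc _ ≤ (c : ℝ) * (l / n : ℝ≥0) := by gcongr
      _ ≤ (c : ℝ) * (2 * l / t : ℝ≥0) := by gcongr
      _ = _ := by push_cast; ring

/-- A regular grid serves any measure whatsoever, with a distortion that depends only on `M` and the
mass. This crude bound handles small remainders and singular parts. -/
lemma achievable_restrict_box {c : ℝ≥0} (hc : NormBound nrm c) (hφ : Monotone φ)
    (m : Measure (Fin d → ℝ)) (v : Fin d → ℝ) {l M : ℝ≥0} (hl : 0 < l) (hM : 0 < M) :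
    Achievable nrm φ (m.restrict (box v l))
      (φ (2 * c / M) * m (box v l)) ((M : ℝ≥0∞) ^ d * (l : ℝ≥0∞) ^ d) := by
  filter_upwards [eventually_ge_atTop (1 / (M * l)), eventually_gt_atTop 0] with s hs hs0
  obtain ⟨C, hC, hCx⟩ := exists_grid hc v l (t := M * l * s) (by
    rwa [div_le_iff₀ (by positivity), mul_comm] at hs)
  refine ⟨C, ?_, ?_⟩
  · rw [mul_pow, mul_pow] at hC
    exact_mod_cast hC
  · calc ∫⁻ x in box v l, err nrm φ s C x ∂m
        ≤ ∫⁻ x in box v l, (φ (2 * c / M) : ℝ≥0∞) ∂m := by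
          refine setLIntegral_mono measurable_const fun x hx => ?_
          obtain ⟨y, hy, hxy⟩ := hCx x hx
          refine (err_le hy x).trans ?_
          gcongr
          apply hφ
          calc _ ≤ s * (2 * c * l / (M * l * s)) := by gcongr
            _ = _ := by field_simp
      _ = _ := by simp

/-- A measure on a cube with small mass is served well by few points. -/
lemma exists_pos_forall_achievable {c : ℝ≥0} (hc : NormBound nrm c) (hd : 0 < d) (hφ : Monotone φ)
    {l : ℝ≥0} (hl : 0 < l) {ε : ℝ≥0} (hε : 0 < ε) :
    ∃ δ : ℝ≥0, 0 < δ ∧ ∀ (v : Fin d → ℝ) (m : Measure (Fin d → ℝ)), m (box v l) ≤ δ →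
      Achievable nrm φ (m.restrict (box v l)) ε ε := by
  -- This grid density uses exactly ε s^d as its budget on the cube; δ is then chosen to control the
  -- distortion.
  set M : ℝ≥0 := ε ^ ((d : ℝ)⁻¹) / l with hM
  have hM0 : 0 < M := div_pos (NNReal.rpow_pos hε) hl
  have hMl : M ^ d * l ^ d = ε := by
    rw [← mul_pow, hM, div_mul_cancel₀ _ hl.ne', rpow_inv_pow_natCast hd]
  refine ⟨ε / (φ (2 * c / M) + 1), by positivity, fun v m hm => ?_⟩
  refine (achievable_restrict_box hc hφ m v hl hM0).mono le_rfl ?_ ?_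
  · calc _ ≤ (φ (2 * c / M) : ℝ≥0∞) * (ε / (φ (2 * c / M) + 1) : ℝ≥0) := by gcongr
      _ ≤ ε := by
        norm_cast
        rw [mul_div_assoc', div_le_iff₀ (by positivity), mul_comm]
        gcongr
        exact le_self_add
  · exact_mod_cast hMl.le

lemma achievable_volume_box {c : ℝ≥0} (hc : NormBound nrm c) (hd : 0 < d) (hφ : Monotone φ)
    (v : Fin d → ℝ) {l : ℝ≥0} (hl : 0 < l) {η : ℝ≥0} (hη : 0 < η) {e : ℝ≥0∞}
    (he : limErr nrm φ η < e) :
    Achievable nrm φ (volume.restrict (box v l)) ((l : ℝ≥0∞) ^ d * e) ((l : ℝ≥0∞) ^ d * η) := by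
  classical
  have hlim : Tendsto (fun s : ℝ≥0 => s * l) atTop atTop := tendsto_id.atTop_mul_const hl
  filter_upwards [hlim.eventually (achievable_unitCube_of_limErr_lt hc hd hφ hη he)]
    with s ⟨C, hC, hCe⟩
  refine ⟨C.image fun y => v + (l : ℝ) • y, ?_, ?_⟩
  · refine le_trans (by exact_mod_cast Finset.card_image_le) (hC.trans (le_of_eq ?_))
    rw [ENNReal.coe_mul, mul_pow]
    ring
  · rw [setLIntegral_box_err_image hφ v hl]
    gcongr

/-- The cell of the grid of mesh `1 / n` with index `z`. -/
def cell (n : ℕ) (z : Fin d → ℤ) : Set (Fin d → ℝ) :=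
  box (fun i => (z i : ℝ) / n) ((1 / n : ℝ≥0) : ℝ)

lemma mem_cell_iff {n : ℕ} (hn : 0 < n) {z : Fin d → ℤ} {x : Fin d → ℝ} :
    x ∈ cell n z ↔ ∀ i, ⌊x i * n⌋ = z i := by
  have hn' : (0 : ℝ) < n := by exact_mod_cast hn
  simp only [cell, box, mem_univ_pi, mem_Ico, Int.floor_eq_iff]
  refine forall_congr' fun i => and_congr (div_le_iff₀ hn') ?_
  push_cast
  rw [← add_div, lt_div_iff₀ hn']

lemma pairwise_disjoint_cell {n : ℕ} (hn : 0 < n) :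
    Pairwise (Function.onFun Disjoint (cell (d := d) n)) := fun z z' hzz' => by
  refine Set.disjoint_left.2 fun x hx hx' => hzz' ?_
  rw [mem_cell_iff hn] at hx hx'
  ext i
  rw [← hx i, hx' i]

lemma measurableSet_cell (n : ℕ) (z : Fin d → ℤ) : MeasurableSet (cell n z) :=
  measurableSet_box _ _

/-- Grid cells inside an open set exhaust it up to small mass. -/
lemma exists_cells_subset {O : Set (Fin d → ℝ)} (hO : IsOpen O) (m : Measure (Fin d → ℝ))
    [IsFiniteMeasure m] {δ : ℝ≥0∞} (hδ : 0 < δ) :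
    ∃ n : ℕ, 0 < n ∧ ∃ Z : Finset (Fin d → ℤ), (∀ z ∈ Z, cell n z ⊆ O) ∧
      m (O \ ⋃ z ∈ Z, cell n z) ≤ δ := by
  classical
  -- The index window n² grows faster than the mesh number n, so the cell of any fixed point, whose
  -- index is of order n, eventually enters.
  let Z : ℕ → Finset (Fin d → ℤ) := fun n =>
    (Fintype.piFinset fun _ => Finset.Icc (-(n : ℤ) ^ 2) ((n : ℤ) ^ 2)).filter fun z => cell n z ⊆ O
  have hmeas : ∀ n, MeasurableSet (O \ ⋃ z ∈ Z n, cell n z) := fun n =>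
    hO.measurableSet.diff ((Z n).measurableSet_biUnion fun z _ => measurableSet_cell n z)
  have hlim : Tendsto (fun n => m (O \ ⋃ z ∈ Z n, cell n z)) atTop (𝓝 (m ∅)) := by
    refine tendsto_measure_of_tendsto_indicator_of_isFiniteMeasure atTop m hmeas fun x => ?_
    by_cases hx : x ∈ O
    swap
    · exact Eventually.of_forall fun n => by simp [hx]
    obtain ⟨r, hr, hball⟩ := Metric.isOpen_iff.1 hO x hx
    have h1 : ∀ᶠ n : ℕ in atTop, (1 / n : ℝ) < r :=
      (tendsto_const_div_atTop_nhds_zero_nat 1).eventually_lt_const hr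
    have h2 : ∀ᶠ n : ℕ in atTop, ‖x‖ + 1 ≤ n := tendsto_natCast_atTop_atTop.eventually_ge_atTop _
    filter_upwards [h1, h2, eventually_gt_atTop 0] with n hn1 hn2 hn
    have hn' : (0 : ℝ) < n := by exact_mod_cast hn
    have hn'' : (1 : ℝ) ≤ n := by exact_mod_cast hn
    have hxc : x ∈ cell n fun i => ⌊x i * n⌋ := (mem_cell_iff hn).2 fun i => rfl
    have hsub : cell n (fun i => ⌊x i * n⌋) ⊆ O := fun y hy => by
      refine hball ?_
      rw [Metric.mem_ball, dist_pi_lt_iff hr]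
      intro i
      have a1 := hxc i (mem_univ i)
      have a2 := hy i (mem_univ i)
      simp only [mem_Ico] at a1 a2
      have a3 : ((1 / n : ℝ≥0) : ℝ) < r := by push_cast; exact hn1
      rw [Real.dist_eq, abs_lt]
      constructor <;> linarith [a1.1, a1.2, a2.1, a2.2]
    have hmem : (fun i => ⌊x i * n⌋) ∈ Z n := by
      refine Finset.mem_filter.2 ⟨Fintype.mem_piFinset.2 fun i => Finset.mem_Icc.2 ?_, hsub⟩
      have b1 : |x i| ≤ ‖x‖ := norm_le_pi_norm x i
      have b2 := Int.floor_le (x i * n)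
      have b3 := Int.lt_floor_add_one (x i * n)
      obtain ⟨b4, b5⟩ := abs_le.1 (b1.trans (by linarith : ‖x‖ ≤ n - 1))
      constructor
      · have : (-(n : ℝ) ^ 2) ≤ (⌊x i * n⌋ : ℝ) := by nlinarith
        exact_mod_cast this
      · have : (⌊x i * n⌋ : ℝ) ≤ (n : ℝ) ^ 2 := by nlinarith
        exact_mod_cast this
    simp only [Set.mem_sdiff, mem_iUnion, not_exists, mem_empty_iff_false, iff_false, not_and]
    intro _ hcon
    exact hcon _ hmem hxc
  rw [measure_empty] at hlim
  obtain ⟨n, hn, hn0⟩ := ((hlim.eventually_lt_const hδ).and (eventually_gt_atTop 0)).exists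
  exact ⟨n, hn0, Z n, fun z hz => (Finset.mem_filter.1 hz).2, hn.le⟩

lemma sum_cells_le {n : ℕ} (hn : 0 < n) {Z : Finset (Fin d → ℤ)} {O : Set (Fin d → ℝ)}
    (hZ : ∀ z ∈ Z, cell n z ⊆ O) :
    ∑ _z ∈ Z, (((1 / n : ℝ≥0) : ℝ≥0∞)) ^ d ≤ volume O := by
  calc ∑ _z ∈ Z, (((1 / n : ℝ≥0) : ℝ≥0∞)) ^ d = ∑ z ∈ Z, volume (cell n z) :=
        Finset.sum_congr rfl fun z _ => (volume_box _ _).symm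
    _ = volume (⋃ z ∈ Z, cell n z) :=
        (measure_biUnion_finset (fun z _ z' _ h => pairwise_disjoint_cell hn h)
          fun z _ => measurableSet_cell n z).symm
    _ ≤ volume O := measure_mono (iUnion₂_subset hZ)

lemma restrict_biUnion_le_sum {ι : Type*} (m : Measure (Fin d → ℝ)) (t : Finset ι)
    (A : ι → Set (Fin d → ℝ)) : m.restrict (⋃ i ∈ t, A i) ≤ ∑ i ∈ t, m.restrict (A i) := by
  classical
  induction t using Finset.induction_on with
  | empty => simp
  | insert i t hi ih =>
    rw [Finset.set_biUnion_insert, Finset.sum_insert hi]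
    exact (Measure.restrict_union_le _ _).trans (add_le_add le_rfl ih)

lemma restrict_le_add_sdiff (m : Measure (Fin d → ℝ)) (A B : Set (Fin d → ℝ)) :
    m.restrict A ≤ m.restrict B + m.restrict (A \ B) :=
  le_trans (Measure.restrict_mono (fun x hx => (em (x ∈ B)).imp id fun h => ⟨hx, h⟩) le_rfl)
    (Measure.restrict_union_le _ _)

lemma restrict_le_sum_cells (m : Measure (Fin d → ℝ)) (A : Set (Fin d → ℝ)) (n : ℕ)
    (Z : Finset (Fin d → ℤ)) :
    m.restrict A ≤ ∑ z ∈ Z, m.restrict (cell n z) + m.restrict (A \ ⋃ z ∈ Z, cell n z) :=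
  (restrict_le_add_sdiff m A _).trans (add_le_add (restrict_biUnion_le_sum m Z _) le_rfl)

lemma exists_pos_add_mul_add_le {a b ε : ℝ≥0∞} (ha : a ≠ ∞) (hb : b ≠ ∞) (hε : 0 < ε) :
    ∃ e : ℝ≥0, 0 < e ∧ ∀ e' ≤ e, (a + e') * (b + e') ≤ a * b + ε := by
  lift a to ℝ≥0 using ha
  lift b to ℝ≥0 using hb
  have h : Tendsto (fun e : ℝ≥0 => ((a : ℝ≥0∞) + e) * (b + e)) (𝓝[>] 0)
      (𝓝 ((((a + 0) * (b + 0) : ℝ≥0)) : ℝ≥0∞)) := by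
    have : Continuous fun e : ℝ≥0 => (((a + e) * (b + e) : ℝ≥0) : ℝ≥0∞) := by fun_prop
    have h2 := (this.tendsto 0).mono_left (nhdsWithin_le_nhds (s := Ioi 0))
    simpa using h2
  have hlt : (((a + 0) * (b + 0) : ℝ≥0) : ℝ≥0∞) < a * b + ε := by
    rw [add_zero, add_zero, ENNReal.coe_mul]
    exact ENNReal.lt_add_right (by finiteness) hε.ne'
  obtain ⟨e, he, he0⟩ := ((h.eventually_lt_const hlt).and self_mem_nhdsWithin).exists
  refine ⟨e, he0, fun e' he' => le_trans ?_ he.le⟩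
  gcongr

/-- Outer regularity replaces A by an open set of almost the same volume. Cells inside it carry
rescaled cube codebooks, and the uncovered remainder in the surrounding cube has so little mass that
few points serve it. -/
lemma achievable_volume_restrict {c : ℝ≥0} (hc : NormBound nrm c) (hd : 0 < d) (hφ : Monotone φ)
    {A : Set (Fin d → ℝ)} {v : Fin d → ℝ} {l : ℝ≥0} (hl : 0 < l) (hA : A ⊆ box v l)
    {η : ℝ≥0} (hη : 0 < η) {ε : ℝ≥0} (hε : 0 < ε) :
    Achievable nrm φ (volume.restrict A) (volume A * limErr nrm φ η + ε) (volume A * η + ε) := by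
  have hAfin : volume A ≠ ∞ := ((measure_mono hA).trans_lt (by
    rw [volume_box]; finiteness)).ne
  have hεh : (0 : ℝ≥0∞) < (ε / 2 : ℝ≥0) := by exact_mod_cast half_pos hε
  obtain ⟨e₁, he₁, h₁⟩ := exists_pos_add_mul_add_le hAfin (limErr_lt_top hc hd hφ hη).ne hεh
  obtain ⟨e₂, he₂, h₂⟩ := exists_pos_add_mul_add_le hAfin (b := (η : ℝ≥0∞)) (by simp) hεh
  set e := min e₁ e₂ with he_def
  have he : 0 < e := lt_min he₁ he₂
  have he' : (e : ℝ≥0∞) ≠ 0 := by simpa using he.ne'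
  obtain ⟨O, hAO, hO, hOv⟩ := A.exists_isOpen_lt_add hAfin he'
  obtain ⟨δ, hδ, hsmall⟩ := exists_pos_forall_achievable hc hd hφ hl (half_pos hε)
  have : IsFiniteMeasure (volume.restrict (box v (l : ℝ))) := ⟨by
    rw [Measure.restrict_apply_univ, volume_box]; finiteness⟩
  obtain ⟨n, hn, Z, hZ, hZδ⟩ := exists_cells_subset hO (volume.restrict (box v (l : ℝ)))
    (show (0 : ℝ≥0∞) < δ by exact_mod_cast hδ)
  set B := ⋃ z ∈ Z, cell n z with hB
  have hn0 : (0 : ℝ≥0) < 1 / n := by positivity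
  have hcells := Achievable.sum Z fun z _ =>
    achievable_volume_box hc hd hφ (fun i => (z i : ℝ) / n) hn0 hη
      (ENNReal.lt_add_right (limErr_lt_top hc hd hφ hη).ne he')
  have hrest := hsmall v (volume.restrict (O \ B)) (by
    rw [Measure.restrict_apply' (hO.measurableSet.diff
      (Z.measurableSet_biUnion fun z _ => measurableSet_cell n z)), inter_comm]
    rwa [Measure.restrict_apply' (measurableSet_box _ _)] at hZδ)
  have hsum := sum_cells_le hn hZ
  refine (hcells.add hrest).mono ?_ ?_ ?_
  · refine (restrict_le_sum_cells volume A n Z).trans (add_le_add le_rfl ?_)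
    rw [Measure.restrict_restrict (measurableSet_box _ _)]
    exact Measure.restrict_mono (show A \ B ⊆ box v (l : ℝ) ∩ (O \ B) from
      fun x hx => ⟨hA hx.1, hAO hx.1, hx.2⟩) le_rfl
  · rw [← Finset.sum_mul]
    calc _ ≤ (volume A + e) * (limErr nrm φ η + e) + (ε / 2 : ℝ≥0) := by
          gcongr
          exact hsum.trans hOv.le
      _ ≤ volume A * limErr nrm φ η + (ε / 2 : ℝ≥0) + (ε / 2 : ℝ≥0) := by
          gcongr
          exact h₁ _ (by exact_mod_cast min_le_left _ _)
      _ = _ := by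
          rw [add_assoc, ← ENNReal.coe_add, add_halves]
  · rw [← Finset.sum_mul]
    calc _ ≤ (volume A + e) * (η + e) + (ε / 2 : ℝ≥0) := by
          gcongr
          · exact hsum.trans hOv.le
          · exact le_self_add
      _ ≤ volume A * η + (ε / 2 : ℝ≥0) + (ε / 2 : ℝ≥0) := by
          gcongr
          exact h₂ _ (by exact_mod_cast min_le_right _ _)
      _ = _ := by
          rw [add_assoc, ← ENNReal.coe_add, add_halves]

end OrliczQuantization
-- The lower bound through a price per point
namespace OrliczQuantization

/-- The optimal cost per unit volume at mass density `a` when points cost `κ` each. -/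
noncomputable def densityCost (g : ℝ≥0 → ℝ≥0∞) (κ a : ℝ≥0∞) : ℝ≥0∞ :=
  ⨅ (η : ℝ≥0) (_ : 0 < η), a * g η + κ * η

section DensityCost
variable {g : ℝ≥0 → ℝ≥0∞}

lemma densityCost_le (κ a : ℝ≥0∞) {η : ℝ≥0} (hη : 0 < η) :
    densityCost g κ a ≤ a * g η + κ * η :=
  iInf₂_le η hη

lemma densityCost_zero (κ : ℝ≥0) : densityCost g κ 0 = 0 := by
  refine le_antisymm (ENNReal.le_of_forall_pos_le_add fun ε hε _ => ?_) zero_le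
  refine (densityCost_le κ 0 (η := ε / (κ + 1)) (by positivity)).trans ?_
  rw [zero_mul, zero_add, zero_add]
  norm_cast
  rw [mul_div_assoc', div_le_iff₀ (by positivity), mul_comm]
  gcongr
  exact le_self_add

lemma densityCost_mono (κ : ℝ≥0∞) : Monotone (densityCost g κ) := fun a b hab =>
  iInf₂_mono fun _ _ => by gcongr

/-- As an infimum of non-negative affine functions of `a` the cost is concave; this is concavity
along the ray from 0. -/
lemma mul_densityCost_le {θ : ℝ≥0∞} (hθ : θ ≤ 1) (κ a : ℝ≥0∞) :
    θ * densityCost g κ a ≤ densityCost g κ (θ * a) := by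
  refine le_iInf₂ fun η hη => ?_
  calc θ * densityCost g κ a ≤ θ * (a * g η + κ * η) := by
        gcongr
        exact densityCost_le κ a hη
    _ = θ * a * g η + θ * (κ * η) := by ring
    _ ≤ θ * a * g η + 1 * (κ * η) := by gcongr
    _ = _ := by rw [one_mul]

lemma densityCost_lt_top (hg : ∀ η, 0 < η → g η < ∞) (κ : ℝ≥0) {a : ℝ≥0∞} (ha : a ≠ ∞) :
    densityCost g κ a < ∞ := by
  refine (densityCost_le κ a one_pos).trans_lt ?_
  have := hg 1 one_pos
  finiteness

/-- Continuity from below, needed for monotone approximation of the density. It follows by scaling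
with θ = f n / a. -/
lemma iSup_densityCost {f : ℕ → ℝ≥0∞} {a κ : ℝ≥0∞} (ha : a ≠ ∞) (hf : ⨆ n, f n = a) :
    densityCost g κ a ≤ ⨆ n, densityCost g κ (f n) := by
  rcases eq_or_ne a 0 with rfl | ha0
  · have : f 0 = 0 := le_antisymm ((le_iSup f 0).trans hf.le) zero_le
    exact le_iSup_of_le 0 (by rw [this])
  have h1 : ∀ n, f n / a ≤ 1 := fun n => by
    rw [ENNReal.div_le_iff ha0 ha, one_mul, ← hf]
    exact le_iSup f n
  calc densityCost g κ a = (⨆ n, f n / a) * densityCost g κ a := by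
        rw [← ENNReal.iSup_div, hf, ENNReal.div_self ha0 ha, one_mul]
    _ = ⨆ n, f n / a * densityCost g κ a := ENNReal.iSup_mul _ _
    _ ≤ _ := iSup_mono fun n => by
        refine (mul_densityCost_le (h1 n) κ a).trans ?_
        rw [ENNReal.div_mul_cancel ha0 ha]

end DensityCost

variable {d : ℕ} {nrm : Seminorm ℝ (Fin d → ℝ)} {φ : ℝ≥0 → ℝ≥0}

/-- A non-empty codebook has some density on the cube, and its penalized distortion competes in the
infimum at that density. The empty codebook has infinite distortion unless `a = 0`. -/
lemma densityCost_box_le (hφ : Monotone φ) (v : Fin d → ℝ) {l s : ℝ≥0} (hl : 0 < l) (hs : 0 < s)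
    (κ : ℝ≥0) (a : ℝ≥0∞) (C : Finset (Fin d → ℝ)) :
    (l : ℝ≥0∞) ^ d * densityCost (limErr nrm φ) κ a
      ≤ a * (∫⁻ x in box v l, err nrm φ s C x) + κ * C.card / (s : ℝ≥0∞) ^ d := by
  rcases C.eq_empty_or_nonempty with rfl | hC
  · rcases eq_or_ne a 0 with rfl | ha
    · simp [densityCost_zero]
    · have hl' : (l : ℝ≥0∞) ^ d ≠ 0 := pow_ne_zero _ (by simpa using hl.ne')
      simp [err_empty, volume_box, ENNReal.top_mul hl', ENNReal.mul_top ha]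
  set η : ℝ≥0 := C.card / (s * l) ^ d with hη
  have hη0 : 0 < η := by
    have : (0 : ℝ≥0) < C.card := by exact_mod_cast hC.card_pos
    positivity
  have h1 : (C.card : ℝ≥0) = η * (s * l) ^ d := by
    rw [hη, div_mul_cancel₀ _ (by positivity)]
  have h2 := limErr_box_le (nrm := nrm) hφ v hl hs (η := η) (C := C) (by exact_mod_cast h1.le)
  have h3 : κ * (l : ℝ≥0) ^ d * η = κ * C.card / s ^ d := by
    rw [h1, mul_pow]
    field_simp
  have h4 : (κ : ℝ≥0∞) * (l : ℝ≥0∞) ^ d * η = κ * C.card / (s : ℝ≥0∞) ^ d := by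
    rw [← ENNReal.coe_pow s, ← ENNReal.coe_natCast, ← ENNReal.coe_mul,
      ← ENNReal.coe_div (by positivity), ← h3]
    push_cast
    rfl
  calc _ ≤ (l : ℝ≥0∞) ^ d * (a * limErr nrm φ η + κ * η) := by
        gcongr
        exact densityCost_le _ _ hη0
    _ = a * ((l : ℝ≥0∞) ^ d * limErr nrm φ η) + κ * (l : ℝ≥0∞) ^ d * η := by ring
    _ ≤ _ := by rw [h4]; gcongr

/-- On a bounded set the penalized distortion is asymptotically at least the optimal cost. This
follows from the bound on a surrounding cube, since the complement can be served optimally. -/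
lemma eventually_densityCost_le {c : ℝ≥0} (hc : NormBound nrm c) (hd : 0 < d) (hφ : Monotone φ)
    {A : Set (Fin d → ℝ)} (hA : MeasurableSet A) {v : Fin d → ℝ} {l : ℝ≥0} (hl : 0 < l)
    (hAb : A ⊆ box v l) (κ : ℝ≥0) {a : ℝ≥0∞} (ha : a ≠ ∞) {ε : ℝ≥0} (hε : 0 < ε) :
    ∀ᶠ s : ℝ≥0 in atTop, ∀ C : Finset (Fin d → ℝ),
      volume A * densityCost (limErr nrm φ) κ a
        ≤ a * (∫⁻ x in A, err nrm φ s C x) + κ * C.card / (s : ℝ≥0∞) ^ d + ε := by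
  classical
  set G := densityCost (limErr nrm φ) κ a with hG
  have hGfin : G ≠ ∞ := (densityCost_lt_top (fun η hη => limErr_lt_top hc hd hφ hη) κ ha).ne
  set V := volume (box v l \ A) with hV
  have hboxfin : volume (box v (l : ℝ)) ≠ ∞ := by rw [volume_box]; finiteness
  have hVfin : V ≠ ∞ := ((measure_mono sdiff_subset).trans_lt hboxfin.lt_top).ne
  have hVA : (l : ℝ≥0∞) ^ d = volume A + V := by
    rw [← volume_box v l, hV, measure_add_sdiff hA.nullMeasurableSet, union_eq_self_of_subset_left hAb]
  lift a to ℝ≥0 using ha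
  obtain ⟨V', hV'⟩ : ∃ V' : ℝ≥0, V = V' := ⟨V.toNNReal, (ENNReal.coe_toNNReal hVfin).symm⟩
  -- The error `e` is lost with weight V in the near-optimal η, with weight a in the distortion of
  -- C', and with weight κ in its size; together this is at most ε.
  set e : ℝ≥0 := ε / (V' + a + κ + 1) with he
  have he0 : 0 < e := by positivity
  have he1 : V * e + a * e + κ * e ≤ ε := by
    rw [hV']
    norm_cast
    calc V' * e + a * e + κ * e ≤ (V' + a + κ + 1) * e := by
          rw [add_mul, add_mul, add_mul]
          exact le_self_add
      _ = ε := by rw [he, mul_div_cancel₀]; positivity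
  obtain ⟨η, hη⟩ := iInf_lt_iff.1 (show densityCost (limErr nrm φ) κ a < G + e from
    ENNReal.lt_add_right hGfin (by simpa using he0.ne'))
  obtain ⟨hη0, hη1⟩ := iInf_lt_iff.1 hη
  filter_upwards [achievable_volume_restrict hc hd hφ (A := box v l \ A) hl sdiff_subset hη0 he0,
    eventually_gt_atTop 0] with s ⟨C', hC', hCe'⟩ hs C
  have hs0 : (s : ℝ≥0∞) ^ d ≠ 0 := pow_ne_zero _ (by simpa using hs.ne')
  have h1 := densityCost_box_le (nrm := nrm) hφ v hl hs κ a (C ∪ C')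
  have h2 : (∫⁻ x in box v l, err nrm φ s (C ∪ C') x)
      ≤ (∫⁻ x in A, err nrm φ s C x) + (∫⁻ x in box v l \ A, err nrm φ s C' x) := by
    refine (lintegral_mono' ?_ le_rfl).trans (lintegral_err_union_le s C C')
    exact restrict_le_add_sdiff _ _ _
  have h3 : (κ : ℝ≥0∞) * (C ∪ C').card / (s : ℝ≥0∞) ^ d
      ≤ κ * C.card / (s : ℝ≥0∞) ^ d + κ * (V * η + e) := by
    calc (κ : ℝ≥0∞) * (C ∪ C').card / (s : ℝ≥0∞) ^ d
        ≤ κ * (C.card + C'.card) / (s : ℝ≥0∞) ^ d := by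
          gcongr
          exact_mod_cast Finset.card_union_le C C'
      _ = κ * C.card / (s : ℝ≥0∞) ^ d + κ * (C'.card / (s : ℝ≥0∞) ^ d) := by
          rw [mul_add, ENNReal.add_div, mul_div_assoc _ (C'.card : ℝ≥0∞)]
      _ ≤ _ := by
          gcongr
          rwa [ENNReal.div_le_iff hs0 (by finiteness)]
  -- The surrounding cube needs cost (volume A + V) G, and the complement is served by C' at cost
  -- about V G. Cancelling the finite term V G leaves the bound on A.
  have h4 : V * G + (volume A * G) ≤ V * G + ((a : ℝ≥0∞) * (∫⁻ x in A, err nrm φ s C x)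
      + κ * C.card / (s : ℝ≥0∞) ^ d + ε) := by
    calc V * G + volume A * G = (l : ℝ≥0∞) ^ d * G := by rw [hVA]; ring
      _ ≤ _ := h1
      _ ≤ a * ((∫⁻ x in A, err nrm φ s C x) + (V * limErr nrm φ η + e))
          + (κ * C.card / (s : ℝ≥0∞) ^ d + κ * (V * η + e)) := by
          refine add_le_add (mul_le_mul' le_rfl ?_) h3
          exact h2.trans (add_le_add le_rfl hCe')
      _ = V * (a * limErr nrm φ η + κ * η) + (a * e + κ * e)
          + (a * (∫⁻ x in A, err nrm φ s C x) + κ * C.card / (s : ℝ≥0∞) ^ d) := by ring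
      _ ≤ V * (G + e) + (a * e + κ * e)
          + (a * (∫⁻ x in A, err nrm φ s C x) + κ * C.card / (s : ℝ≥0∞) ^ d) := by gcongr
      _ = V * G + (a * (∫⁻ x in A, err nrm φ s C x) + κ * C.card / (s : ℝ≥0∞) ^ d
          + (V * e + a * e + κ * e)) := by ring
      _ ≤ _ := by gcongr
  exact (ENNReal.add_le_add_iff_left (ENNReal.mul_ne_top hVfin hGfin)).1 h4

lemma exists_subset_box {A : Set (Fin d → ℝ)} (hA : Bornology.IsBounded A) :
    ∃ (v : Fin d → ℝ) (l : ℝ≥0), 0 < l ∧ A ⊆ box v l := by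
  obtain ⟨R, hR⟩ := hA.subset_closedBall 0
  refine ⟨fun _ => -(R.toNNReal + 1), 2 * R.toNNReal + 3, by positivity, fun x hx i _ => ?_⟩
  have h1 : ‖x‖ ≤ R := by simpa using hR hx
  have h2 := abs_le.1 ((norm_le_pi_norm x i).trans (h1.trans (Real.le_coe_toNNReal R)))
  push_cast
  constructor <;> linarith [h2.1, h2.2]

lemma exists_pos_pairwise_disjoint_thickening {ι : Type*} (t : Finset ι)
    {A : ι → Set (Fin d → ℝ)} (hA : ∀ i ∈ t, IsCompact (A i))
    (hdisj : (t : Set ι).PairwiseDisjoint A) :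
    ∃ δ : ℝ, 0 < δ ∧ (t : Set ι).PairwiseDisjoint fun i => Metric.thickening δ (A i) := by
  have h : ∀ᶠ δ : ℝ in 𝓝[>] 0, ∀ i ∈ t, ∀ j ∈ t, i ≠ j →
      Disjoint (Metric.thickening δ (A i)) (Metric.thickening δ (A j)) := by
    refine (Filter.eventually_all_finset t).2 fun i hi =>
      (Filter.eventually_all_finset t).2 fun j hj => ?_
    by_cases hij : i = j
    · exact Eventually.of_forall fun _ h => absurd hij h
    obtain ⟨δ, hδ, hdis⟩ := (hdisj hi hj hij).exists_thickenings (hA i hi) (hA j hj).isClosed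
    filter_upwards [Ioo_mem_nhdsGT hδ] with δ' hδ' _
    exact hdis.mono (Metric.thickening_mono hδ'.2.le _) (Metric.thickening_mono hδ'.2.le _)
  obtain ⟨δ, hδ, hδ0⟩ := (h.and self_mem_nhdsWithin).exists
  exact ⟨δ, hδ0, fun i hi j hj hij => hδ i hi j hj hij⟩

/-- Compact disjoint sets have disjoint thickenings, so a codepoint near one set is not counted for
another. Codepoints far from a set are beaten there by a fixed finite net T, whose size is
negligible against s^d. -/
lemma eventually_sum_densityCost_le {c : ℝ≥0} (hc : NormBound nrm c) (hd : 0 < d)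
    (hφ : Monotone φ) {ι : Type*} (t : Finset ι) {A : ι → Set (Fin d → ℝ)}
    (hA : ∀ i ∈ t, IsCompact (A i)) (hdisj : (t : Set ι).PairwiseDisjoint A) (κ : ℝ≥0)
    {a : ι → ℝ≥0∞} (ha : ∀ i ∈ t, a i ≠ ∞) {ε : ℝ≥0} (hε : 0 < ε) :
    ∀ᶠ s : ℝ≥0 in atTop, ∀ C : Finset (Fin d → ℝ),
      ∑ i ∈ t, volume (A i) * densityCost (limErr nrm φ) κ (a i)
        ≤ ∑ i ∈ t, a i * (∫⁻ x in A i, err nrm φ s C x) + κ * C.card / (s : ℝ≥0∞) ^ d + ε := by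
  classical
  obtain ⟨δ, hδ, hthick⟩ := exists_pos_pairwise_disjoint_thickening t hA hdisj
  have hc0 : (0 : ℝ) < c := hc.pos
  -- With net radius δ / c² the net point z satisfies nrm (x - z) ≤ δ / c, while any y outside the
  -- thickening satisfies nrm (x - y) ≥ δ / c.
  obtain ⟨T', hT's, hT'fin, hT'cov⟩ := (t.isCompact_biUnion hA).finite_cover_balls
    (show 0 < δ / (c * c) by positivity)
  obtain ⟨T, rfl⟩ := hT'fin.exists_finset_coe
  set e : ℝ≥0 := ε / (2 * (t.card + 1)) with he
  have he0 : 0 < e := by positivity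
  have hev : ∀ i ∈ t, ∀ᶠ s : ℝ≥0 in atTop, ∀ C : Finset (Fin d → ℝ),
      volume (A i) * densityCost (limErr nrm φ) κ (a i)
        ≤ a i * (∫⁻ x in A i, err nrm φ s C x) + κ * C.card / (s : ℝ≥0∞) ^ d + e := fun i hi => by
    obtain ⟨v, l, hl, hsub⟩ := exists_subset_box (hA i hi).isBounded
    exact eventually_densityCost_le hc hd hφ (hA i hi).measurableSet hl hsub κ (ha i hi) he0
  have hlim : Tendsto (fun s : ℝ≥0 => κ * (t.card * T.card) / s ^ d) atTop (𝓝 0) :=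
    (tendsto_const_div_nnreal_atTop _).comp (tendsto_pow_atTop hd.ne')
  filter_upwards [(Filter.eventually_all_finset t).2 hev,
    hlim.eventually_lt_const (half_pos hε), eventually_gt_atTop 0] with s hs hsT hs0 C
  have hs0' : (s : ℝ≥0∞) ^ d ≠ 0 := pow_ne_zero _ (by simpa using hs0.ne')
  let D : ι → Finset (Fin d → ℝ) := fun i => C.filter fun y => y ∈ Metric.thickening δ (A i)
  have hD : ∑ i ∈ t, (D i).card ≤ C.card := by
    rw [← Finset.card_biUnion]
    · exact Finset.card_le_card (Finset.biUnion_subset.2 fun i _ => Finset.filter_subset _ _)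
    · intro i hi j hj hij
      refine Finset.disjoint_left.2 fun y hy hy' => ?_
      exact Set.disjoint_left.1 (hthick hi hj hij) (Finset.mem_filter.1 hy).2
        (Finset.mem_filter.1 hy').2
  have herr : ∀ i ∈ t, ∀ x ∈ A i, err nrm φ s (D i ∪ T) x ≤ err nrm φ s C x := fun i hi x hx => by
    refine le_iInf₂ fun y hy => ?_
    by_cases hyD : y ∈ D i
    · exact err_le (Finset.mem_union_left _ hyD) x
    obtain ⟨z, hz, hxz⟩ := mem_iUnion₂.1 (hT'cov (mem_biUnion hi hx))
    refine (err_le (Finset.mem_union_right _ hz) x).trans ?_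
    gcongr
    apply hφ
    gcongr
    have h1 : δ ≤ ‖x - y‖ := by
      by_contra! hlt
      refine hyD (Finset.mem_filter.2 ⟨hy, Metric.mem_thickening_iff.2 ⟨x, hx, ?_⟩⟩)
      rwa [dist_comm, dist_eq_norm]
    have h2 : ‖x - z‖ ≤ δ / (c * c) := by
      rw [← dist_eq_norm]
      exact (Metric.mem_ball.1 hxz).le
    have h3 := hc.norm_le (x - y)
    calc nrm (x - z) ≤ c * ‖x - z‖ := hc.le_mul _
      _ ≤ c * (δ / (c * c)) := by gcongr
      _ = δ / c := by field_simp
      _ ≤ nrm (x - y) := by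
        rw [div_le_iff₀ hc0, mul_comm]
        exact h1.trans h3
  have hcard : ∑ i ∈ t, (κ : ℝ≥0∞) * (D i ∪ T).card / (s : ℝ≥0∞) ^ d
      ≤ κ * C.card / (s : ℝ≥0∞) ^ d + (ε / 2 : ℝ≥0) := by
    have h1 : ∑ i ∈ t, (D i ∪ T).card ≤ C.card + t.card * T.card := by
      calc ∑ i ∈ t, (D i ∪ T).card ≤ ∑ i ∈ t, ((D i).card + T.card) :=
            Finset.sum_le_sum fun i _ => Finset.card_union_le _ _
        _ = ∑ i ∈ t, (D i).card + t.card * T.card := by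
            rw [Finset.sum_add_distrib, Finset.sum_const, smul_eq_mul]
        _ ≤ _ := by gcongr
    have h2 : (κ : ℝ≥0∞) * (t.card * T.card) / (s : ℝ≥0∞) ^ d ≤ (ε / 2 : ℝ≥0) := by
      rw [ENNReal.div_le_iff hs0' (by finiteness)]
      rw [div_lt_iff₀ (by positivity)] at hsT
      exact_mod_cast hsT.le
    calc ∑ i ∈ t, (κ : ℝ≥0∞) * (D i ∪ T).card / (s : ℝ≥0∞) ^ d
        = κ * ((∑ i ∈ t, (D i ∪ T).card : ℕ) : ℝ≥0∞) / (s : ℝ≥0∞) ^ d := by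
          push_cast
          rw [Finset.mul_sum]
          simp only [div_eq_mul_inv]
          rw [Finset.sum_mul]
      _ ≤ κ * ((C.card + t.card * T.card : ℕ) : ℝ≥0∞) / (s : ℝ≥0∞) ^ d := by gcongr
      _ = κ * C.card / (s : ℝ≥0∞) ^ d + κ * (t.card * T.card) / (s : ℝ≥0∞) ^ d := by
          push_cast
          rw [mul_add, ENNReal.add_div]
      _ ≤ _ := by gcongr
  have hesum : ∑ _i ∈ t, (e : ℝ≥0∞) ≤ (ε / 2 : ℝ≥0) := by
    rw [Finset.sum_const, nsmul_eq_mul]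
    norm_cast
    calc (t.card : ℝ≥0) * e ≤ (t.card + 1) * e := by gcongr; exact le_self_add
      _ = ε / 2 := by rw [he]; field_simp
  calc ∑ i ∈ t, volume (A i) * densityCost (limErr nrm φ) κ (a i)
      ≤ ∑ i ∈ t, (a i * (∫⁻ x in A i, err nrm φ s (D i ∪ T) x)
        + κ * (D i ∪ T).card / (s : ℝ≥0∞) ^ d + e) := Finset.sum_le_sum fun i hi => hs i hi _
    _ = ∑ i ∈ t, a i * (∫⁻ x in A i, err nrm φ s (D i ∪ T) x)
        + ∑ i ∈ t, κ * (D i ∪ T).card / (s : ℝ≥0∞) ^ d + ∑ _i ∈ t, (e : ℝ≥0∞) := by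
        rw [Finset.sum_add_distrib, Finset.sum_add_distrib]
    _ ≤ ∑ i ∈ t, a i * (∫⁻ x in A i, err nrm φ s C x)
        + (κ * C.card / (s : ℝ≥0∞) ^ d + (ε / 2 : ℝ≥0)) + (ε / 2 : ℝ≥0) := by
        exact add_le_add (add_le_add (Finset.sum_le_sum fun i hi => mul_le_mul' le_rfl
          (setLIntegral_mono (measurable_err hφ _ _) (herr i hi))) hcard) hesum
    _ = _ := by
        rw [add_assoc, add_assoc, ← ENNReal.coe_add, add_halves, ← add_assoc]

/-- If the pair `(b, η)` is achieved by codebooks at arbitrarily large scales, then the optimal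
cost integrated over any density below `m` is at most `b + κ η`. -/
lemma lintegral_densityCost_le {c : ℝ≥0} (hc : NormBound nrm c) (hd : 0 < d) (hφ : Monotone φ)
    {m : Measure (Fin d → ℝ)} {h : (Fin d → ℝ) → ℝ≥0∞} (hh : Measurable h)
    (hhi : ∫⁻ x, h x ≠ ∞) (hm : volume.withDensity h ≤ m) {b η : ℝ≥0∞} (κ : ℝ≥0)
    (hfreq : ∃ᶠ s : ℝ≥0 in atTop, ∃ C : Finset (Fin d → ℝ),
      (C.card : ℝ≥0∞) ≤ η * (s : ℝ≥0∞) ^ d ∧ ∫⁻ x, err nrm φ s C x ∂m ≤ b) :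
    ∫⁻ x, densityCost (limErr nrm φ) κ (h x) ≤ b + κ * η := by
  classical
  set G := densityCost (limErr nrm φ) κ with hG
  have hsimple : ∀ f : SimpleFunc (Fin d → ℝ) ℝ≥0∞, (∀ x, f x ≤ h x) → (∀ x, f x < ∞) →
      ∫⁻ x, G (f x) ≤ b + κ * η := fun f hfh hfin => by
    -- The value 0 costs nothing, and the level sets of the other values have finite volume because
    -- h is integrable; inner regularity by compact sets is then available.
    set t := f.range.filter fun a => a ≠ 0 with ht
    have hat : ∀ a ∈ t, a ≠ 0 ∧ a ≠ ∞ := fun a ha => by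
      obtain ⟨ha1, ha2⟩ := Finset.mem_filter.1 ha
      obtain ⟨x, rfl⟩ := SimpleFunc.mem_range.1 ha1
      exact ⟨ha2, (hfin x).ne⟩
    have hvol : ∀ a ∈ t, volume (f ⁻¹' {a}) ≠ ∞ := fun a ha htop => by
      refine hhi (top_le_iff.1 ?_)
      calc (∞ : ℝ≥0∞) = a * volume (f ⁻¹' {a}) := by rw [htop, ENNReal.mul_top (hat a ha).1]
        _ = ∫⁻ _ in f ⁻¹' {a}, a := by simp
        _ ≤ ∫⁻ x in f ⁻¹' {a}, h x := setLIntegral_mono hh fun x hx => by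
            rw [← show f x = a from hx]
            exact hfh x
        _ ≤ ∫⁻ x, h x := setLIntegral_le_lintegral _ _
    have hGfin : ∀ a ∈ t, G a ≠ ∞ := fun a ha =>
      (densityCost_lt_top (fun η hη => limErr_lt_top hc hd hφ hη) κ (hat a ha).2).ne
    have hsum : ∫⁻ x, G (f x) = ∑ a ∈ t, volume (f ⁻¹' {a}) * G a := by
      have h1 : ∫⁻ x, G (f x) = (f.map G).lintegral volume := by
        rw [← SimpleFunc.lintegral_eq_lintegral]
        rfl
      rw [h1, SimpleFunc.map_lintegral, ht, Finset.sum_filter]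
      refine Finset.sum_congr rfl fun a _ => ?_
      split_ifs with ha
      · rw [mul_comm]
      · rw [not_not.1 ha, hG, densityCost_zero, zero_mul]
    have hK : ∀ K : ℝ≥0∞ → Set (Fin d → ℝ), (∀ a ∈ t, K a ⊆ f ⁻¹' {a} ∧ IsCompact (K a)) →
        ∑ a ∈ t, volume (K a) * G a ≤ b + κ * η := fun K hKt => by
      have hKd : (t : Set ℝ≥0∞).PairwiseDisjoint K := fun a ha a' ha' haa' => by
        refine Set.disjoint_left.2 fun x hx hx' => haa' ?_
        rw [← show f x = a from (hKt a ha).1 hx, ← show f x = a' from (hKt a' ha').1 hx']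
      refine ENNReal.le_of_forall_pos_le_add fun ε hε _ => ?_
      obtain ⟨s, ⟨C, hC, hCe⟩, hs, hs0⟩ := (hfreq.and_eventually
        ((eventually_sum_densityCost_le hc hd hφ t (fun a ha => (hKt a ha).2) hKd κ (a := id)
          (fun a ha => (hat a ha).2) hε).and (eventually_gt_atTop 0))).exists
      have hs0' : (s : ℝ≥0∞) ^ d ≠ 0 := pow_ne_zero _ (by simpa using hs0.ne')
      have hsum' : ∑ a ∈ t, a * (∫⁻ x in K a, err nrm φ s C x) ≤ b := by
        calc ∑ a ∈ t, a * (∫⁻ x in K a, err nrm φ s C x)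
            = ∑ a ∈ t, ∫⁻ x in K a, a * err nrm φ s C x :=
              Finset.sum_congr rfl fun a _ => (lintegral_const_mul _ (measurable_err hφ _ _)).symm
          _ ≤ ∑ a ∈ t, ∫⁻ x in K a, h x * err nrm φ s C x := by
              refine Finset.sum_le_sum fun a ha =>
                setLIntegral_mono (hh.mul (measurable_err hφ _ _)) fun x hx => ?_
              gcongr
              rw [← show f x = a from (hKt a ha).1 hx]
              exact hfh x
          _ = ∫⁻ x in ⋃ a ∈ t, K a, h x * err nrm φ s C x :=
              (lintegral_biUnion_finset hKd (fun a ha => (hKt a ha).2.measurableSet) _).symm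
          _ ≤ ∫⁻ x, h x * err nrm φ s C x := setLIntegral_le_lintegral _ _
          _ = ∫⁻ x, err nrm φ s C x ∂volume.withDensity h :=
              (lintegral_withDensity_eq_lintegral_mul _ hh (measurable_err hφ _ _)).symm
          _ ≤ _ := (lintegral_mono' hm le_rfl).trans hCe
      refine (hs C).trans ?_
      gcongr
      · exact hsum'
      · rw [mul_div_assoc]
        gcongr
        rwa [ENNReal.div_le_iff hs0' (by finiteness)]
    rw [hsum]
    refine ENNReal.le_of_forall_pos_le_add fun ε hε _ => ?_
    set S := ∑ a ∈ t, G a with hS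
    have hSfin : S ≠ ∞ := ENNReal.sum_ne_top.2 hGfin
    set e : ℝ≥0 := ε / (S.toNNReal + 1) with he
    have he0 : (e : ℝ≥0∞) ≠ 0 := by
      have : 0 < e := by positivity
      simpa using this.ne'
    have heS : (e : ℝ≥0∞) * S ≤ ε := by
      rw [← ENNReal.coe_toNNReal hSfin]
      norm_cast
      rw [he, div_mul_eq_mul_div, div_le_iff₀ (by positivity)]
      gcongr
      exact le_self_add
    have hex : ∀ a : ℝ≥0∞, ∃ K, a ∈ t → (K ⊆ f ⁻¹' {a} ∧ IsCompact K) ∧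
        volume (f ⁻¹' {a}) < volume K + e := fun a => by
      by_cases ha : a ∈ t
      · obtain ⟨K, h1, h2, h3⟩ := (f.measurableSet_fiber a).exists_isCompact_lt_add (hvol a ha) he0
        exact ⟨K, fun _ => ⟨⟨h1, h2⟩, h3⟩⟩
      · exact ⟨∅, fun h => absurd h ha⟩
    choose K hKt using hex
    calc ∑ a ∈ t, volume (f ⁻¹' {a}) * G a ≤ ∑ a ∈ t, (volume (K a) + e) * G a := by
          gcongr with a ha
          exact (hKt a ha).2.le
      _ = ∑ a ∈ t, volume (K a) * G a + e * S := by
          rw [hS, Finset.mul_sum, ← Finset.sum_add_distrib]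
          exact Finset.sum_congr rfl fun a _ => by ring
      _ ≤ _ := by
          gcongr
          exact hK K fun a ha => (hKt a ha).1
  have hGm : Measurable G := (densityCost_mono _).measurable
  calc ∫⁻ x, G (h x) ≤ ∫⁻ x, ⨆ n, G (SimpleFunc.eapprox h n x) := by
        refine lintegral_mono_ae ?_
        filter_upwards [ae_lt_top hh hhi] with x hx
        exact iSup_densityCost hx.ne (SimpleFunc.iSup_eapprox_apply hh x)
    _ = ⨆ n, ∫⁻ x, G (SimpleFunc.eapprox h n x) := by
        refine lintegral_iSup (fun n => hGm.comp (SimpleFunc.eapprox h n).measurable) ?_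
        exact fun n n' hnn' x => densityCost_mono _ (SimpleFunc.monotone_eapprox h hnn' x)
    _ ≤ _ := iSup_le fun n => hsimple _ (fun x => by
        rw [← SimpleFunc.iSup_eapprox_apply hh x]
        exact le_iSup (fun n => SimpleFunc.eapprox h n x) n)
        fun x => SimpleFunc.eapprox_lt_top h n x

end OrliczQuantization
-- The upper bound on a cube: densities and singular measures
namespace OrliczQuantization
variable {d : ℕ} {nrm : Seminorm ℝ (Fin d → ℝ)} {φ : ℝ≥0 → ℝ≥0}

lemma exists_forall_phi_div_le (hφ : Monotone φ) (hφ₀ : Tendsto φ (𝓝[>] 0) (𝓝 0)) (a : ℝ≥0)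
    {ε : ℝ≥0} (hε : 0 < ε) : ∃ M₀ : ℝ≥0, 0 < M₀ ∧ ∀ M, M₀ ≤ M → φ (a / M) ≤ ε := by
  obtain ⟨τ, hτ, hτ0⟩ := ((hφ₀.eventually_lt_const hε).and self_mem_nhdsWithin).exists
  have hτ0' : 0 < τ := hτ0
  refine ⟨a / τ + 1, by positivity, fun M hM => le_trans (hφ ?_) hτ.le⟩
  have hM0 : 0 < M := lt_of_lt_of_le (by positivity) hM
  rw [div_le_iff₀ hM0]
  calc a = τ * (a / τ) := by rw [mul_div_cancel₀ _ hτ0'.ne']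
    _ ≤ τ * M := by gcongr; exact le_self_add.trans hM

lemma tendsto_limErr_atTop {c : ℝ≥0} (hc : NormBound nrm c) (hd : 0 < d) (hφ : Monotone φ)
    (hφ₀ : Tendsto φ (𝓝[>] 0) (𝓝 0)) : Tendsto (limErr nrm φ) atTop (𝓝 0) := by
  refine ENNReal.tendsto_nhds_zero.2 fun ε hε => ?_
  obtain ⟨e, he, heε⟩ := ENNReal.lt_iff_exists_nnreal_btwn.1 hε
  obtain ⟨M, hM, hMe⟩ := exists_forall_phi_div_le hφ hφ₀ c (show 0 < e by exact_mod_cast he)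
  have hlim := NNReal.tendsto_rpow_atTop (show (0 : ℝ) < (d : ℝ)⁻¹ by positivity)
  filter_upwards [hlim.eventually_ge_atTop M, eventually_gt_atTop 0] with η hη hη0
  refine (limErr_le_phi hc hd hφ hη0).trans (le_trans ?_ heε.le)
  rw [NNReal.rpow_neg, inv_mul_eq_div]
  exact_mod_cast hMe _ hη

lemma withDensity_restrict_le_sum (f : SimpleFunc (Fin d → ℝ) ℝ≥0∞) {A : Set (Fin d → ℝ)}
    (hA : MeasurableSet A) :
    (volume.withDensity f).restrict A
      ≤ ∑ a ∈ f.range, a • volume.restrict (A ∩ f ⁻¹' {a}) := by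
  refine Measure.le_iff.2 fun s hs => le_of_eq ?_
  rw [Measure.restrict_apply hs, withDensity_apply _ (hs.inter hA),
    SimpleFunc.lintegral_eq_lintegral, SimpleFunc.lintegral, Measure.finsetSum_apply]
  refine Finset.sum_congr rfl fun a _ => ?_
  rw [Measure.smul_apply, smul_eq_mul, Measure.restrict_apply (f.measurableSet_fiber a),
    Measure.restrict_apply hs]
  congr 2
  ext x
  simp only [mem_inter_iff]
  tauto

/-- The density is approximated from below by a simple function, each level set is served as a
multiple of Lebesgue measure, and the remainder h - f has so little mass that few points suffice. -/
lemma achievable_withDensity_restrict {c : ℝ≥0} (hc : NormBound nrm c) (hd : 0 < d)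
    (hφ : Monotone φ) {h : (Fin d → ℝ) → ℝ≥0∞} (hh : Measurable h) {A : Set (Fin d → ℝ)}
    (hA : MeasurableSet A) {v : Fin d → ℝ} {l : ℝ≥0} (hl : 0 < l) (hAb : A ⊆ box v l)
    (hhA : ∫⁻ x in A, h x ≠ ∞) {η : ℝ≥0} (hη : 0 < η) {ε : ℝ≥0} (hε : 0 < ε) :
    Achievable nrm φ ((volume.withDensity h).restrict A)
      ((∫⁻ x in A, h x) * limErr nrm φ η + ε) (volume A * η + ε) := by
  obtain ⟨δ, hδ, hsmall⟩ := exists_pos_forall_achievable hc hd hφ hl (half_pos hε)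
  have hδ' : (δ : ℝ≥0∞) ≠ 0 := by simpa using hδ.ne'
  obtain ⟨n, hn⟩ : ∃ n, ∫⁻ x in A, h x < ∫⁻ x in A, SimpleFunc.eapprox h n x ∂volume + δ := by
    have h1 : ∫⁻ x in A, h x = ⨆ n, ∫⁻ x in A, SimpleFunc.eapprox h n x := by
      rw [← lintegral_iSup (fun n => (SimpleFunc.eapprox h n).measurable)
        fun n n' hnn' x => SimpleFunc.monotone_eapprox h hnn' x]
      simp only [SimpleFunc.iSup_eapprox_apply hh]
    by_contra! hcon
    have h2 : ∫⁻ x in A, h x ∂volume + δ ≤ ∫⁻ x in A, h x := by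
      conv_lhs => rw [h1, ENNReal.iSup_add]
      exact iSup_le hcon
    exact (ENNReal.lt_add_right hhA hδ').not_ge h2
  set f := SimpleFunc.eapprox h n with hf
  have hfh : ∀ x, f x ≤ h x := fun x => by
    rw [← SimpleFunc.iSup_eapprox_apply hh x]
    exact le_iSup (fun n => SimpleFunc.eapprox h n x) n
  have hdecomp : volume.withDensity h = volume.withDensity f + volume.withDensity (h - ⇑f) := by
    rw [← withDensity_add_left f.measurable]
    congr 1
    ext x
    exact (add_tsub_cancel_of_le (hfh x)).symm
  have hrest : ∫⁻ x in A, (h - ⇑f) x ≤ δ := by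
    have h1 : ∫⁻ x in A, f x ≠ ∞ := ((lintegral_mono hfh).trans_lt hhA.lt_top).ne
    have h2 : ∫⁻ x in A, (h - ⇑f) x = ∫⁻ x in A, h x ∂volume - ∫⁻ x in A, f x :=
      lintegral_sub f.measurable h1 (ae_of_all _ hfh)
    rw [h2]
    exact tsub_le_iff_left.2 hn.le
  have hr := hsmall v ((volume.withDensity (h - ⇑f)).restrict A) (by
    refine (measure_mono (subset_univ _)).trans ?_
    rwa [Measure.restrict_apply_univ, withDensity_apply _ hA])
  -- This one constant dominates both the total weight of the distortion errors, ∑ a, and the number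
  -- of level sets that contribute an error to the size.
  set S := ∑ a ∈ f.range, (a + 1) with hS
  have hSfin : S ≠ ∞ := ENNReal.sum_ne_top.2 fun a ha => by
    obtain ⟨x, rfl⟩ := SimpleFunc.mem_range.1 ha
    have := SimpleFunc.eapprox_lt_top h n x
    finiteness
  set e : ℝ≥0 := ε / 2 / (S.toNNReal + 1) with he
  have he0 : 0 < e := by positivity
  have heS : S * e ≤ (ε / 2 : ℝ≥0) := by
    rw [← ENNReal.coe_toNNReal hSfin]
    norm_cast
    rw [he, mul_div_assoc', div_le_iff₀ (by positivity), mul_comm]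
    gcongr
    exact le_self_add
  have hsum := Achievable.sum f.range fun a _ => (achievable_volume_restrict (nrm := nrm) hc hd hφ hl
    ((inter_subset_left (s := A) (t := f ⁻¹' {a})).trans hAb) hη he0).smul a
  have hvol : ∑ a ∈ f.range, a * volume (A ∩ f ⁻¹' {a}) = ∫⁻ x in A, f x := by
    rw [SimpleFunc.lintegral_eq_lintegral, SimpleFunc.lintegral]
    refine Finset.sum_congr rfl fun a _ => ?_
    rw [Measure.restrict_apply (f.measurableSet_fiber a), inter_comm]
  have hvol' : ∑ a ∈ f.range, volume (A ∩ f ⁻¹' {a}) = volume A := by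
    rw [← Measure.restrict_apply_univ A, ← f.sum_range_measure_preimage_singleton (volume.restrict A)]
    refine Finset.sum_congr rfl fun a _ => ?_
    rw [Measure.restrict_apply (f.measurableSet_fiber a), inter_comm]
  refine (hsum.add hr).mono ?_ ?_ ?_
  · rw [hdecomp, Measure.restrict_add, Measure.restrict_restrict (measurableSet_box _ _),
      inter_eq_self_of_subset_right hAb]
    exact add_le_add (withDensity_restrict_le_sum f hA) le_rfl
  · calc _ = (∑ a ∈ f.range, a * volume (A ∩ f ⁻¹' {a})) * limErr nrm φ η
          + (∑ a ∈ f.range, a) * e + (ε / 2 : ℝ≥0) := by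
          rw [Finset.sum_mul, Finset.sum_mul, ← Finset.sum_add_distrib]
          congr 1
          exact Finset.sum_congr rfl fun a _ => by ring
      _ ≤ (∫⁻ x in A, h x) * limErr nrm φ η + S * e + (ε / 2 : ℝ≥0) := by
          rw [hvol]
          gcongr
          · exact hfh _
          · exact Finset.sum_le_sum fun a _ => le_self_add
      _ ≤ (∫⁻ x in A, h x) * limErr nrm φ η + (ε / 2 : ℝ≥0) + (ε / 2 : ℝ≥0) := by gcongr
      _ = _ := by rw [add_assoc, ← ENNReal.coe_add, add_halves]
  · calc _ = (∑ a ∈ f.range, volume (A ∩ f ⁻¹' {a})) * η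
          + (∑ a ∈ f.range, 1) * e + (ε / 2 : ℝ≥0) := by
          rw [Finset.sum_mul, Finset.sum_mul, ← Finset.sum_add_distrib]
          congr 1
          exact Finset.sum_congr rfl fun a _ => by ring
      _ ≤ volume A * η + S * e + (ε / 2 : ℝ≥0) := by
          rw [hvol']
          gcongr
          exact Finset.sum_le_sum fun a _ => le_add_self
      _ ≤ volume A * η + (ε / 2 : ℝ≥0) + (ε / 2 : ℝ≥0) := by gcongr
      _ = _ := by rw [add_assoc, ← ENNReal.coe_add, add_halves]

/-- On a cube every absolutely continuous measure can be served with point density `ξ`. -/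
lemma achievable_withDensity_box {c : ℝ≥0} (hc : NormBound nrm c) (hd : 0 < d)
    (hφ : Monotone φ) (hφ₀ : Tendsto φ (𝓝[>] 0) (𝓝 0)) {h : (Fin d → ℝ) → ℝ≥0∞}
    (hh : Measurable h) (hhi : ∫⁻ x, h x ≠ ∞) (v : Fin d → ℝ) {l : ℝ≥0} (hl : 0 < l)
    {ξ : (Fin d → ℝ) → ℝ≥0} (hξ : Measurable ξ) {ε : ℝ≥0} (hε : 0 < ε) :
    Achievable nrm φ ((volume.withDensity h).restrict (box v l))
      (∫⁻ x, h x * complexity nrm φ (ξ x) ∂volume + ε) (∫⁻ x, ξ x ∂volume + ε) := by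
  obtain ⟨H, hH⟩ : ∃ H : ℝ≥0, ∫⁻ x, h x = H := ⟨_, (ENNReal.coe_toNNReal hhi).symm⟩
  set e : ℝ≥0 := ε / 2 / (H + l ^ d + 1) with he
  have he0 : 0 < e := by positivity
  have heH : H * e ≤ ε / 2 := by
    rw [he, mul_div_assoc', div_le_iff₀ (by positivity), mul_comm]
    gcongr
    rw [add_assoc]
    exact le_self_add
  have hel : l ^ d * e ≤ ε / 2 := by
    rw [he, mul_div_assoc', div_le_iff₀ (by positivity), mul_comm]
    gcongr
    rw [add_right_comm]
    exact le_add_self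
  obtain ⟨L, hL0, hL⟩ : ∃ L : ℝ≥0, 0 < L ∧ limErr nrm φ L ≤ e := by
    have he0' : (0 : ℝ≥0∞) < e := by exact_mod_cast he0
    obtain ⟨L, h1, h2⟩ := (((tendsto_limErr_atTop hc hd hφ hφ₀).eventually_lt_const he0').and
      (eventually_gt_atTop 0)).exists
    exact ⟨L, h2, h1.le⟩
  set n := ⌈L / e⌉₊ with hn
  have hn0 : 0 < n := Nat.ceil_pos.2 (by positivity)
  have hnL : L ≤ n * e := by
    have := Nat.le_ceil (L / e)
    rwa [div_le_iff₀ he0] at this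
  -- ξ is rounded up to a positive multiple of e, so that g does not increase and η = 0 is avoided.
  -- The cap n keeps the number of pieces finite and is harmless because g(n e) ≤ e.
  let J : (Fin d → ℝ) → ℕ := fun x => min (⌊ξ x / e⌋₊ + 1) n
  have hJ : Measurable J := by
    have : Measurable fun x => ⌊ξ x / e⌋₊ := Nat.measurable_floor.comp (hξ.div_const e)
    exact (this.add_const 1).min measurable_const
  let A : ℕ → Set (Fin d → ℝ) := fun j => box v l ∩ J ⁻¹' {j}
  have hAm : ∀ j, MeasurableSet (A j) := fun j =>
    (measurableSet_box _ _).inter (hJ (measurableSet_singleton j))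
  have hJ1 : ∀ x, 1 ≤ J x := fun x => le_min (by omega) hn0
  have hcov : box v (l : ℝ) = ⋃ j ∈ Finset.Icc 1 n, A j := by
    ext x
    simp only [mem_iUnion, exists_prop]
    constructor
    · exact fun hx => ⟨J x, Finset.mem_Icc.2 ⟨hJ1 x, min_le_right _ _⟩, hx, rfl⟩
    · exact fun ⟨j, _, hj⟩ => hj.1
  have hAd : ((Finset.Icc 1 n : Finset ℕ) : Set ℕ).PairwiseDisjoint A := fun i _ j _ hij =>
    Set.disjoint_left.2 fun x hx hx' => hij (by rw [← show J x = i from hx.2, ← show J x = j from hx'.2])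
  have hJg : ∀ x, limErr nrm φ (J x * e) ≤ complexity nrm φ (ξ x) + e := fun x => by
    rcases le_total (⌊ξ x / e⌋₊ + 1) n with hle | hle
    · have h1 : J x = ⌊ξ x / e⌋₊ + 1 := min_eq_left hle
      have h2 : ξ x ≤ J x * e := by
        rw [h1, ← div_le_iff₀ he0]
        push_cast
        exact (Nat.lt_floor_add_one _).le
      have h3 : 0 < (J x : ℝ≥0) * e := mul_pos (by exact_mod_cast hJ1 x) he0
      rw [← complexity_eq_limErr hc hd hφ h3]
      exact (complexity_antitone hc hd hφ h2).trans le_self_add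
    · have h1 : J x = n := min_eq_right hle
      rw [h1]
      exact (limErr_antitone hnL).trans (hL.trans le_add_self)
  have hJξ : ∀ x, J x * e ≤ ξ x + e := fun x => by
    calc J x * e ≤ (⌊ξ x / e⌋₊ + 1 : ℕ) * e := by gcongr; exact min_le_left _ _
      _ = ⌊ξ x / e⌋₊ * e + e := by push_cast; ring
      _ ≤ ξ x / e * e + e := by gcongr; exact Nat.floor_le zero_le
      _ = _ := by rw [div_mul_cancel₀ _ he0.ne']
  have hgm : Measurable fun x => complexity nrm φ (ξ x) :=
    (complexity_continuous hc hd hφ).measurable.comp hξ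
  set e' : ℝ≥0 := ε / 2 / n with he'
  have he'0 : 0 < e' := by positivity
  have he's : ∑ _j ∈ Finset.Icc 1 n, (e' : ℝ≥0∞) = (ε / 2 : ℝ≥0) := by
    rw [Finset.sum_const, Nat.card_Icc, Nat.add_sub_cancel, nsmul_eq_mul]
    norm_cast
    rw [he', mul_div_cancel₀]
    exact_mod_cast hn0.ne'
  have hsum := Achievable.sum (Finset.Icc 1 n) fun j hj =>
    achievable_withDensity_restrict (nrm := nrm) hc hd hφ hh (hAm j) hl inter_subset_left
      ((setLIntegral_le_lintegral _ _).trans_lt hhi.lt_top).ne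
      (η := j * e) (mul_pos (by exact_mod_cast (Finset.mem_Icc.1 hj).1) he0) he'0
  refine hsum.mono ?_ ?_ ?_
  · conv_lhs => rw [hcov]
    exact restrict_biUnion_le_sum _ _ _
  · rw [Finset.sum_add_distrib, he's]
    calc _ ≤ ∑ j ∈ Finset.Icc 1 n, (∫⁻ x in A j, h x * (complexity nrm φ (ξ x) + e))
          + (ε / 2 : ℝ≥0) := by
          refine add_le_add (Finset.sum_le_sum fun j _ => ?_) le_rfl
          rw [← lintegral_mul_const _ hh]
          refine setLIntegral_mono (hh.mul (hgm.add_const _)) fun x hx => ?_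
          gcongr
          rw [← show J x = j from hx.2]
          exact hJg x
      _ = (∫⁻ x in box v l, h x * (complexity nrm φ (ξ x) + e)) + (ε / 2 : ℝ≥0) := by
          rw [← lintegral_biUnion_finset hAd fun j _ => hAm j, ← hcov]
      _ ≤ (∫⁻ x, h x * (complexity nrm φ (ξ x) + e)) + (ε / 2 : ℝ≥0) := by
          gcongr
          exact Measure.restrict_le_self
      _ = (∫⁻ x, h x * complexity nrm φ (ξ x)) + H * e + (ε / 2 : ℝ≥0) := by
          simp only [mul_add]
          rw [lintegral_add_right _ (hh.mul_const _), lintegral_mul_const _ hh, hH]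
      _ ≤ (∫⁻ x, h x * complexity nrm φ (ξ x)) + (ε / 2 : ℝ≥0) + (ε / 2 : ℝ≥0) := by
          gcongr
          exact_mod_cast heH
      _ = _ := by rw [add_assoc, ← ENNReal.coe_add, add_halves]
  · rw [Finset.sum_add_distrib, he's]
    calc _ ≤ ∑ j ∈ Finset.Icc 1 n, (∫⁻ x in A j, ((ξ x : ℝ≥0∞) + e)) + (ε / 2 : ℝ≥0) := by
          refine add_le_add (Finset.sum_le_sum fun j _ => ?_) le_rfl
          rw [mul_comm, ← setLIntegral_const]
          refine setLIntegral_mono (hξ.coe_nnreal_ennreal.add_const _) fun x hx => ?_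
          rw [← show J x = j from hx.2]
          exact_mod_cast hJξ x
      _ = (∫⁻ x in box v l, ((ξ x : ℝ≥0∞) + e)) + (ε / 2 : ℝ≥0) := by
          rw [← lintegral_biUnion_finset hAd fun j _ => hAm j, ← hcov]
      _ = (∫⁻ x in box v l, (ξ x : ℝ≥0∞)) + (l : ℝ≥0∞) ^ d * e + (ε / 2 : ℝ≥0) := by
          rw [lintegral_add_right _ measurable_const, setLIntegral_const, volume_box, mul_comm]
      _ ≤ (∫⁻ x, (ξ x : ℝ≥0∞)) + (ε / 2 : ℝ≥0) + (ε / 2 : ℝ≥0) := by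
          refine add_le_add (add_le_add (setLIntegral_le_lintegral _ _) ?_) le_rfl
          exact_mod_cast hel
      _ = _ := by rw [add_assoc, ← ENNReal.coe_add, add_halves]

/-- Singular measures on a cube need asymptotically no points. -/
lemma achievable_mutuallySingular {c : ℝ≥0} (hc : NormBound nrm c) (hd : 0 < d)
    (hφ : Monotone φ) (hφ₀ : Tendsto φ (𝓝[>] 0) (𝓝 0)) {m : Measure (Fin d → ℝ)}
    [IsFiniteMeasure m] (hm : m ⟂ₘ volume) (v : Fin d → ℝ) {l : ℝ≥0} (hl : 0 < l) {ε : ℝ≥0}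
    (hε : 0 < ε) : Achievable nrm φ (m.restrict (box v l)) ε ε := by
  obtain ⟨S, hS, hmS, hvS⟩ := hm
  obtain ⟨δ, hδ, hsmall⟩ := exists_pos_forall_achievable hc hd hφ hl (half_pos hε)
  obtain ⟨H, hH⟩ : ∃ H : ℝ≥0, m univ = H := ⟨_, (ENNReal.coe_toNNReal (measure_ne_top _ _)).symm⟩
  obtain ⟨M, hM, hMφ⟩ := exists_forall_phi_div_le hφ hφ₀ (2 * c)
    (show 0 < ε / 2 / (H + 1) by positivity)
  have hδ'0 : 0 < ε / 2 / M ^ d := by positivity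
  -- The measure m lives on the null set Sᶜ. The volume bound for O is chosen so that a grid of
  -- density M^d on cells inside O costs at most ε / 2.
  obtain ⟨O, hSO, hO, hOv⟩ := Sᶜ.exists_isOpen_lt_of_lt ((ε / 2 / M ^ d : ℝ≥0) : ℝ≥0∞)
    (by rw [hvS]; exact_mod_cast hδ'0)
  obtain ⟨n, hn, Z, hZ, hZδ⟩ := exists_cells_subset hO m (show (0 : ℝ≥0∞) < δ by exact_mod_cast hδ)
  set B := ⋃ z ∈ Z, cell n z with hB
  have hn0 : (0 : ℝ≥0) < 1 / n := by positivity
  have hcells := Achievable.sum Z fun z _ =>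
    achievable_restrict_box (nrm := nrm) hc hφ m (fun i => (z i : ℝ) / n) hn0 hM
  have hBm : MeasurableSet B := Z.measurableSet_biUnion fun z _ => measurableSet_cell n z
  have hrest := hsmall v (m.restrict Bᶜ) (by
    refine (measure_mono (subset_univ _)).trans ?_
    rw [Measure.restrict_apply_univ]
    calc m Bᶜ ≤ m (S ∪ (O \ B)) := measure_mono fun x hx => (em (x ∈ S)).imp id fun h =>
          ⟨hSO h, hx⟩
      _ ≤ m S + m (O \ B) := measure_union_le _ _
      _ ≤ δ := by rw [hmS, zero_add]; exact hZδ)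
  refine (hcells.add hrest).mono ?_ ?_ ?_
  · refine (restrict_le_sum_cells m _ n Z).trans (add_le_add le_rfl ?_)
    rw [Measure.restrict_restrict (measurableSet_box _ _)]
    exact le_rfl
  · calc _ = (φ (2 * c / M) : ℝ≥0∞) * m B + (ε / 2 : ℝ≥0) := by
          rw [← Finset.mul_sum, measure_biUnion_finset (fun z _ z' _ h => pairwise_disjoint_cell hn h)
            fun z _ => measurableSet_cell n z]
          rfl
      _ ≤ ((ε / 2 / (H + 1) : ℝ≥0) : ℝ≥0∞) * H + (ε / 2 : ℝ≥0) := by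
          rw [← hH]
          gcongr
          · exact hMφ M le_rfl
          · exact subset_univ _
      _ ≤ ((ε / 2 : ℝ≥0) : ℝ≥0∞) + (ε / 2 : ℝ≥0) := by
          gcongr
          norm_cast
          rw [div_mul_eq_mul_div, div_le_iff₀ (by positivity)]
          gcongr
          exact le_self_add
      _ = ε := by rw [← ENNReal.coe_add, add_halves]
  · rw [← Finset.mul_sum]
    calc _ ≤ (M : ℝ≥0∞) ^ d * ((ε / 2 / M ^ d : ℝ≥0) : ℝ≥0∞) + (ε / 2 : ℝ≥0) := by
          gcongr
          exact (sum_cells_le hn hZ).trans hOv.le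
      _ = ε := by
          norm_cast
          rw [mul_div_cancel₀ _ (by positivity), add_halves]

end OrliczQuantization
-- Tails under the growth condition, and the global upper bound
namespace OrliczQuantization
variable {d : ℕ} {nrm : Seminorm ℝ (Fin d → ℝ)} {φ Ψ : ℝ≥0 → ℝ≥0}

/-- The radii in the growth condition are unbounded. -/
lemma exists_lt_of_tsum_lt_top (hd : 0 < d) (hφ : Monotone φ)
    (hφne : φ ≠ 0) (hΨ : Monotone Ψ) {α r : ℕ → ℝ≥0} (hα : ∀ n, 0 < α n) (hαs : Summable α)
    (hr : Monotone r) (hr0 : ∃ n, 0 < r n)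
    (hsum : ∑' n, (φ (α n ^ (-(d : ℝ)⁻¹) * r (n + 1)) : ℝ≥0∞) / (Ψ (r n) : ℝ≥0∞) < ∞) (R : ℝ≥0) :
    ∃ n, R < r n := by
  by_contra! hcon
  obtain ⟨T, hT⟩ : ∃ T, 0 < φ T := by
    by_contra! h
    exact hφne (funext fun t => le_antisymm (h t) zero_le)
  obtain ⟨k, hk⟩ := hr0
  have h1 : Tendsto (fun n => (φ (α n ^ (-(d : ℝ)⁻¹) * r (n + 1)) : ℝ≥0∞) / (Ψ (r n) : ℝ≥0∞))
      atTop (𝓝 0) := ENNReal.tendsto_atTop_zero_of_tsum_ne_top hsum.ne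
  -- If the radii stayed below R, then α_n^{-1/d} → ∞ would push the terms above this constant,
  -- against summability. The `+ 1` covers Ψ R = 0.
  have h2 : (0 : ℝ≥0∞) < (φ T : ℝ≥0∞) / (Ψ R + 1 : ℝ≥0) :=
    ENNReal.div_pos (by simpa using hT.ne') ENNReal.coe_ne_top
  have hT1 : 0 < r k / (T + 1) := by positivity
  have h3 : Tendsto (fun n => α n ^ ((d : ℝ)⁻¹)) atTop (𝓝 0) := by
    have h := (NNReal.tendsto_atTop_zero_of_summable hαs).nnrpow
      (tendsto_const_nhds (x := (d : ℝ)⁻¹)) (Or.inr (by positivity))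
    rwa [NNReal.zero_rpow (by positivity)] at h
  obtain ⟨n, hn1, hn2, hn3⟩ := ((h1.eventually_lt_const h2).and
    ((h3.eventually_lt_const hT1).and (eventually_ge_atTop k))).exists
  refine hn1.not_ge ?_
  have hαn : 0 < α n ^ ((d : ℝ)⁻¹) := NNReal.rpow_pos (hα n)
  gcongr
  · apply hφ
    rw [NNReal.rpow_neg, inv_mul_eq_div, le_div_iff₀ hαn]
    calc T * α n ^ ((d : ℝ)⁻¹) ≤ (T + 1) * (r k / (T + 1)) := by
          gcongr
          exact le_self_add
      _ = r k := by rw [mul_div_cancel₀]; positivity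
      _ ≤ r (n + 1) := hr (by omega)
  · exact (hΨ (hcon n)).trans le_self_add

/-- Under the growth condition the part of a measure far away from the origin can be served with
few points and small distortion. -/
lemma exists_achievable_tail {c : ℝ≥0} (hc : NormBound nrm c) (hd : 0 < d)
    (hφ : Monotone φ) (hφne : φ ≠ 0) (hΨ : Monotone Ψ)
    (hG : GrowthCondition d φ Ψ) {m : Measure (Fin d → ℝ)}
    (hm : ∫⁻ x, (Ψ (nrm x).toNNReal : ℝ≥0∞) ∂m ≠ ∞) {ε : ℝ≥0} (hε : 0 < ε) :
    ∃ R : ℝ≥0, Achievable nrm φ (m.restrict {x | R ≤ (nrm x).toNNReal}) ε ε := by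
  classical
  obtain ⟨α, r, hα, -, hαs, hr, hr0, hsum⟩ := hG
  have hunb := exists_lt_of_tsum_lt_top hd hφ hφne hΨ hα hαs hr hr0 hsum
  set T : ℕ → ℝ≥0∞ := fun n => (φ (α n ^ (-(d : ℝ)⁻¹) * r (n + 1)) : ℝ≥0∞) / (Ψ (r n) : ℝ≥0∞)
    with hT
  set EΨ := ∫⁻ x, (Ψ (nrm x).toNNReal : ℝ≥0∞) ∂m with hEΨ
  -- The factor 4c² compensates the constants of the grid on a cube of side 2 c r_{n+1}; K ≥ 1 is
  -- used for the shells that receive no grid.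
  set K : ℝ≥0 := max (4 * c * c) 1 with hK
  have hK0 : 0 < K := lt_max_of_lt_right one_pos
  have hnm : Measurable fun x : Fin d → ℝ => (nrm x).toNNReal :=
    (continuous_real_toNNReal.comp (seminorm_continuous nrm)).measurable
  have hlim1 : Tendsto (fun i => K ^ d * ∑' k, α (k + i)) atTop (𝓝 (K ^ d * 0)) :=
    (NNReal.tendsto_sum_nat_add α).const_mul _
  have hlim2 : Tendsto (fun i => (∑' k, T (k + i)) * EΨ) atTop (𝓝 (0 * EΨ)) :=
    ENNReal.Tendsto.mul_const (ENNReal.tendsto_sum_nat_add T hsum.ne) (Or.inr hm)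
  rw [mul_zero] at hlim1
  rw [zero_mul] at hlim2
  obtain ⟨i, hi1, hi2⟩ := ((hlim1.eventually_lt_const (half_pos hε)).and
    (hlim2.eventually_lt_const (show (0 : ℝ≥0∞) < ε by exact_mod_cast hε))).exists
  have hαi : Summable fun k => α (k + i) := (NNReal.summable_nat_add_iff i).2 hαs
  refine ⟨r i, ?_⟩
  have hs1 : Tendsto (fun s : ℝ≥0 => s ^ d * (ε / 2)) atTop atTop :=
    (tendsto_pow_atTop hd.ne').atTop_mul_const (half_pos hε)
  filter_upwards [hs1.eventually_ge_atTop 1, eventually_gt_atTop 0] with s hs hs0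
  -- The shell n gets at most K^d α_n s^d points. When the grid would have less than one point per
  -- edge it is omitted, and the origin alone is close enough. Since α_n → 0, only finitely many
  -- shells need points.
  have hgrid : ∀ n, ∃ C : Finset (Fin d → ℝ), (C.card : ℝ≥0) ≤ K ^ d * α n * s ^ d ∧
      (K * α n ^ ((d : ℝ)⁻¹) * s < 1 → C = ∅) ∧
      ∀ x, (nrm x).toNNReal < r (n + 1) → ∃ y ∈ insert 0 C,
        s * (nrm (x - y)).toNNReal ≤ α n ^ (-(d : ℝ)⁻¹) * r (n + 1) := fun n => by
    have hαn : 0 < α n ^ ((d : ℝ)⁻¹) := NNReal.rpow_pos (hα n)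
    rcases lt_or_ge (K * α n ^ ((d : ℝ)⁻¹) * s) 1 with hlt | hge
    · refine ⟨∅, by simp, fun _ => rfl, fun x hx => ⟨0, by simp, ?_⟩⟩
      rw [sub_zero, NNReal.rpow_neg]
      have h1 : s ≤ (α n ^ ((d : ℝ)⁻¹))⁻¹ := by
        rw [le_inv_comm₀ hs0 hαn, ← one_div s, le_div_iff₀ hs0]
        refine le_trans ?_ hlt.le
        gcongr
        calc α n ^ ((d : ℝ)⁻¹) = 1 * α n ^ ((d : ℝ)⁻¹) := (one_mul _).symm
          _ ≤ _ := by gcongr; exact le_max_right _ _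
      exact mul_le_mul' h1 hx.le
    · obtain ⟨C, hC, hCx⟩ := exists_grid hc (fun _ => -((c * r (n + 1) : ℝ≥0) : ℝ))
        (2 * (c * r (n + 1))) hge
      refine ⟨C, ?_, fun h => absurd h hge.not_gt, fun x hx => ?_⟩
      · rwa [mul_pow, mul_pow, rpow_inv_pow_natCast hd] at hC
      · have hxb : x ∈ box (fun _ => -((c * r (n + 1) : ℝ≥0) : ℝ))
            ((2 * (c * r (n + 1)) : ℝ≥0) : ℝ) := fun j _ => by
          have h1 : nrm x < r (n + 1) := by
            rwa [← NNReal.coe_lt_coe, Real.coe_toNNReal _ (apply_nonneg _ _)] at hx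
          have h2 : |x j| < c * r (n + 1) := by
            calc |x j| ≤ ‖x‖ := norm_le_pi_norm x j
              _ ≤ c * nrm x := hc.norm_le x
              _ < _ := by gcongr; exact hc.pos
          have h3 := abs_lt.1 h2
          push_cast
          constructor <;> linarith [h3.1, h3.2]
        obtain ⟨y, hy, hxy⟩ := hCx x hxb
        refine ⟨y, Finset.mem_insert_of_mem hy, ?_⟩
        calc s * (nrm (x - y)).toNNReal
            ≤ s * (2 * c * (2 * (c * r (n + 1))) / (K * α n ^ ((d : ℝ)⁻¹) * s)) := by gcongr
          _ = (4 * c * c / K) * (α n ^ (-(d : ℝ)⁻¹) * r (n + 1)) := by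
              rw [NNReal.rpow_neg]
              field_simp
              ring
          _ ≤ 1 * (α n ^ (-(d : ℝ)⁻¹) * r (n + 1)) := by
              gcongr
              rw [div_le_iff₀ hK0, one_mul]
              exact le_max_left _ _
          _ = _ := one_mul _
  choose D hDcard hDempty hDx using hgrid
  have hα0 : Tendsto (fun k => K * α (k + i) ^ ((d : ℝ)⁻¹) * s) atTop (𝓝 0) := by
    have h := (NNReal.tendsto_atTop_zero_of_summable hαi).nnrpow
      (tendsto_const_nhds (x := (d : ℝ)⁻¹)) (Or.inr (by positivity))
    rw [NNReal.zero_rpow (by positivity)] at h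
    simpa using (h.const_mul K).mul_const s
  obtain ⟨n₁, hn₁⟩ := eventually_atTop.1 (hα0.eventually_lt_const one_pos)
  -- The origin is shared by all shells and costs one point, which is at most (ε / 2) s^d for large
  -- s.
  set C := insert (0 : Fin d → ℝ) ((Finset.range n₁).biUnion fun k => D (k + i)) with hC
  have hCx : ∀ k x, (nrm x).toNNReal < r (k + i + 1) →
      err nrm φ s C x ≤ φ (α (k + i) ^ (-(d : ℝ)⁻¹) * r (k + i + 1)) := fun k x hx => by
    obtain ⟨y, hy, hxy⟩ := hDx (k + i) x hx
    have hyC : y ∈ C := by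
      rcases Finset.mem_insert.1 hy with rfl | hy
      · exact Finset.mem_insert_self _ _
      · refine Finset.mem_insert_of_mem (Finset.mem_biUnion.2 ⟨k, ?_, hy⟩)
        rw [Finset.mem_range]
        by_contra! hk
        rw [hDempty _ (hn₁ k hk)] at hy
        simp at hy
    refine (err_le hyC x).trans ?_
    gcongr
    exact hφ hxy
  refine ⟨C, ?_, ?_⟩
  · have h1 : (C.card : ℝ≥0) ≤ 1 + ∑ k ∈ Finset.range n₁, K ^ d * α (k + i) * s ^ d := by
      calc (C.card : ℝ≥0) ≤ 1 + ((Finset.range n₁).biUnion fun k => D (k + i)).card := by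
            rw [add_comm]
            exact_mod_cast Finset.card_insert_le _ _
        _ ≤ 1 + ∑ k ∈ Finset.range n₁, ((D (k + i)).card : ℝ≥0) := by
            gcongr
            exact_mod_cast Finset.card_biUnion_le
        _ ≤ _ := by
            gcongr with k _
            exact hDcard _
    have h2 : (C.card : ℝ≥0) ≤ ε * s ^ d := by
      calc (C.card : ℝ≥0) ≤ 1 + ∑ k ∈ Finset.range n₁, K ^ d * α (k + i) * s ^ d := h1
        _ = 1 + K ^ d * (∑ k ∈ Finset.range n₁, α (k + i)) * s ^ d := by
            rw [Finset.mul_sum, Finset.sum_mul]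
        _ ≤ s ^ d * (ε / 2) + (ε / 2) * s ^ d := by
            gcongr
            refine le_trans ?_ hi1.le
            gcongr
            exact hαi.sum_le_tsum _ fun _ _ => zero_le
        _ = _ := by rw [mul_comm, ← add_mul, add_halves]
    exact_mod_cast h2
  · set sh : ℕ → Set (Fin d → ℝ) := fun k =>
      {x | r (k + i) ≤ (nrm x).toNNReal ∧ (nrm x).toNNReal < r (k + i + 1)} with hsh
    have hcov : {x | r i ≤ (nrm x).toNNReal} ⊆ ⋃ k, sh k := fun x hx => by
      have hx' : r i ≤ (nrm x).toNNReal := hx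
      have hex := hunb (nrm x).toNNReal
      have h1 := Nat.find_spec hex
      have h2 : i < Nat.find hex := by
        by_contra! h
        exact (hx'.trans_lt h1).not_ge (hr h)
      have h3 := Nat.find_min hex (m := Nat.find hex - 1) (by omega)
      refine mem_iUnion.2 ⟨Nat.find hex - 1 - i, ?_, ?_⟩
      · rw [show Nat.find hex - 1 - i + i = Nat.find hex - 1 by omega]
        exact not_lt.1 h3
      · rwa [show Nat.find hex - 1 - i + i + 1 = Nat.find hex by omega]
    have hshell : ∀ k, ∫⁻ x in sh k, err nrm φ s C x ∂m ≤ T (k + i) * EΨ := fun k => by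
      set p := (φ (α (k + i) ^ (-(d : ℝ)⁻¹) * r (k + i + 1)) : ℝ≥0∞) with hp
      have h1 : ∫⁻ x in sh k, err nrm φ s C x ∂m ≤ p * m (sh k) := by
        rw [← setLIntegral_const]
        exact setLIntegral_mono measurable_const fun x hx => hCx k x hx.2
      refine h1.trans ?_
      have hTk : T (k + i) = p / Ψ (r (k + i)) := rfl
      have hfin : T (k + i) ≠ ∞ := ENNReal.ne_top_of_tsum_ne_top hsum.ne _
      -- If Ψ vanishes at the inner radius, the finiteness of the term forces its numerator to
      -- vanish. Otherwise the mass of the shell is bounded by Markov's inequality.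
      rcases eq_or_ne (Ψ (r (k + i)) : ℝ≥0∞) 0 with h0 | h0
      · have : p = 0 := by
          by_contra hp0
          rw [hTk, h0, ENNReal.div_zero hp0] at hfin
          exact hfin rfl
        rw [this, zero_mul]
        exact zero_le
      · have hmark : (Ψ (r (k + i)) : ℝ≥0∞) * m (sh k) ≤ EΨ := by
          refine le_trans ?_ (mul_meas_ge_le_lintegral
            (hΨ.measurable.comp hnm).coe_nnreal_ennreal (Ψ (r (k + i)) : ℝ≥0∞))
          gcongr
          intro x hx
          simp only [Function.comp, mem_ofPred_eq, ENNReal.coe_le_coe]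
          exact hΨ hx.1
        rw [hTk, div_eq_mul_inv, mul_assoc]
        gcongr
        rw [mul_comm, ← div_eq_mul_inv, ENNReal.le_div_iff_mul_le (Or.inl h0)
          (Or.inl ENNReal.coe_ne_top), mul_comm]
        exact hmark
    calc ∫⁻ x in {x | r i ≤ (nrm x).toNNReal}, err nrm φ s C x ∂m
        ≤ ∫⁻ x in ⋃ k, sh k, err nrm φ s C x ∂m := lintegral_mono_set hcov
      _ ≤ ∑' k, ∫⁻ x in sh k, err nrm φ s C x ∂m := lintegral_iUnion_le _ _
      _ ≤ ∑' k, T (k + i) * EΨ := ENNReal.tsum_le_tsum hshell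
      _ = (∑' k, T (k + i)) * EΨ := ENNReal.tsum_mul_right
      _ ≤ ε := hi2.le

lemma exists_box_superset {c : ℝ≥0} (hc : NormBound nrm c) (R : ℝ≥0) :
    ∃ (v : Fin d → ℝ) (l : ℝ≥0), 0 < l ∧ {x | R ≤ (nrm x).toNNReal}ᶜ ⊆ box v l := by
  refine exists_subset_box (Metric.isBounded_closedBall (x := 0) (r := c * R) |>.subset
    fun x hx => ?_)
  have h1 : (nrm x).toNNReal < R := not_le.1 hx
  rw [mem_closedBall_zero_iff]
  refine (hc.norm_le x).trans ?_
  gcongr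
  rw [← Real.coe_toNNReal (nrm x) (apply_nonneg _ _)]
  exact_mod_cast h1.le

/-- Point densities `ξ` are asymptotically realized by codebooks. -/
lemma achievable_of_density {c : ℝ≥0} (hc : NormBound nrm c) (hd : 0 < d)
    (hφ : Monotone φ) (hφ₀ : Tendsto φ (𝓝[>] 0) (𝓝 0)) (hφne : φ ≠ 0) (hΨ : Monotone Ψ)
    (hG : GrowthCondition d φ Ψ) {m : Measure (Fin d → ℝ)} [IsFiniteMeasure m]
    (hm : ∫⁻ x, (Ψ (nrm x).toNNReal : ℝ≥0∞) ∂m ≠ ∞) {ξ : (Fin d → ℝ) → ℝ≥0} (hξ : Measurable ξ)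
    {ε : ℝ≥0} (hε : 0 < ε) :
    Achievable nrm φ m (∫⁻ x, complexity nrm φ (ξ x) ∂(acPart m) + ε)
      (∫⁻ x, ξ x ∂volume + ε) := by
  have hε3 : 0 < ε / 3 := by positivity
  obtain ⟨R, hR⟩ := exists_achievable_tail hc hd hφ hφne hΨ hG hm hε3
  obtain ⟨v, l, hl, hsub⟩ := exists_box_superset hc R
  have hh : Measurable (acDensity m) := Measure.measurable_rnDeriv _ _
  have h1 := achievable_mutuallySingular hc hd hφ hφ₀
    (Measure.mutuallySingular_singularPart m volume) v hl hε3
  have h2 := achievable_withDensity_box hc hd hφ hφ₀ hh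
    (Measure.lintegral_rnDeriv_lt_top m volume).ne v hl hξ hε3
  have hε' : (ε : ℝ≥0∞) = (ε / 3 : ℝ≥0) + (ε / 3 : ℝ≥0) + (ε / 3 : ℝ≥0) := by
    rw [← ENNReal.coe_add, ← ENNReal.coe_add]
    congr 1
    rw [← NNReal.coe_inj]
    push_cast
    ring
  refine ((h2.add h1).add hR).mono ?_ (le_of_eq ?_) (le_of_eq ?_)
  · calc m = m.restrict univ := Measure.restrict_univ.symm
      _ ≤ m.restrict (box v l) + m.restrict {x | R ≤ (nrm x).toNNReal} := by
          refine (Measure.restrict_mono (fun x _ => ?_) le_rfl).trans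
            (Measure.restrict_union_le _ _)
          by_cases hx : x ∈ {x | R ≤ (nrm x).toNNReal}
          exacts [Or.inr hx, Or.inl (hsub hx)]
      _ ≤ _ := by
          refine add_le_add (le_of_eq ?_) le_rfl
          conv_lhs => rw [Measure.haveLebesgueDecomposition_add m volume]
          rw [Measure.restrict_add, add_comm]
          rfl
  · have h3 : ∫⁻ x, complexity nrm φ (ξ x) ∂(acPart m)
        = ∫⁻ x, acDensity m x * complexity nrm φ (ξ x) :=
      lintegral_withDensity_eq_lintegral_mul _ hh
        ((complexity_continuous hc hd hφ).measurable.comp hξ)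
    rw [hε', h3]
    simp only [add_assoc]
  · rw [hε']
    simp only [add_assoc]

/-- Any positive distortion is achieved at some finite density of points. -/
lemma exists_achievable {c : ℝ≥0} (hc : NormBound nrm c) (hd : 0 < d)
    (hφ : Monotone φ) (hφ₀ : Tendsto φ (𝓝[>] 0) (𝓝 0)) (hφne : φ ≠ 0) (hΨ : Monotone Ψ)
    (hG : GrowthCondition d φ Ψ) {m : Measure (Fin d → ℝ)} [IsFiniteMeasure m]
    (hm : ∫⁻ x, (Ψ (nrm x).toNNReal : ℝ≥0∞) ∂m ≠ ∞) {ε : ℝ≥0} (hε : 0 < ε) :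
    ∃ η : ℝ≥0, Achievable nrm φ m ε η := by
  obtain ⟨R, hR⟩ := exists_achievable_tail hc hd hφ hφne hΨ hG hm (half_pos hε)
  obtain ⟨v, l, hl, hsub⟩ := exists_box_superset hc R
  obtain ⟨H, hH⟩ : ∃ H : ℝ≥0, m univ = H := ⟨_, (ENNReal.coe_toNNReal (measure_ne_top _ _)).symm⟩
  obtain ⟨M, hM, hMφ⟩ := exists_forall_phi_div_le hφ hφ₀ (2 * c)
    (show 0 < ε / 2 / (H + 1) by positivity)
  refine ⟨M ^ d * l ^ d + ε / 2,
    ((achievable_restrict_box hc hφ m v hl hM).add hR).mono ?_ ?_ (by push_cast; rfl)⟩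
  · calc m = m.restrict univ := Measure.restrict_univ.symm
      _ ≤ _ := by
          refine (Measure.restrict_mono (fun x _ => ?_) le_rfl).trans
            (Measure.restrict_union_le _ _)
          by_cases hx : x ∈ {x | R ≤ (nrm x).toNNReal}
          exacts [Or.inr hx, Or.inl (hsub hx)]
  · calc _ ≤ ((ε / 2 / (H + 1) : ℝ≥0) : ℝ≥0∞) * H + (ε / 2 : ℝ≥0) := by
          rw [← hH]
          gcongr
          · exact hMφ M le_rfl
          · exact subset_univ _
      _ ≤ ((ε / 2 : ℝ≥0) : ℝ≥0∞) + (ε / 2 : ℝ≥0) := by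
          gcongr
          norm_cast
          rw [div_mul_eq_mul_div, div_le_iff₀ (by positivity)]
          gcongr
          exact le_self_add
      _ = ε := by rw [← ENNReal.coe_add, add_halves]

end OrliczQuantization
-- Minimizers of the penalized density problem
namespace OrliczQuantization

/-- The minimizers of `η ↦ a g(η) + η`. -/
def minimizers (g : ℝ≥0 → ℝ≥0∞) (a : ℝ≥0) : Set ℝ≥0 :=
  {η | ∀ η', a * g η + η ≤ a * g η' + η'}

/-- The largest minimizer of `η ↦ a g(η) + η`. -/
noncomputable def maxMinimizer (g : ℝ≥0 → ℝ≥0∞) (a : ℝ≥0) : ℝ≥0 := sSup (minimizers g a)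

/-- The smallest minimizer of `η ↦ a g(η) + η`. -/
noncomputable def minMinimizer (g : ℝ≥0 → ℝ≥0∞) (a : ℝ≥0) : ℝ≥0 := sInf (minimizers g a)

section Minimizers
variable {g : ℝ≥0 → ℝ≥0∞}

lemma continuous_penalized (hgc : Continuous g) (a : ℝ≥0) :
    Continuous fun η : ℝ≥0 => a * g η + η :=
  (ENNReal.continuous_const_mul ENNReal.coe_ne_top |>.comp hgc).add ENNReal.continuous_coe

lemma minimizers_nonempty (hgc : Continuous g) (hgf : ∀ η, 0 < η → g η < ∞) (a : ℝ≥0) :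
    (minimizers g a).Nonempty := by
  have hB : (a : ℝ≥0∞) * g 1 + (1 : ℝ≥0) ≠ ∞ := by
    have := hgf 1 one_pos
    finiteness
  -- Beyond B the linear penalty alone exceeds the value at η = 1, so the search can be confined to
  -- a compact interval.
  obtain ⟨B, hB'⟩ : ∃ B : ℝ≥0, (a : ℝ≥0∞) * g 1 + (1 : ℝ≥0) = B :=
    ⟨_, (ENNReal.coe_toNNReal hB).symm⟩
  have h1B : 1 ≤ B := by
    rw [← ENNReal.coe_le_coe, ← hB']
    exact le_add_self
  obtain ⟨η, hη, hmin⟩ := (isCompact_Icc (a := (0 : ℝ≥0)) (b := B)).exists_isMinOn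
    ⟨1, zero_le, h1B⟩ (continuous_penalized hgc a).continuousOn
  refine ⟨η, fun η' => ?_⟩
  rcases le_total η' B with h | h
  · exact hmin ⟨zero_le, h⟩
  · calc a * g η + η ≤ a * g 1 + (1 : ℝ≥0) := hmin ⟨zero_le, h1B⟩
      _ = B := hB'
      _ ≤ η' := by exact_mod_cast h
      _ ≤ _ := le_add_self

lemma isCompact_minimizers (hgc : Continuous g) (hgf : ∀ η, 0 < η → g η < ∞) (a : ℝ≥0) :
    IsCompact (minimizers g a) := by
  have hB : (a : ℝ≥0∞) * g 1 + (1 : ℝ≥0) ≠ ∞ := by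
    have := hgf 1 one_pos
    finiteness
  obtain ⟨B, hB'⟩ : ∃ B : ℝ≥0, (a : ℝ≥0∞) * g 1 + (1 : ℝ≥0) = B :=
    ⟨_, (ENNReal.coe_toNNReal hB).symm⟩
  refine (isCompact_Icc (a := (0 : ℝ≥0)) (b := B)).of_isClosed_subset ?_ fun η hη => ⟨zero_le, ?_⟩
  · simp only [minimizers, ofPred_forall]
    exact isClosed_iInter fun η' =>
      isClosed_le (continuous_penalized hgc a) continuous_const
  · rw [← ENNReal.coe_le_coe, ← hB']
    exact le_add_self.trans (hη 1)

lemma maxMinimizer_mem (hgc : Continuous g) (hgf : ∀ η, 0 < η → g η < ∞) (a : ℝ≥0) :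
    maxMinimizer g a ∈ minimizers g a :=
  (isCompact_minimizers hgc hgf a).sSup_mem (minimizers_nonempty hgc hgf a)

lemma minMinimizer_mem (hgc : Continuous g) (hgf : ∀ η, 0 < η → g η < ∞) (a : ℝ≥0) :
    minMinimizer g a ∈ minimizers g a :=
  (isCompact_minimizers hgc hgf a).sInf_mem (minimizers_nonempty hgc hgf a)

lemma le_maxMinimizer (hgc : Continuous g) (hgf : ∀ η, 0 < η → g η < ∞) {a η : ℝ≥0}
    (h : η ∈ minimizers g a) : η ≤ maxMinimizer g a :=
  le_csSup (isCompact_minimizers hgc hgf a).bddAbove h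

lemma minMinimizer_le {a η : ℝ≥0} (h : η ∈ minimizers g a) : minMinimizer g a ≤ η :=
  csInf_le (OrderBot.bddBelow _) h

/-- Add a₂ times the optimality of η₁ to a₁ times the optimality of η₂. The values of g cancel and
leave (a₂ - a₁)(η₁ - η₂) ≤ 0. -/
lemma minimizers_le_of_lt (hgf : ∀ η, 0 < η → g η < ∞) {a₁ a₂ η₁ η₂ : ℝ≥0} (ha : a₁ < a₂)
    (h₁ : η₁ ∈ minimizers g a₁) (h₂ : η₂ ∈ minimizers g a₂) : η₁ ≤ η₂ := by
  by_contra! hlt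
  have hg₁ : g η₁ ≠ ∞ := (hgf _ (zero_le.trans_lt hlt)).ne
  have hg₂ : g η₂ ≠ ∞ := fun htop => by
    have h := h₂ η₁
    rw [htop, ENNReal.mul_top (by simpa using (zero_le.trans_lt ha).ne')] at h
    have : (a₂ : ℝ≥0∞) * g η₁ + η₁ ≠ ∞ := by finiteness
    exact this (top_le_iff.1 (le_self_add.trans h))
  have e₁ := h₁ η₂
  have e₂ := h₂ η₁
  generalize g η₁ = G₁ at *
  generalize g η₂ = G₂ at *
  lift G₁ to ℝ≥0 using hg₁
  lift G₂ to ℝ≥0 using hg₂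
  norm_cast at e₁ e₂
  rw [← NNReal.coe_le_coe] at e₁ e₂
  rw [← NNReal.coe_lt_coe] at ha hlt
  push_cast at e₁ e₂
  have h0 : (0 : ℝ) ≤ a₁ := a₁.coe_nonneg
  have h3 : (0 : ℝ) < a₂ := lt_of_le_of_lt h0 ha
  have e₃ := mul_le_mul_of_nonneg_left e₁ h3.le
  have e₄ := mul_le_mul_of_nonneg_left e₂ h0
  nlinarith [mul_pos (sub_pos.2 ha) (sub_pos.2 hlt)]

lemma maxMinimizer_mono (hgc : Continuous g) (hgf : ∀ η, 0 < η → g η < ∞) :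
    Monotone (maxMinimizer g) := fun a b hab => by
  rcases hab.eq_or_lt with rfl | h
  · exact le_rfl
  · exact minimizers_le_of_lt hgf h (maxMinimizer_mem hgc hgf a) (maxMinimizer_mem hgc hgf b)

lemma minMinimizer_mono (hgc : Continuous g) (hgf : ∀ η, 0 < η → g η < ∞) :
    Monotone (minMinimizer g) := fun a b hab => by
  rcases hab.eq_or_lt with rfl | h
  · exact le_rfl
  · exact minimizers_le_of_lt hgf h (minMinimizer_mem hgc hgf a) (minMinimizer_mem hgc hgf b)

/-- The graph of the minimizer map is closed. Positivity of `a₀` keeps the product continuous where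
g takes the value ∞ at 0. -/
lemma mem_minimizers_of_tendsto (hgc : Continuous g)
    {a : ℕ → ℝ≥0} {η : ℕ → ℝ≥0} {a₀ η₀ : ℝ≥0} (ha₀ : 0 < a₀) (ha : Tendsto a atTop (𝓝 a₀))
    (hη : Tendsto η atTop (𝓝 η₀)) (h : ∀ n, η n ∈ minimizers g (a n)) : η₀ ∈ minimizers g a₀ := by
  have ha' : Tendsto (fun n => (a n : ℝ≥0∞)) atTop (𝓝 a₀) := ENNReal.tendsto_coe.2 ha
  have ha0 : (a₀ : ℝ≥0∞) ≠ 0 := by simpa using ha₀.ne'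
  intro η'
  have h1 : Tendsto (fun n => a n * g (η n) + η n) atTop (𝓝 (a₀ * g η₀ + η₀)) :=
    (ENNReal.Tendsto.mul ha' (Or.inl ha0) ((hgc.tendsto η₀).comp hη)
      (Or.inr ENNReal.coe_ne_top)).add (ENNReal.tendsto_coe.2 hη)
  have h2 : Tendsto (fun n => a n * g η' + η') atTop (𝓝 (a₀ * g η' + η')) :=
    (ENNReal.Tendsto.mul ha' (Or.inl ha0) tendsto_const_nhds
      (Or.inr ENNReal.coe_ne_top)).add tendsto_const_nhds
  exact le_of_tendsto_of_tendsto' h1 h2 fun n => h n η'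

lemma tendsto_maxMinimizer_of_antitone (hgc : Continuous g) (hgf : ∀ η, 0 < η → g η < ∞)
    {a : ℕ → ℝ≥0} {a₀ : ℝ≥0} (ha₀ : 0 < a₀) (hanti : Antitone a) (ha : Tendsto a atTop (𝓝 a₀)) :
    Tendsto (fun n => maxMinimizer g (a n)) atTop (𝓝 (maxMinimizer g a₀)) := by
  have hm := maxMinimizer_mono hgc hgf
  have h1 := tendsto_atTop_ciInf (fun _ _ h => hm (hanti h))
    (OrderBot.bddBelow (range fun n => maxMinimizer g (a n)))
  have h2 := mem_minimizers_of_tendsto hgc ha₀ ha h1 fun n => maxMinimizer_mem hgc hgf _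
  rwa [le_antisymm (le_maxMinimizer hgc hgf h2) (le_ciInf fun n => hm (hanti.le_of_tendsto ha n))]
    at h1

/-- Approached strictly from below, even the largest minimizers tend to the smallest one: they are
ordered below it, and their limit is again a minimizer. -/
lemma tendsto_maxMinimizer_of_monotone (hgc : Continuous g) (hgf : ∀ η, 0 < η → g η < ∞)
    {a : ℕ → ℝ≥0} {a₀ : ℝ≥0} (ha₀ : 0 < a₀) (hmono : Monotone a) (ha : Tendsto a atTop (𝓝 a₀))
    (hlt : ∀ n, a n < a₀) :
    Tendsto (fun n => maxMinimizer g (a n)) atTop (𝓝 (minMinimizer g a₀)) := by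
  have hm := maxMinimizer_mono hgc hgf
  have hle : ∀ n, maxMinimizer g (a n) ≤ minMinimizer g a₀ := fun n =>
    minimizers_le_of_lt hgf (hlt n) (maxMinimizer_mem hgc hgf _) (minMinimizer_mem hgc hgf _)
  have h1 := tendsto_atTop_ciSup (fun _ _ h => hm (hmono h)) ⟨_, forall_mem_range.2 hle⟩
  have h2 := mem_minimizers_of_tendsto hgc ha₀ ha h1 fun n => maxMinimizer_mem hgc hgf _
  rwa [le_antisymm (ciSup_le hle) (minMinimizer_le h2)] at h1

lemma tendsto_maxMinimizer_zero (hgc : Continuous g) (hgf : ∀ η, 0 < η → g η < ∞)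
    {a : ℕ → ℝ≥0} (ha : Tendsto a atTop (𝓝 0)) :
    Tendsto (fun n => maxMinimizer g (a n)) atTop (𝓝 0) := by
  refine tendsto_order.2 ⟨fun e he => absurd he not_lt_zero, fun e he => ?_⟩
  have he2 := half_pos he
  have hfin := (hgf _ he2).ne
  have h1 : Tendsto (fun n => (a n : ℝ≥0∞) * g (e / 2) + (e / 2 : ℝ≥0)) atTop
      (𝓝 (((0 : ℝ≥0) : ℝ≥0∞) * g (e / 2) + (e / 2 : ℝ≥0))) :=
    (ENNReal.Tendsto.mul_const (ENNReal.tendsto_coe.2 ha) (Or.inr hfin)).add tendsto_const_nhds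
  have h2 : ((0 : ℝ≥0) : ℝ≥0∞) * g (e / 2) + (e / 2 : ℝ≥0) < e := by
    rw [ENNReal.coe_zero, zero_mul, zero_add]
    exact_mod_cast NNReal.half_lt_self he.ne'
  filter_upwards [h1.eventually_lt_const h2] with n hn
  have h3 := (le_add_self.trans (maxMinimizer_mem hgc hgf (a n) (e / 2))).trans_lt hn
  exact_mod_cast h3

lemma densityCost_le_of_continuous (hgc : Continuous g) (κ u η : ℝ≥0) :
    densityCost g κ u ≤ u * g η + κ * η := by
  rcases eq_or_ne η 0 with rfl | hη
  · have hc : Continuous fun η : ℝ≥0 => (u : ℝ≥0∞) * g η + κ * η :=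
      (ENNReal.continuous_const_mul ENNReal.coe_ne_top |>.comp hgc).add
        (ENNReal.continuous_const_mul ENNReal.coe_ne_top |>.comp ENNReal.continuous_coe)
    refine ge_of_tendsto ((hc.tendsto 0).mono_left (nhdsWithin_le_nhds (s := Ioi 0))) ?_
    filter_upwards [self_mem_nhdsWithin] with η' hη'
    exact densityCost_le _ _ hη'
  · exact densityCost_le _ _ (pos_of_ne_zero hη)

/-- Minimizers attain the optimal cost. -/
lemma densityCost_eq_of_mem_minimizers (hgc : Continuous g) {u κ η : ℝ≥0} (hκ : 0 < κ)
    (h : η ∈ minimizers g (u / κ)) : densityCost g κ u = u * g η + κ * η := by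
  have hmul : ∀ η' : ℝ≥0, (κ : ℝ≥0∞) * ((u / κ : ℝ≥0) * g η' + η') = u * g η' + κ * η' := fun η' => by
    rw [mul_add, ← mul_assoc, ← ENNReal.coe_mul, mul_div_cancel₀ _ hκ.ne']
  refine le_antisymm (densityCost_le_of_continuous hgc κ u η) (le_iInf₂ fun η' _ => ?_)
  rw [← hmul, ← hmul]
  exact mul_le_mul' le_rfl (h η')

end Minimizers

/-! ### Splitting two measures by a half space -/

section HalfSpace
variable {d : ℕ}

lemma continuous_measure_halfSpace (i : Fin d) (m : Measure (Fin d → ℝ)) [IsFiniteMeasure m]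
    (hm : m ≪ volume) : Continuous fun θ : ℝ => m {x | x i < θ} := by
  refine continuous_iff_continuousAt.2 fun θ => ?_
  refine tendsto_measure_of_ae_tendsto_indicator_of_isFiniteMeasure (𝓝 θ)
    (measurableSet_lt (measurable_pi_apply i) measurable_const)
    (fun θ => measurableSet_lt (measurable_pi_apply i) measurable_const) ?_
  have hnull : m {x : Fin d → ℝ | x i = θ} = 0 := hm (by
    rw [volume_pi]
    exact Measure.pi_hyperplane (fun _ : Fin d => (volume : Measure ℝ)) i θ)
  have hae : ∀ᵐ x ∂m, x i ≠ θ := by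
    rw [ae_iff]
    simpa using hnull
  filter_upwards [hae] with x hx
  rcases hx.lt_or_gt with h | h
  · filter_upwards [Ioi_mem_nhds h] with θ' hθ'
    exact ⟨fun _ => h, fun _ => hθ'⟩
  · filter_upwards [Iio_mem_nhds h] with θ' hθ'
    exact ⟨fun h' => absurd (h'.trans hθ') (lt_irrefl _), fun h' => absurd (h.trans h') (lt_irrefl _)⟩

/-- The intermediate value theorem in the position of a hyperplane, which is a null set for both
measures. -/
lemma exists_measurableSet_add_compl_eq (hd : 0 < d) (m₁ m₂ : Measure (Fin d → ℝ))
    [IsFiniteMeasure m₁] [IsFiniteMeasure m₂] (h₁ : m₁ ≪ volume) (h₂ : m₂ ≪ volume) {b : ℝ≥0∞}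
    (hb₁ : b ≤ m₁ univ) (hb₂ : m₂ univ ≤ b) :
    ∃ A : Set (Fin d → ℝ), MeasurableSet A ∧ m₁ A + m₂ Aᶜ = b := by
  rcases hb₁.eq_or_lt with h | hlt₁
  · exact ⟨univ, MeasurableSet.univ, by simp [h]⟩
  rcases hb₂.eq_or_lt with h | hlt₂
  · exact ⟨∅, MeasurableSet.empty, by simp [h]⟩
  set i : Fin d := ⟨0, hd⟩
  have hmeas : ∀ θ : ℝ, MeasurableSet {x : Fin d → ℝ | x i < θ} := fun θ =>
    measurableSet_lt (measurable_pi_apply i) measurable_const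
  let F : ℝ → ℝ≥0∞ := fun θ => m₁ {x | x i < θ} + m₂ {x | x i < θ}ᶜ
  have hcompl : ∀ θ : ℝ, m₂ {x | x i < θ}ᶜ = m₂ univ - m₂ {x | x i < θ} := fun θ =>
    measure_compl (hmeas θ) (measure_ne_top _ _)
  have hF : Continuous F := by
    simp only [F, hcompl]
    refine (continuous_measure_halfSpace i m₁ h₁).add ?_
    exact (ENNReal.continuous_sub_left (measure_ne_top _ _)).comp
      (continuous_measure_halfSpace i m₂ h₂)
  have htop : ∀ m : Measure (Fin d → ℝ), ∀ [IsFiniteMeasure m],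
      Tendsto (fun θ : ℝ => m {x | x i < θ}) atTop (𝓝 (m univ)) := fun m _ => by
    refine tendsto_measure_of_tendsto_indicator_of_isFiniteMeasure atTop m hmeas fun x => ?_
    filter_upwards [eventually_gt_atTop (x i)] with θ hθ
    simpa using hθ
  have hbot : ∀ m : Measure (Fin d → ℝ), ∀ [IsFiniteMeasure m],
      Tendsto (fun θ : ℝ => m {x | x i < θ}) atBot (𝓝 (m ∅)) := fun m _ => by
    refine tendsto_measure_of_tendsto_indicator_of_isFiniteMeasure atBot m hmeas fun x => ?_
    filter_upwards [eventually_lt_atBot (x i)] with θ hθ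
    simpa using hθ.le
  have hFtop : ∃ θ, b ≤ F θ := by
    obtain ⟨θ, hθ⟩ := ((htop m₁).eventually_const_lt hlt₁).exists
    exact ⟨θ, hθ.le.trans le_self_add⟩
  have hFbot : ∃ θ, F θ ≤ b := by
    have h3 : Tendsto F atBot (𝓝 (m₁ ∅ + m₂ univ)) := by
      refine (hbot m₁).add ?_
      simp only [hcompl]
      have h4 := ENNReal.Tendsto.sub (tendsto_const_nhds (x := m₂ univ)) (hbot m₂)
        (Or.inl (measure_ne_top _ _))
      simpa using h4
    rw [measure_empty, zero_add] at h3
    obtain ⟨θ, hθ⟩ := (h3.eventually_lt_const hlt₂).exists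
    exact ⟨θ, hθ.le⟩
  obtain ⟨θ, hθ⟩ := mem_range_of_exists_le_of_exists_ge hF hFbot hFtop
  exact ⟨_, hmeas θ, hθ⟩

end HalfSpace

/-! ### Solving the allocation problem at a critical price -/

section Allocation
variable {d : ℕ} {g : ℝ≥0 → ℝ≥0∞} {u : (Fin d → ℝ) → ℝ≥0}

/-- The distortion of the largest optimal point density when points cost `κ` each. -/
noncomputable def optimalError (g : ℝ≥0 → ℝ≥0∞) (u : (Fin d → ℝ) → ℝ≥0) (κ : ℝ≥0) : ℝ≥0∞ :=
  ∫⁻ x, u x * g (maxMinimizer g (u x / κ))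

lemma measurable_mul_comp (hgc : Continuous g) (hu : Measurable u) {ξ : (Fin d → ℝ) → ℝ≥0}
    (hξ : Measurable ξ) : Measurable fun x => (u x : ℝ≥0∞) * g (ξ x) :=
  hu.coe_nnreal_ennreal.mul (hgc.measurable.comp hξ)

lemma measurable_maxMinimizer_div (hgc : Continuous g) (hgf : ∀ η, 0 < η → g η < ∞)
    (hu : Measurable u) (κ : ℝ≥0) : Measurable fun x => maxMinimizer g (u x / κ) :=
  (maxMinimizer_mono hgc hgf).measurable.comp (hu.div_const κ)

lemma measurable_minMinimizer_div (hgc : Continuous g) (hgf : ∀ η, 0 < η → g η < ∞)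
    (hu : Measurable u) (κ : ℝ≥0) : Measurable fun x => minMinimizer g (u x / κ) :=
  (minMinimizer_mono hgc hgf).measurable.comp (hu.div_const κ)

/-- A higher price buys fewer points and so leaves a larger error. -/
lemma mul_maxMinimizer_mono (hg : Antitone g) (hgc : Continuous g) (hgf : ∀ η, 0 < η → g η < ∞)
    {κ κ' : ℝ≥0} (hκ : 0 < κ) (h : κ ≤ κ') (t : ℝ≥0) :
    (t : ℝ≥0∞) * g (maxMinimizer g (t / κ)) ≤ t * g (maxMinimizer g (t / κ')) := by
  have h1 : t / κ' ≤ t / κ := by gcongr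
  exact mul_le_mul' le_rfl (hg (maxMinimizer_mono hgc hgf h1))

lemma optimalError_mono (hg : Antitone g) (hgc : Continuous g) (hgf : ∀ η, 0 < η → g η < ∞)
    {κ κ' : ℝ≥0} (hκ : 0 < κ) (h : κ ≤ κ') : optimalError g u κ ≤ optimalError g u κ' :=
  lintegral_mono fun x => mul_maxMinimizer_mono hg hgc hgf hκ h (u x)

lemma lintegral_mul_le_lintegral_densityCost (hgc : Continuous g) {ξ : (Fin d → ℝ) → ℝ≥0}
    {κ : ℝ≥0} (hκ : 0 < κ) (hξ : ∀ x, ξ x ∈ minimizers g (u x / κ)) :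
    ∫⁻ x, u x * g (ξ x) ≤ ∫⁻ x, densityCost g κ (u x) := by
  refine lintegral_mono fun x => ?_
  rw [densityCost_eq_of_mem_minimizers hgc hκ (hξ x)]
  exact le_self_add

lemma tendsto_optimalError_atTop (hg : Antitone g) (hgc : Continuous g)
    (hgf : ∀ η, 0 < η → g η < ∞) (hu : Measurable u) :
    Tendsto (fun n : ℕ => optimalError g u (n + 1)) atTop (𝓝 (∫⁻ x, u x * g 0)) := by
  refine lintegral_tendsto_of_tendsto_of_monotone (fun n => (measurable_mul_comp hgc hu
    (measurable_maxMinimizer_div hgc hgf hu _)).aemeasurable) ?_ ?_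
  · refine ae_of_all _ fun x n n' hnn' => mul_maxMinimizer_mono hg hgc hgf (by positivity) ?_ _
    gcongr
  · refine ae_of_all _ fun x => ?_
    have h1 : Tendsto (fun n : ℕ => (n : ℝ≥0) + 1) atTop atTop :=
      tendsto_atTop_mono (fun _ => le_self_add) tendsto_natCast_atTop_atTop
    have h2 : Tendsto (fun n : ℕ => u x / ((n : ℝ≥0) + 1)) atTop (𝓝 0) :=
      (tendsto_const_div_nnreal_atTop (u x)).comp h1
    exact ENNReal.Tendsto.const_mul ((hgc.tendsto 0).comp (tendsto_maxMinimizer_zero hgc hgf h2))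
      (Or.inr ENNReal.coe_ne_top)

lemma exists_seq_monotone_lt_tendsto {κ : ℝ≥0} (hκ : 0 < κ) :
    ∃ k : ℕ → ℝ≥0, (∀ n, 0 < k n ∧ k n < κ) ∧ Monotone k ∧ Tendsto k atTop (𝓝 κ) := by
  obtain ⟨k, hk, hkκ, hlim⟩ := exists_seq_strictMono_tendsto' hκ
  exact ⟨k, fun n => hkκ n, hk.monotone, hlim⟩

lemma tendsto_const_div_nnreal {k : ℕ → ℝ≥0} {κ : ℝ≥0} (hκ : 0 < κ) (hk : Tendsto k atTop (𝓝 κ))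
    (t : ℝ≥0) : Tendsto (fun n => t / k n) atTop (𝓝 (t / κ)) :=
  tendsto_const_nhds.div hk hκ.ne'

/-- Left continuity in the price: as k ↑ κ, the ratios u/k decrease to u/κ and the largest
minimizers converge to the largest one. -/
lemma optimalError_le_of_forall_lt (hg : Antitone g) (hgc : Continuous g)
    (hgf : ∀ η, 0 < η → g η < ∞) (hu : Measurable u) {κ : ℝ≥0} (hκ : 0 < κ) {b : ℝ≥0∞}
    (h : ∀ k, 0 < k → k < κ → optimalError g u k ≤ b) : optimalError g u κ ≤ b := by
  obtain ⟨k, hkκ, hkm, hk⟩ := exists_seq_monotone_lt_tendsto hκ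
  have hlim : Tendsto (fun n => optimalError g u (k n)) atTop (𝓝 (optimalError g u κ)) := by
    refine lintegral_tendsto_of_tendsto_of_monotone (fun n => (measurable_mul_comp hgc hu
      (measurable_maxMinimizer_div hgc hgf hu _)).aemeasurable) ?_ ?_
    · exact ae_of_all _ fun x n n' hnn' =>
        mul_maxMinimizer_mono hg hgc hgf (hkκ n).1 (hkm hnn') (u x)
    · refine ae_of_all _ fun x => ?_
      rcases eq_or_ne (u x) 0 with h0 | h0
      · simp [h0]
      refine ENNReal.Tendsto.const_mul ?_ (Or.inr ENNReal.coe_ne_top)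
      refine (hgc.tendsto _).comp (tendsto_maxMinimizer_of_antitone hgc hgf
        (div_pos (pos_of_ne_zero h0) hκ) (fun n n' hnn' => ?_) (tendsto_const_div_nnreal hκ hk _))
      exact div_le_div_of_nonneg_left zero_le (hkκ n).1 (hkm hnn')
  exact le_of_tendsto' hlim fun n => h _ (hkκ n).1 (hkκ n).2

/-- As k ↓ κ, the ratios u/k approach u/κ strictly from below, so the limit of the errors involves
the smallest minimizers. -/
lemma le_lintegral_minMinimizer (hg : Antitone g) (hgc : Continuous g)
    (hgf : ∀ η, 0 < η → g η < ∞) (hu : Measurable u) {κ : ℝ≥0} (hκ : 0 < κ) {b : ℝ≥0∞}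
    (hfin : ∀ k, 0 < k → optimalError g u k ≠ ∞) (h : ∀ k, κ < k → b ≤ optimalError g u k) :
    b ≤ ∫⁻ x, u x * g (minMinimizer g (u x / κ)) := by
  obtain ⟨k, hk, hkκ, hklim⟩ := exists_seq_strictAnti_tendsto κ
  have hk0 : ∀ n, 0 < k n := fun n => hκ.trans (hkκ n)
  have hlim : Tendsto (fun n => optimalError g u (k n)) atTop
      (𝓝 (∫⁻ x, u x * g (minMinimizer g (u x / κ)))) := by
    refine lintegral_tendsto_of_tendsto_of_antitone (fun n => (measurable_mul_comp hgc hu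
      (measurable_maxMinimizer_div hgc hgf hu _)).aemeasurable) ?_ (hfin _ (hk0 0)) ?_
    · exact ae_of_all _ fun x n n' hnn' =>
        mul_maxMinimizer_mono hg hgc hgf (hk0 n') (hk.antitone hnn') (u x)
    · refine ae_of_all _ fun x => ?_
      rcases eq_or_ne (u x) 0 with h0 | h0
      · simp [h0]
      refine ENNReal.Tendsto.const_mul ?_ (Or.inr ENNReal.coe_ne_top)
      refine (hgc.tendsto _).comp (tendsto_maxMinimizer_of_monotone hgc hgf
        (div_pos (pos_of_ne_zero h0) hκ) (fun n n' hnn' => ?_)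
        (tendsto_const_div_nnreal hκ hklim _) fun n => ?_)
      · exact div_le_div_of_nonneg_left zero_le (hk0 n') (hk.antitone hnn')
      · exact div_lt_div_of_pos_left (pos_of_ne_zero h0) hκ (hkκ n)
  exact ge_of_tendsto' hlim fun n => h _ (hkκ n)

/-- The smallest minimizer is used on a half space and the largest outside; moving the half space
attains every intermediate error. -/
lemma exists_minimizer_lintegral_eq (hd : 0 < d) (hgc : Continuous g)
    (hgf : ∀ η, 0 < η → g η < ∞) (hu : Measurable u) {κ : ℝ≥0} {b : ℝ≥0∞} (hb : b ≠ ∞)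
    (hp : optimalError g u κ ≤ b) (hm : b ≤ ∫⁻ x, u x * g (minMinimizer g (u x / κ)))
    (hfin : ∫⁻ x, u x * g (minMinimizer g (u x / κ)) ≠ ∞) :
    ∃ ξ : (Fin d → ℝ) → ℝ≥0, Measurable ξ ∧ (∀ x, ξ x ∈ minimizers g (u x / κ)) ∧
      ∫⁻ x, u x * g (ξ x) = b := by
  classical
  set ξm : (Fin d → ℝ) → ℝ≥0 := fun x => minMinimizer g (u x / κ) with hξm
  set ξp : (Fin d → ℝ) → ℝ≥0 := fun x => maxMinimizer g (u x / κ) with hξp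
  have : IsFiniteMeasure (volume.withDensity fun x => (u x : ℝ≥0∞) * g (ξm x)) :=
    isFiniteMeasure_withDensity hfin
  have : IsFiniteMeasure (volume.withDensity fun x => (u x : ℝ≥0∞) * g (ξp x)) :=
    isFiniteMeasure_withDensity (hp.trans_lt hb.lt_top).ne
  obtain ⟨A, hA, hAb⟩ := exists_measurableSet_add_compl_eq hd
    (volume.withDensity fun x => (u x : ℝ≥0∞) * g (ξm x))
    (volume.withDensity fun x => (u x : ℝ≥0∞) * g (ξp x))
    (withDensity_absolutelyContinuous _ _) (withDensity_absolutelyContinuous _ _)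
    (b := b) (by rwa [withDensity_apply _ MeasurableSet.univ, Measure.restrict_univ])
    (by rwa [withDensity_apply _ MeasurableSet.univ, Measure.restrict_univ])
  rw [withDensity_apply _ hA, withDensity_apply _ hA.compl] at hAb
  refine ⟨A.piecewise ξm ξp, (measurable_minMinimizer_div hgc hgf hu κ).piecewise hA
    (measurable_maxMinimizer_div hgc hgf hu κ), fun x => ?_, ?_⟩
  · by_cases hx : x ∈ A
    · rw [Set.piecewise_eq_of_mem _ _ _ hx]
      exact minMinimizer_mem hgc hgf _
    · rw [Set.piecewise_eq_of_notMem _ _ _ hx]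
      exact maxMinimizer_mem hgc hgf _
  · rw [← hAb, ← lintegral_add_compl _ hA]
    congr 1
    · refine setLIntegral_congr_fun hA fun x hx => ?_
      simp only [Set.piecewise_eq_of_mem _ _ _ hx]
    · refine setLIntegral_congr_fun hA.compl fun x hx => ?_
      simp only [Set.piecewise_eq_of_notMem _ _ _ hx]

/-- The allocation problem has a solution that is either zero or optimal for a Lagrangian. -/
lemma exists_optimal_density (hd : 0 < d) (hg : Antitone g) (hgc : Continuous g)
    (hgf : ∀ η, 0 < η → g η < ∞) (hu : Measurable u)
    (hD : ∀ b : ℝ≥0, 0 < b → ∃ η : ℝ≥0, ∀ κ : ℝ≥0,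
      ∫⁻ x, densityCost g κ (u x) ≤ (b : ℝ≥0∞) + κ * η) {b : ℝ≥0} (hb : 0 < b) :
    ∃ ξ : (Fin d → ℝ) → ℝ≥0, Measurable ξ ∧ ∫⁻ x, u x * g (ξ x) ≤ b ∧
      ((∀ x, ξ x = 0) ∨ ∃ κ : ℝ≥0, 0 < κ ∧
        (b : ℝ≥0∞) + κ * ∫⁻ x, ξ x = ∫⁻ x, densityCost g κ (u x)) := by
  -- If no points at all already meet the error level, ξ = 0 is optimal. Otherwise the error exceeds
  -- b at high prices, so the critical price is finite.
  rcases le_or_gt (∫⁻ x, u x * g 0) b with h0 | h0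
  · exact ⟨fun _ => 0, measurable_const, h0, Or.inl fun _ => rfl⟩
  have hDfin : ∀ κ : ℝ≥0, ∫⁻ x, densityCost g κ (u x) < ∞ := fun κ => by
    obtain ⟨η, hη⟩ := hD b hb
    exact (hη κ).trans_lt (by finiteness)
  have hPD : ∀ k : ℝ≥0, 0 < k → optimalError g u k ≤ ∫⁻ x, densityCost g k (u x) := fun k hk =>
    lintegral_mul_le_lintegral_densityCost hgc hk fun x => maxMinimizer_mem hgc hgf _
  set S : Set ℝ≥0 := {κ | 0 < κ ∧ optimalError g u κ ≤ b} with hS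
  have hSne : S.Nonempty := by
    -- The bound at level b / 2 leaves room for the term κ η at a small price κ.
    obtain ⟨η, hη⟩ := hD (b / 2) (half_pos hb)
    refine ⟨b / 2 / (η + 1), by positivity, (hPD _ (by positivity)).trans ((hη _).trans ?_)⟩
    norm_cast
    calc b / 2 + b / 2 / (η + 1) * η ≤ b / 2 + b / 2 := by
          gcongr
          rw [div_mul_eq_mul_div, div_le_iff₀ (by positivity)]
          gcongr
          exact le_self_add
      _ = b := add_halves b
  have hSbdd : BddAbove S := by
    obtain ⟨n, hn⟩ := ((tendsto_optimalError_atTop hg hgc hgf hu).eventually_const_lt h0).exists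
    refine ⟨n + 1, fun κ hκ => ?_⟩
    by_contra! hlt
    exact (hn.trans_le (optimalError_mono hg hgc hgf (by positivity) hlt.le)).not_ge hκ.2
  -- At this critical price the largest minimizers still meet the level b, by left continuity, while
  -- the smallest ones have error at least b.
  set κ := sSup S with hκ
  have hκ0 : 0 < κ := by
    obtain ⟨k, hk⟩ := hSne
    exact hk.1.trans_le (le_csSup hSbdd hk)
  have hp : optimalError g u κ ≤ b := optimalError_le_of_forall_lt hg hgc hgf hu hκ0
    fun k hk hkκ => by
      obtain ⟨k', hk', hkk'⟩ := exists_lt_of_lt_csSup hSne hkκ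
      exact (optimalError_mono hg hgc hgf hk hkk'.le).trans hk'.2
  have hm := le_lintegral_minMinimizer hg hgc hgf hu hκ0 (b := b)
    (fun k hk => ((hPD k hk).trans_lt (hDfin k)).ne) fun k hk => by
      by_contra! hlt
      exact hk.not_ge (le_csSup hSbdd ⟨hκ0.trans hk, hlt.le⟩)
  obtain ⟨ξ, hξ, hξmin, hξb⟩ := exists_minimizer_lintegral_eq hd hgc hgf hu ENNReal.coe_ne_top hp hm
    ((lintegral_mul_le_lintegral_densityCost hgc hκ0 fun x =>
      minMinimizer_mem hgc hgf _).trans_lt (hDfin κ)).ne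
  refine ⟨ξ, hξ, hξb.le, Or.inr ⟨κ, hκ0, ?_⟩⟩
  calc (b : ℝ≥0∞) + κ * ∫⁻ x, ξ x = ∫⁻ x, (u x * g (ξ x) + κ * ξ x) := by
        rw [lintegral_add_left (measurable_mul_comp hgc hu hξ), hξb,
          lintegral_const_mul _ hξ.coe_nnreal_ennreal]
    _ = _ := lintegral_congr fun x => (densityCost_eq_of_mem_minimizers hgc hκ0 (hξmin x)).symm

end Allocation

end OrliczQuantization
-- Strong duality for the density of the absolutely continuous part
namespace OrliczQuantization

/-- The dual function of the point allocation problem. -/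
noncomputable def dualValue {d : ℕ} (nrm : Seminorm ℝ (Fin d → ℝ)) (φ : ℝ≥0 → ℝ≥0)
    (μ : Measure (Fin d → ℝ)) (κ : ℝ≥0) : ℝ≥0∞ :=
  ∫⁻ x, densityCost (complexity nrm φ) κ (acDensity μ x)

variable {d : ℕ} {nrm : Seminorm ℝ (Fin d → ℝ)} {φ Ψ : ℝ≥0 → ℝ≥0} {c : ℝ≥0}
  {μ : Measure (Fin d → ℝ)}

lemma densityCost_complexity (hc : NormBound nrm c) (hd : 0 < d) (hφ : Monotone φ) (κ a : ℝ≥0∞) :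
    densityCost (complexity nrm φ) κ a = densityCost (limErr nrm φ) κ a :=
  iInf_congr fun η => iInf_congr fun hη => by rw [complexity_eq_limErr hc hd hφ hη]

lemma measurable_acDensity (μ : Measure (Fin d → ℝ)) : Measurable (acDensity μ) :=
  Measure.measurable_rnDeriv _ _

lemma acDensity_lt_top (μ : Measure (Fin d → ℝ)) [SigmaFinite μ] :
    ∀ᵐ x, acDensity μ x < ∞ :=
  Measure.rnDeriv_lt_top μ volume

lemma dualValue_le (hc : NormBound nrm c) (hd : 0 < d) (hφ : Monotone φ) [IsFiniteMeasure μ]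
    {b η : ℝ≥0∞} (κ : ℝ≥0)
    (hfreq : ∃ᶠ s : ℝ≥0 in atTop, ∃ C : Finset (Fin d → ℝ),
      (C.card : ℝ≥0∞) ≤ η * (s : ℝ≥0∞) ^ d ∧ ∫⁻ x, err nrm φ s C x ∂μ ≤ b) :
    dualValue nrm φ μ κ ≤ b + κ * η := by
  simp_rw [dualValue, densityCost_complexity hc hd hφ]
  exact lintegral_densityCost_le hc hd hφ (measurable_acDensity μ)
    (Measure.lintegral_rnDeriv_lt_top μ volume).ne (Measure.withDensity_rnDeriv_le μ volume) κ hfreq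

lemma lintegral_acPart {f : (Fin d → ℝ) → ℝ≥0∞} (hf : AEMeasurable f volume) :
    ∫⁻ x, f x ∂(acPart μ) = ∫⁻ x, acDensity μ x * f x :=
  lintegral_withDensity_eq_lintegral_mul₀ (measurable_acDensity μ).aemeasurable hf

/-- Weak duality for the point allocation problem. -/
lemma dualValue_le_of_aemeasurable (hc : NormBound nrm c) (hd : 0 < d) (hφ : Monotone φ)
    [SigmaFinite μ] {ξ : (Fin d → ℝ) → ℝ≥0} (hξ : AEMeasurable ξ volume) (κ : ℝ≥0) :
    dualValue nrm φ μ κ ≤ ∫⁻ x, complexity nrm φ (ξ x) ∂(acPart μ) + κ * ∫⁻ x, ξ x := by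
  have hgξ : AEMeasurable (fun x => complexity nrm φ (ξ x)) volume :=
    (complexity_continuous hc hd hφ).measurable.comp_aemeasurable hξ
  have hm : AEMeasurable (fun x => acDensity μ x * complexity nrm φ (ξ x)) volume :=
    (measurable_acDensity μ).aemeasurable.mul hgξ
  rw [lintegral_acPart hgξ, ← lintegral_const_mul'' _ hξ.coe_nnreal_ennreal,
    ← lintegral_add_left' hm]
  refine lintegral_mono_ae ?_
  filter_upwards [acDensity_lt_top μ] with x hx
  lift acDensity μ x to ℝ≥0 using hx.ne with u
  exact densityCost_le_of_continuous (complexity_continuous hc hd hφ) κ u (ξ x)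

/-- The point allocation problem with error level `b` has an optimal solution, and strong
duality holds. -/
lemma exists_optimal_allocation (hc : NormBound nrm c) (hd : 0 < d)
    (hφ : Monotone φ) (hφ₀ : Tendsto φ (𝓝[>] 0) (𝓝 0)) (hφne : φ ≠ 0) (hΨ : Monotone Ψ)
    (hG : GrowthCondition d φ Ψ) [IsFiniteMeasure μ]
    (hm : ∫⁻ x, (Ψ (nrm x).toNNReal : ℝ≥0∞) ∂μ ≠ ∞) {b : ℝ≥0} (hb : 0 < b) :
    ∃ ξ : (Fin d → ℝ) → ℝ≥0, Measurable ξ ∧ ∫⁻ x, complexity nrm φ (ξ x) ∂(acPart μ) ≤ b ∧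
      ((∀ x, ξ x = 0) ∨ ∃ κ : ℝ≥0, 0 < κ ∧ (b : ℝ≥0∞) + κ * ∫⁻ x, ξ x = dualValue nrm φ μ κ) ∧
      ∫⁻ x, ξ x < ∞ ∧
      ∀ η : ℝ≥0∞, (∀ κ : ℝ≥0, dualValue nrm φ μ κ ≤ b + κ * η) → ∫⁻ x, ξ x ≤ η := by
  have hgc := complexity_continuous (nrm := nrm) hc hd hφ
  have hu : Measurable fun x => (acDensity μ x).toNNReal := (measurable_acDensity μ).ennreal_toNNReal
  have hae : ∀ᵐ x, ((acDensity μ x).toNNReal : ℝ≥0∞) = acDensity μ x := by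
    filter_upwards [acDensity_lt_top μ] with x hx using ENNReal.coe_toNNReal hx.ne
  have hD : ∀ κ : ℝ≥0, ∫⁻ x, densityCost (complexity nrm φ) κ ((acDensity μ x).toNNReal : ℝ≥0∞) =
      dualValue nrm φ μ κ := fun κ =>
    lintegral_congr_ae (hae.mono fun x hx => by simp only [hx])
  have hbd : ∀ b : ℝ≥0, 0 < b → ∃ η : ℝ≥0, ∀ κ : ℝ≥0, dualValue nrm φ μ κ ≤ (b : ℝ≥0∞) + κ * η :=
    fun b hb => by
      obtain ⟨η, hη⟩ := exists_achievable hc hd hφ hφ₀ hφne hΨ hG hm hb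
      exact ⟨η, fun κ => dualValue_le hc hd hφ κ hη.frequently⟩
  obtain ⟨ξ, hξ, hle, hopt⟩ := exists_optimal_density hd (complexity_antitone hc hd hφ) hgc
    (fun η hη => complexity_lt_top hc hd hφ hη) hu (fun b hb => by simpa only [hD] using hbd b hb) hb
  simp only [hD] at hopt
  -- In the Lagrangian case b + κ ∫ ξ equals the dual value at one κ > 0; cancelling b and then κ
  -- compares ∫ ξ with η.
  have hmin : ∀ η : ℝ≥0∞, (∀ κ : ℝ≥0, dualValue nrm φ μ κ ≤ b + κ * η) → ∫⁻ x, ξ x ≤ η :=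
    fun η hη => by
      rcases hopt with h0 | ⟨κ, hκ, h⟩
      · simp [h0]
      · have h1 := h.trans_le (hη κ)
        rw [ENNReal.add_le_add_iff_left ENNReal.coe_ne_top] at h1
        exact (ENNReal.mul_le_mul_iff_right (by exact_mod_cast hκ.ne') ENNReal.coe_ne_top).1 h1
  refine ⟨ξ, hξ, ?_, hopt, ?_, hmin⟩
  · have hgξ : Measurable fun x => complexity nrm φ (ξ x) := hgc.measurable.comp hξ
    rw [lintegral_acPart hgξ.aemeasurable]
    refine le_of_eq_of_le (lintegral_congr_ae (hae.mono fun x hx => ?_)) hle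
    simp only [hx]
  · obtain ⟨η, hη⟩ := hbd b hb
    exact (hmin η hη).trans_lt ENNReal.coe_lt_top

lemma IsAdmissible.aemeasurable {ξ : (Fin d → ℝ) → ℝ≥0} (h : IsAdmissible nrm φ μ ξ) :
    AEMeasurable ξ volume := by
  simpa using h.1.aemeasurable.real_toNNReal

lemma isAdmissible_of_measurable {ξ : (Fin d → ℝ) → ℝ≥0} (hξ : Measurable ξ)
    (hfin : ∫⁻ x, ξ x < ∞) (hle : ∫⁻ x, complexity nrm φ (ξ x) ∂(acPart μ) ≤ 1) :
    IsAdmissible nrm φ μ ξ := by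
  refine ⟨⟨hξ.coe_nnreal_real.aestronglyMeasurable, ?_⟩, hle⟩
  simpa [HasFiniteIntegral] using hfin

lemma dualValue_le_allocValue (hc : NormBound nrm c) (hd : 0 < d) (hφ : Monotone φ) [SigmaFinite μ]
    {ξ : (Fin d → ℝ) → ℝ≥0} (h : IsAdmissible nrm φ μ ξ) (κ : ℝ≥0) :
    dualValue nrm φ μ κ ≤ 1 + κ * ∫⁻ x, ξ x :=
  (dualValue_le_of_aemeasurable hc hd hφ h.aemeasurable κ).trans (add_le_add_left h.2 _)

/-- Level 1 is the problem defining I. Weak duality feeds the cost of any competitor into the last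
clause, so the constructed ξ is optimal; that clause also turns asymptotic dual bounds into I ≤ η.
-/
lemma exists_isAdmissible_eq_allocValue (hc : NormBound nrm c) (hd : 0 < d)
    (hφ : Monotone φ) (hφ₀ : Tendsto φ (𝓝[>] 0) (𝓝 0)) (hφne : φ ≠ 0) (hΨ : Monotone Ψ)
    (hG : GrowthCondition d φ Ψ) [IsFiniteMeasure μ]
    (hm : ∫⁻ x, (Ψ (nrm x).toNNReal : ℝ≥0∞) ∂μ ≠ ∞) :
    ∃ ξ : (Fin d → ℝ) → ℝ≥0, Measurable ξ ∧ IsAdmissible nrm φ μ ξ ∧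
      ∫⁻ x, ξ x = allocValue nrm φ μ ∧ allocValue nrm φ μ < ∞ ∧
      (allocValue nrm φ μ = 0 ∨
        ∃ κ : ℝ≥0, 0 < κ ∧ 1 + κ * allocValue nrm φ μ = dualValue nrm φ μ κ) ∧
      ∀ η : ℝ≥0∞, (∀ κ : ℝ≥0, dualValue nrm φ μ κ ≤ 1 + κ * η) → allocValue nrm φ μ ≤ η := by
  obtain ⟨ξ, hξ, hle, hopt, hfin, hmin⟩ :=
    exists_optimal_allocation (b := 1) hc hd hφ hφ₀ hφne hΨ hG hm one_pos
  rw [ENNReal.coe_one] at hle hopt hmin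
  have hadm := isAdmissible_of_measurable hξ hfin hle
  have hI : ∫⁻ x, ξ x = allocValue nrm φ μ :=
    le_antisymm (le_iInf₂ fun ξ' h' => hmin _ fun κ => dualValue_le_allocValue hc hd hφ h' κ)
      (iInf₂_le ξ hadm)
  refine ⟨ξ, hξ, hadm, hI, hI ▸ hfin, ?_, hI ▸ hmin⟩
  rw [← hI]
  exact hopt.imp_left fun h => by simp [h]

/-- Because the infimum is attained, I = 0 exactly when ξ = 0 is admissible, and its error is
μ_c(ℝ^d) g(0) with g(0) = sup φ. -/
lemma allocValue_pos_iff (hc : NormBound nrm c) (hd : 0 < d)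
    (hφ : Monotone φ) (hφ₀ : Tendsto φ (𝓝[>] 0) (𝓝 0)) (hφne : φ ≠ 0) (hΨ : Monotone Ψ)
    (hG : GrowthCondition d φ Ψ) [IsFiniteMeasure μ]
    (hm : ∫⁻ x, (Ψ (nrm x).toNNReal : ℝ≥0∞) ∂μ ≠ ∞) :
    0 < allocValue nrm φ μ ↔ 1 < acPart μ univ * ⨆ t : ℝ≥0, (φ t : ℝ≥0∞) := by
  rw [← complexity_zero hc hd hφ, ← not_iff_not, not_lt, not_lt, nonpos_iff_eq_zero, mul_comm,
    ← lintegral_const]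
  refine ⟨fun h => ?_, fun h => ?_⟩
  · obtain ⟨ξ, hξ, hadm, hI, -⟩ :=
      exists_isAdmissible_eq_allocValue hc hd hφ hφ₀ hφne hΨ hG hm
    rw [h, lintegral_eq_zero_iff hξ.coe_nnreal_ennreal] at hI
    have h0 : (fun x => (ξ x : ℝ≥0∞)) =ᵐ[acPart μ] 0 :=
      (withDensity_absolutelyContinuous volume (acDensity μ)).ae_eq hI
    refine le_of_eq_of_le (lintegral_congr_ae (h0.mono fun x hx => ?_)) hadm.2
    simp only [Pi.zero_apply, ENNReal.coe_eq_zero] at hx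
    simp [hx]
  · refine le_antisymm (iInf₂_le_of_le (fun _ => 0) ?_ ?_) zero_le
    · exact isAdmissible_of_measurable measurable_const (by simp) h
    · simp

end OrliczQuantization
-- The dual formula, and the passage to random vectors
namespace OrliczQuantization

variable {d : ℕ} {nrm : Seminorm ℝ (Fin d → ℝ)} {φ Ψ : ℝ≥0 → ℝ≥0} {c : ℝ≥0}
  {μ : Measure (Fin d → ℝ)}

lemma complexityBar_mono (nrm : Seminorm ℝ (Fin d → ℝ)) (φ : ℝ≥0 → ℝ≥0) :
    Monotone (complexityBar nrm φ) := fun _ _ h =>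
  iInf₂_mono fun _ _ => add_le_add_right (mul_le_mul_right h _) _

lemma mul_complexityBar_div {a : ℝ≥0∞} (ha : a ≠ ∞) (κ : ℝ≥0) :
    a * complexityBar nrm φ (κ / a) = densityCost (complexity nrm φ) κ a := by
  rcases eq_or_ne a 0 with rfl | ha0
  · rw [densityCost_zero, zero_mul]
  · simp_rw [complexityBar, densityCost, ENNReal.mul_iInf_of_ne ha0 ha]
    refine iInf_congr fun η => iInf_congr fun _ => ?_
    rw [mul_add, mul_left_comm, ENNReal.mul_div_cancel ha0 ha, mul_comm (η : ℝ≥0∞)]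

lemma lintegral_complexityBar [SigmaFinite μ] (κ : ℝ≥0) :
    ∫⁻ x, complexityBar nrm φ (κ / acDensity μ x) ∂(acPart μ) = dualValue nrm φ μ κ := by
  have h1 : Measurable fun x => complexityBar nrm φ (κ / acDensity μ x) :=
    (complexityBar_mono nrm φ).measurable.comp (measurable_const.div (measurable_acDensity μ))
  rw [lintegral_acPart h1.aemeasurable]
  refine lintegral_congr_ae ((acDensity_lt_top μ).mono fun x hx => ?_)
  exact mul_complexityBar_div hx.ne κ

/-- The dual formula for the value of the point allocation problem. -/
lemma allocValue_eq_iSup (hc : NormBound nrm c) (hd : 0 < d)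
    (hφ : Monotone φ) (hφ₀ : Tendsto φ (𝓝[>] 0) (𝓝 0)) (hφne : φ ≠ 0) (hΨ : Monotone Ψ)
    (hG : GrowthCondition d φ Ψ) [IsFiniteMeasure μ]
    (hm : ∫⁻ x, (Ψ (nrm x).toNNReal : ℝ≥0∞) ∂μ ≠ ∞) :
    ((allocValue nrm φ μ : ℝ≥0∞) : EReal) = ⨆ (κ : ℝ) (_ : 0 < κ), ((κ⁻¹ : ℝ) : EReal) *
      (((∫⁻ x, complexityBar nrm φ (ENNReal.ofReal κ / acDensity μ x)
        ∂(acPart μ) : ℝ≥0∞) : EReal) - 1) := by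
  obtain ⟨ξ, -, hadm, hξI, hfin, hopt, -⟩ :=
    exists_isAdmissible_eq_allocValue hc hd hφ hφ₀ hφne hΨ hG hm
  have hweak : ∀ κ : ℝ≥0, dualValue nrm φ μ κ ≤ 1 + κ * allocValue nrm φ μ := fun κ =>
    hξI ▸ dualValue_le_allocValue hc hd hφ hadm κ
  have hterm : ∀ κ : ℝ, (∫⁻ x, complexityBar nrm φ (ENNReal.ofReal κ / acDensity μ x) ∂(acPart μ)) =
      dualValue nrm φ μ κ.toNNReal := fun κ => lintegral_complexityBar _
  simp_rw [hterm]
  obtain ⟨I, hI⟩ : ∃ I : ℝ≥0, (I : ℝ≥0∞) = allocValue nrm φ μ := ⟨_, ENNReal.coe_toNNReal hfin.ne⟩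
  rw [← hI] at hopt ⊢
  simp_rw [← hI] at hweak
  have hDfin : ∀ κ : ℝ≥0, ∃ D : ℝ≥0, dualValue nrm φ μ κ = D ∧ D ≤ 1 + κ * I := fun κ => by
    have h := hweak κ
    lift dualValue nrm φ μ κ to ℝ≥0 using (h.trans_lt (by finiteness)).ne with D
    exact ⟨D, rfl, by exact_mod_cast h⟩
  choose D hD hDle using hDfin
  have hcoe : ∀ κ : ℝ, ((κ⁻¹ : ℝ) : EReal) * ((dualValue nrm φ μ κ.toNNReal : EReal) - 1) =
      ((κ⁻¹ * (D κ.toNNReal - 1) : ℝ) : EReal) := fun κ => by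
    rw [hD]
    push_cast
    rfl
  simp_rw [hcoe]
  have hIcoe : (((I : ℝ≥0) : ℝ≥0∞) : EReal) = ((I : ℝ) : EReal) := rfl
  rw [hIcoe]
  refine le_antisymm ?_ (iSup₂_le fun κ hκ => EReal.coe_le_coe_iff.2 ?_)
  -- If I = 0, the supremum need only be approached: the dual value is non-negative, so κ = 1/(-r)
  -- gives a term at least r for any r < 0. Otherwise the optimal price attains it.
  · rcases hopt with h0 | ⟨κ, hκ, h⟩
    · have h0' : I = 0 := by exact_mod_cast h0
      subst h0'
      refine le_of_forall_lt fun a ha => ?_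
      obtain ⟨r, har, hr⟩ := EReal.lt_iff_exists_real_btwn.1 ha
      have hr0 : r < 0 := by exact_mod_cast hr
      have hκ : 0 < (-r)⁻¹ := inv_pos.2 (neg_pos.2 hr0)
      refine har.trans_le (le_iSup₂_of_le (-r)⁻¹ hκ (EReal.coe_le_coe_iff.2 ?_))
      rw [inv_inv]
      nlinarith [(D (-r)⁻¹.toNNReal).coe_nonneg]
    · refine le_iSup₂_of_le (κ : ℝ) (by exact_mod_cast hκ) (EReal.coe_le_coe_iff.2 ?_)
      rw [Real.toNNReal_coe]
      rw [hD] at h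
      have h' : 1 + κ * I = D κ := by exact_mod_cast h
      have hκ' : (κ : ℝ) ≠ 0 := by exact_mod_cast hκ.ne'
      rw [← h']
      push_cast
      field_simp
      linarith
  · have h := NNReal.coe_le_coe.2 (hDle κ.toNNReal)
    push_cast [Real.coe_toNNReal _ hκ.le] at h
    rw [inv_mul_le_iff₀ hκ]
    linarith

/-- A finite non-empty codebook has a measurable nearest-point map. -/
lemma exists_measurable_nearestPoint (nrm : Seminorm ℝ (Fin d → ℝ)) {C : Finset (Fin d → ℝ)}
    (hC : C.Nonempty) : ∃ π : (Fin d → ℝ) → Fin d → ℝ, Measurable π ∧ (∀ x, π x ∈ C) ∧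
      ∀ x, ∀ y ∈ C, nrm (x - π x) ≤ nrm (x - y) := by
  classical
  have hn : Measurable nrm := (seminorm_continuous nrm).measurable
  induction hC using Finset.Nonempty.cons_induction with
  | singleton a => exact ⟨fun _ => a, measurable_const, by simp, by simp⟩
  | cons a s ha hs ih =>
    obtain ⟨π, hπ, hmem, hle⟩ := ih
    have hS : MeasurableSet {x | nrm (x - a) ≤ nrm (x - π x)} :=
      measurableSet_le (hn.comp (measurable_id.sub_const a)) (hn.comp (measurable_id.sub hπ))
    refine ⟨fun x => if nrm (x - a) ≤ nrm (x - π x) then a else π x,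
      Measurable.ite hS measurable_const hπ, fun x => ?_, fun x y hy => ?_⟩
    · dsimp only
      split_ifs <;> simp [hmem x]
    · dsimp only
      rcases Finset.mem_cons.1 hy with rfl | hy
      · split_ifs with h
        · exact le_rfl
        · exact (not_le.1 h).le
      · split_ifs with h
        · exact h.trans (hle x y hy)
        · exact hle x y hy

variable {Ω : Type*} [MeasurableSpace Ω] {P : Measure Ω} {X : Ω → Fin d → ℝ}

/-- Projecting X to a nearest codepoint gives an admissible quantizer whose level is t = 1/s. -/
lemma quantError_le_inv (hφ : Monotone φ) (hX : Measurable X) {s : ℝ≥0} (hs : 0 < s)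
    {C : Finset (Fin d → ℝ)} (hC : C.Nonempty) {N : ℕ} (hN : C.card ≤ N)
    (he : ∫⁻ x, err nrm φ s C x ∂(P.map X) ≤ 1) :
    quantError nrm φ P X N ≤ (s⁻¹ : ℝ≥0) := by
  obtain ⟨π, hπ, hmem, hle⟩ := exists_measurable_nearestPoint nrm hC
  refine iInf_le_of_le (π ∘ X) (iInf₂_le_of_le (hπ.comp hX) ?_ ?_)
  · have hsub : range (π ∘ X) ⊆ (C : Set (Fin d → ℝ)) := range_subset_iff.2 fun ω => hmem _
    refine (encard_le_encard hsub).trans ?_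
    rw [encard_coe_eq_coe_finsetCard]
    exact_mod_cast hN
  · refine iInf_le_of_le s⁻¹ (iInf₂_le_of_le (inv_pos.2 hs) ?_ le_rfl)
    rw [lintegral_map (measurable_err hφ s C) hX] at he
    refine (lintegral_mono fun ω => le_iInf₂ fun y hy => ENNReal.coe_le_coe.2 (hφ ?_)).trans he
    rw [div_inv_eq_mul, mul_comm]
    exact mul_le_mul_right (Real.toNNReal_mono (hle _ y hy)) _

/-- The range of a nearly optimal quantizer is the codebook, at the reciprocal of an admissible
level below `t₀`. -/
lemma exists_codebook_of_quantError_lt (hφ : Monotone φ) (hX : Measurable X) {N : ℕ} {t₀ : ℝ≥0}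
    (h : quantError nrm φ P X N < t₀) : ∃ s : ℝ≥0, t₀⁻¹ ≤ s ∧ ∃ C : Finset (Fin d → ℝ),
      C.card ≤ N ∧ ∫⁻ x, err nrm φ s C x ∂(P.map X) ≤ 1 := by
  simp only [quantError, orliczNorm, iInf_lt_iff] at h
  obtain ⟨Y, hY, hYN, t, ht, hint, htt⟩ := h
  have hfin : (range Y).Finite := finite_of_encard_le_coe hYN
  refine ⟨t⁻¹, inv_anti₀ ht (by exact_mod_cast htt.le), hfin.toFinset, ?_, ?_⟩
  · rw [hfin.encard_eq_coe_toFinset_card] at hYN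
    exact_mod_cast hYN
  · rw [lintegral_map (measurable_err hφ _ _) hX]
    refine (lintegral_mono fun ω => ?_).trans hint
    refine (err_le (y := Y ω) (by simp) _).trans_eq ?_
    rw [div_eq_inv_mul]

/-- Optimal densities are realized only up to an additional error e, so the problem is solved at
level 1 - e. Its optimal cost is at most that of a mixture of the problems at levels 1 and 1/2,
which tends to I as e → 0. -/
lemma achievable_of_allocValue_lt (hc : NormBound nrm c) (hd : 0 < d)
    (hφ : Monotone φ) (hφ₀ : Tendsto φ (𝓝[>] 0) (𝓝 0)) (hφne : φ ≠ 0) (hΨ : Monotone Ψ)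
    (hG : GrowthCondition d φ Ψ) [IsFiniteMeasure μ]
    (hm : ∫⁻ x, (Ψ (nrm x).toNNReal : ℝ≥0∞) ∂μ ≠ ∞) {η : ℝ≥0} (hη : allocValue nrm φ μ < η) :
    Achievable nrm φ μ 1 η := by
  obtain ⟨ξ₁, -, hadm₁, hI₁, -⟩ := exists_isAdmissible_eq_allocValue hc hd hφ hφ₀ hφne hΨ hG hm
  obtain ⟨ξ₂, hξ₂, hle₂, -, hfin₂, -⟩ := exists_optimal_allocation (b := 1 / 2) hc hd hφ hφ₀ hφne
    hΨ hG hm (by norm_num)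
  have hD₁ := dualValue_le_allocValue hc hd hφ hadm₁
  have hD₂ : ∀ κ : ℝ≥0, dualValue nrm φ μ κ ≤ (1 / 2 : ℝ≥0) + κ * ∫⁻ x, ξ₂ x := fun κ =>
    (dualValue_le_of_aemeasurable hc hd hφ hξ₂.aemeasurable κ).trans (add_le_add_left hle₂ _)
  rw [← hI₁] at hη
  lift ∫⁻ x, ξ₁ x to ℝ≥0 using (hη.trans ENNReal.coe_lt_top).ne with I₁
  lift ∫⁻ x, ξ₂ x to ℝ≥0 using hfin₂.ne with I₂
  have hη' : (I₁ : ℝ) < η := by exact_mod_cast hη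
  obtain ⟨e, he0, he2, heη⟩ : ∃ e : ℝ≥0, 0 < e ∧ e ≤ 1 / 2 ∧ I₁ + 2 * e * I₂ + e ≤ η := by
    have hq : 0 < ((η : ℝ) - I₁) / (2 * I₂ + 1) := by
      have := I₂.coe_nonneg
      exact div_pos (by linarith) (by linarith)
    refine ⟨min (1 / 2) (((η : ℝ) - I₁) / (2 * I₂ + 1)).toNNReal,
      lt_min (by norm_num) (Real.toNNReal_pos.2 hq), min_le_left _ _, ?_⟩
    have h := min_le_right (1 / 2) (((η : ℝ) - I₁) / (2 * I₂ + 1)).toNNReal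
    generalize min (1 / 2) (((η : ℝ) - I₁) / (2 * I₂ + 1)).toNNReal = e at h
    rw [← NNReal.coe_le_coe, Real.coe_toNNReal _ hq.le,
      le_div_iff₀ (by have := I₂.coe_nonneg; linarith)] at h
    rw [← NNReal.coe_le_coe]
    push_cast
    linarith
  have he2' : (e : ℝ) ≤ 1 / 2 := by simpa using NNReal.coe_le_coe.2 he2
  have he1 : e ≤ 1 := he2.trans (by norm_num)
  have hpos : 0 < 1 - e := tsub_pos_of_lt (he2.trans_lt (by norm_num))
  obtain ⟨ξ, hξ, hle, -, -, hmin⟩ := exists_optimal_allocation hc hd hφ hφ₀ hφne hΨ hG hm hpos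
  have hξle : ∫⁻ x, ξ x ≤ (I₁ + 2 * e * I₂ : ℝ≥0) := hmin _ fun κ => by
    have h1 := hD₁ κ
    have h2 := hD₂ κ
    lift dualValue nrm φ μ κ to ℝ≥0 using (h1.trans_lt (by finiteness)).ne with D
    have h1' : D ≤ 1 + κ * I₁ := by exact_mod_cast h1
    have h2' : D ≤ 1 / 2 + κ * I₂ := by exact_mod_cast h2
    suffices h : D ≤ (1 - e) + κ * (I₁ + 2 * e * I₂) by exact_mod_cast h
    rw [← NNReal.coe_le_coe] at h1' h2' ⊢
    push_cast [NNReal.coe_sub he1] at h1' h2' ⊢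
    -- With weights 1 - 2e and 2e the levels 1 and 1/2 average to 1 - e.
    have h3 := mul_le_mul_of_nonneg_left h1' (by linarith : 0 ≤ 1 - 2 * (e : ℝ))
    have h4 := mul_le_mul_of_nonneg_left h2' (by positivity : 0 ≤ 2 * (e : ℝ))
    nlinarith [mul_nonneg (mul_nonneg e.coe_nonneg κ.coe_nonneg) I₁.coe_nonneg]
  refine (achievable_of_density hc hd hφ hφ₀ hφne hΨ hG hm hξ he0).mono le_rfl ?_ ?_
  · refine (add_le_add_left hle _).trans ?_
    rw [← ENNReal.coe_add, tsub_add_cancel_of_le he1, ENNReal.coe_one]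
  · refine (add_le_add_left hξle _).trans ?_
    exact_mod_cast heη

lemma mul_rpow_div_inv {N : ℕ} {η : ℝ≥0} (hN : 0 < N) :
    (N : ℝ≥0∞) ^ ((d : ℝ)⁻¹) * (((((N : ℝ≥0) / η) ^ ((d : ℝ)⁻¹))⁻¹ : ℝ≥0) : ℝ≥0∞) =
      (η : ℝ≥0∞) ^ ((d : ℝ)⁻¹) := by
  have hd : 0 ≤ (d : ℝ)⁻¹ := by positivity
  rw [← NNReal.inv_rpow, inv_div, ENNReal.coe_rpow_of_nonneg _ hd, ← ENNReal.mul_rpow_of_nonneg _ _ hd,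
    ← ENNReal.coe_natCast, ← ENNReal.coe_mul, mul_div_cancel₀ _ (by exact_mod_cast hN.ne')]

/-- The asymptotics of the quantization error. -/
lemma tendsto_quantError (hc : NormBound nrm c) (hd : 0 < d)
    (hφ : Monotone φ) (hφ₀ : Tendsto φ (𝓝[>] 0) (𝓝 0)) (hφne : φ ≠ 0) (hΨ : Monotone Ψ)
    (hG : GrowthCondition d φ Ψ) [IsProbabilityMeasure P] (hX : Measurable X)
    (hm : ∫⁻ x, (Ψ (nrm x).toNNReal : ℝ≥0∞) ∂(P.map X) ≠ ∞) :
    Tendsto (fun N : ℕ => (N : ℝ≥0∞) ^ ((d : ℝ)⁻¹) * quantError nrm φ P X N) atTop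
      (𝓝 (allocValue nrm φ (P.map X) ^ ((d : ℝ)⁻¹))) := by
  have hprob : IsProbabilityMeasure (P.map X) := Measure.isProbabilityMeasure_map hX.aemeasurable
  have hd' : (0 : ℝ) < d := by exact_mod_cast hd
  refine tendsto_order.2 ⟨fun e he => ?_, fun e he => ?_⟩
  · rw [ENNReal.lt_rpow_inv_iff hd'] at he
    obtain ⟨η', heη, hηI⟩ := exists_between he
    lift η' to ℝ≥0 using hηI.ne_top with η
    have hη : 0 < η := by exact_mod_cast pos_of_gt heη
    rw [← ENNReal.lt_rpow_inv_iff hd'] at heη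
    by_contra hcon
    rw [not_eventually] at hcon
    obtain ⟨-, -, -, -, -, -, hmin⟩ :=
      exists_isAdmissible_eq_allocValue hc hd hφ hφ₀ hφne hΨ hG hm
    -- Small errors for infinitely many N give codebooks with at most η s^d points at arbitrarily
    -- large scales; the dual inequalities would then force I ≤ η.
    refine hηI.not_ge (hmin _ fun κ => dualValue_le hc hd hφ κ (frequently_atTop.2 fun a => ?_))
    obtain ⟨N, hN, haN, hN0⟩ := (hcon.and_eventually
      (((tendsto_rpow_div_atTop hd hη).eventually_ge_atTop a).and (eventually_gt_atTop 0))).exists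
    have hlt : quantError nrm φ P X N < (((((N : ℝ≥0) / η) ^ ((d : ℝ)⁻¹))⁻¹ : ℝ≥0) : ℝ≥0∞) := by
      by_contra hge
      refine hN (heη.trans_le ?_)
      rw [← mul_rpow_div_inv hN0]
      exact mul_le_mul_right (not_lt.1 hge) _
    obtain ⟨s, hs, C, hCN, hC⟩ := exists_codebook_of_quantError_lt hφ hX hlt
    rw [inv_inv] at hs
    refine ⟨s, haN.trans hs, C, ?_, hC⟩
    have h1 := mul_le_mul_right (pow_le_pow_left₀ zero_le hs d) η
    rw [rpow_inv_pow_natCast hd, mul_div_cancel₀ _ hη.ne'] at h1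
    have h2 : (C.card : ℝ≥0) ≤ η * s ^ d := le_trans (by exact_mod_cast hCN) h1
    exact_mod_cast h2
  · rw [gt_iff_lt, ENNReal.rpow_inv_lt_iff hd'] at he
    obtain ⟨η', hIη, hηe⟩ := exists_between he
    lift η' to ℝ≥0 using hηe.ne_top with η
    have hη : 0 < η := by exact_mod_cast pos_of_gt hIη
    rw [← ENNReal.rpow_inv_lt_iff hd'] at hηe
    filter_upwards [(tendsto_rpow_div_atTop hd hη).eventually
      (achievable_of_allocValue_lt hc hd hφ hφ₀ hφne hΨ hG hm hIη), eventually_gt_atTop 0]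
      with N ⟨C, hCN, hC⟩ hN0
    have hne : C.Nonempty := nonempty_of_setLIntegral_err_lt_top (IsProbabilityMeasure.ne_zero _)
      (hC.trans_lt ENNReal.one_lt_top)
    have h1 : (C.card : ℝ≥0) ≤ η * (((N : ℝ≥0) / η) ^ ((d : ℝ)⁻¹)) ^ d := by exact_mod_cast hCN
    rw [rpow_inv_pow_natCast hd, mul_div_cancel₀ _ hη.ne'] at h1
    have hs : 0 < ((N : ℝ≥0) / η) ^ ((d : ℝ)⁻¹) :=
      NNReal.rpow_pos (div_pos (by exact_mod_cast hN0) hη)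
    refine lt_of_le_of_lt ?_ hηe
    rw [← mul_rpow_div_inv hN0]
    exact mul_le_mul_right (quantError_le_inv hφ hX hs hne (by exact_mod_cast h1) hC) _

end OrliczQuantization
theorem theorem1p1
    {d : ℕ} (hd : 0 < d)
    -- the arbitrary norm on `ℝ^d`
    (nrm : Seminorm ℝ (Fin d → ℝ)) (hnrm : ∀ x, nrm x = 0 → x = 0)
    (φ : ℝ≥0 → ℝ≥0) (hφ_mono : Monotone φ)
    (hφ_left : ∀ t, ContinuousWithinAt φ (Set.Iio t) t)
    (hφ_zero : Tendsto φ (𝓝[>] 0) (𝓝 0)) (hφ_ne : φ ≠ 0)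
    (Ψ : ℝ≥0 → ℝ≥0) (hΨ_mono : Monotone Ψ) (hΨ : GrowthCondition d φ Ψ)
    {Ω : Type*} [MeasurableSpace Ω] (P : Measure Ω) [IsProbabilityMeasure P]
    (X : Ω → Fin d → ℝ) (hX : Measurable X)
    (hXΨ : ∫⁻ ω, (Ψ ((nrm (X ω)).toNNReal) : ℝ≥0∞) ∂P < ∞) :
    -- the limit that defines `g` exists and is finite
    (∀ η : ℝ≥0, 0 < η → complexity nrm φ η < ∞ ∧
      Tendsto (fun N : ℕ => cubeError nrm φ N η) atTop (𝓝 (complexity nrm φ η))) ∧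
    -- the asymptotics of the quantization error
    Tendsto (fun N : ℕ => (N : ℝ≥0∞) ^ ((d : ℝ)⁻¹) * quantError nrm φ P X N) atTop
      (𝓝 (allocValue nrm φ (P.map X) ^ ((d : ℝ)⁻¹))) ∧
    -- `I` is finite and is attained
    allocValue nrm φ (P.map X) < ∞ ∧
    (∃ ξ : (Fin d → ℝ) → ℝ≥0, IsAdmissible nrm φ (P.map X) ξ ∧
      ∫⁻ x, (ξ x : ℝ≥0∞) = allocValue nrm φ (P.map X)) ∧
    -- the dual formula
    ((allocValue nrm φ (P.map X) : ℝ≥0∞) : EReal) =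
      ⨆ (κ : ℝ) (_ : 0 < κ), ((κ⁻¹ : ℝ) : EReal) *
        (((∫⁻ x, complexityBar nrm φ (ENNReal.ofReal κ / acDensity (P.map X) x)
            ∂(acPart (P.map X)) : ℝ≥0∞) : EReal) - 1) ∧
    -- positivity of `I`
    (0 < allocValue nrm φ (P.map X) ↔
      1 < acPart (P.map X) Set.univ * ⨆ t : ℝ≥0, (φ t : ℝ≥0∞)) := by
  obtain ⟨c, hc⟩ := exists_normBound hd hnrm
  have hm : ∫⁻ x, (Ψ (nrm x).toNNReal : ℝ≥0∞) ∂(P.map X) ≠ ∞ := by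
    have hnm : Measurable fun x : Fin d → ℝ => (nrm x).toNNReal :=
      (continuous_real_toNNReal.comp (seminorm_continuous nrm)).measurable
    have hΨm : Measurable fun x : Fin d → ℝ => (Ψ (nrm x).toNNReal : ℝ≥0∞) :=
      (hΨ_mono.measurable.comp hnm).coe_nnreal_ennreal
    rw [lintegral_map hΨm hX]
    exact hXΨ.ne
  have hprob : IsProbabilityMeasure (P.map X) := Measure.isProbabilityMeasure_map hX.aemeasurable
  obtain ⟨ξ, -, hadm, hI, hfin, -⟩ :=
    exists_isAdmissible_eq_allocValue hc hd hφ_mono hφ_zero hφ_ne hΨ_mono hΨ hm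
  refine ⟨fun η hη => ⟨complexity_lt_top hc hd hφ_mono hη, ?_⟩,
    tendsto_quantError hc hd hφ_mono hφ_zero hφ_ne hΨ_mono hΨ hX hm, hfin, ⟨ξ, hadm, hI⟩,
    allocValue_eq_iSup hc hd hφ_mono hφ_zero hφ_ne hΨ_mono hΨ hm,
    allocValue_pos_iff hc hd hφ_mono hφ_zero hφ_ne hΨ_mono hΨ hm⟩
  rw [complexity_eq_limErr hc hd hφ_mono hη]
  exact tendsto_cubeError hc hd hφ_mono hη
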